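/- Let $x>0$ be real, $\mathcal{A}=(a_n)_{n\le x}$ a complex sequence, and put $$\mathcal{A}(z;q,a)=\sum_{n\le z,\ n\equiv a\ (q)}a_n,\qquad \mathrm{Aver}(\mathcal{A},z;q,h)=\frac1{\phi(q/h)}\sum_{1\le a\le q,\ (a,q)=h}\mathcal{A}(z;q,a)\quad(h\mid q),$$ $$V(\mathcal{A},x,Q)=\sum_{Q/2<q\le Q}\ \sum_{1\le a\le q}\bigl|\mathcal{A}(x;q,a)-\mathrm{Aver}(\mathcal{A},x;q,(a,q))\bigr|^2 .$$ Let $\tau(n)$ be the divisor function, $\tau_3(n)$ the number of triples of positive integers with product $n$, and, for real $y$, let $\tau_3^{y}$ be the multiplicative function which agrees with $\tau_3$ on powers of primes $p\le y$ and equals $1$ on powers of primes $p>y$. Let $\{v\}$ denote the fractional part of $v$. There are absolute constants $C,x_0>0$ such that the following holds for all $x\ge x_0$, all $\sqrt{2x}<Q\le x$ and every complex sequence $\mathcal{A}=(a_n)_{n\le x}$. Suppose that, for some $K_{\rm prog}>0$, for some $K_{\rm conc}[H]>0$ (for each real $H\le Q$), for some $3\le P\le R\le x^{1/10}$, and for some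 $K_{\rm int}^{(1)},K_{\rm int}^{(2)}>0$ and $K_{\rm int}^{(3)}\ge 1$ (all of which may depend on $\mathcal{A},x,Q$): (Progressions Condition) $$\sum_{1\le r\le 2x/Q}\ \sum_{1\le a\le r}\Bigl(\sum_{n\le x,\ n\equiv a\ (r)}|a_n|\Bigr)\max_{z\le x}\bigl|\mathcal{A}(z;r,a)-\mathrm{Aver}(\mathcal{A},z;r,(a,r))\bigr|\le\frac{(\sum_{n\le x}|a_n|)^2}{K_{\rm prog}};$$ (Non-concentration on Multiples) for all $H\le Q$, $$\sum_{H\le h\le Q}\Bigl(\sum_{n\le x,\ h\mid n}|a_n|\Bigr)^2\le\frac{(\sum_{n\le x}|a_n|)^2}{K_{\rm conc}[H]};$$ (Resembles the Integers I) for every positive integer $h$ and every interval $I\subseteq[1,x/h]$ of length $|I|$, $$\Bigl|\sum_{n\in I,\ p\mid n\Rightarrow p>P}a_{nh}-\frac{\sum_{n\le x}a_n}{x}\sum_{n\in I,\ p\mid n\Rightarrow p>P}1\Bigr|\le\frac{|I|}{K_{\rm int}^{(1)}}\frac{\sum_{n\le x}|a_n|}{x}+\frac{\sum_{n\le x}|a_n|}{K_{\rm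 int}^{(2)}},$$ where $p$ denotes primes; (Resembles the Integers II) for every positive integer $h$ and every interval $I\subseteq[1,x/h]$, $$\sum_{n\in I}|a_{nh}|\tau(n)\le K_{\rm int}^{(3)}|I|\frac{\sum_{n\le x}|a_n|}{x}+\frac{\sum_{n\le x}|a_n|}{K_{\rm int}^{(2)}}.$$ Then $$V(\mathcal{A},x,Q)=\frac Q2\sum_{n\le x}|a_n|^2-\frac Q2\frac{|\sum_{n\le x}a_n|^2}{x}+\Bigl|\sum_{n\le x}a_n\Bigr|^2\int_{x/Q}^{2x/Q}\{v\}(1-\{v\})\frac{dv}{v^3}+E,$$ where $$\begin{aligned}|E|\le C\Biggl[&\sum_{n\le x}|a_n|^2\tau(n)+\Bigl(\sum_{n\le x}|a_n|\Bigr)^2\Bigl(\frac1{K_{\rm prog}}+\frac{\log x}{P(\log P)K_{\rm conc}[1]}+\frac{\log P}{K_{\rm int}^{(1)}}\sqrt{\frac{Q}{xK_{\rm conc}[2x/Q]}}\Bigr)\\&+\Bigl(\sum_{n\le x}|a_n|\Bigr)\log^6\Bigl(\frac{Px}Q\Bigr)\Bigl(\frac{Q}{xK_{\rm int}^{(1)}}\sum_{n\le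 x}|a_n|\tau_3^{Px/Q}(n)+(\log^3x)\Bigl(\frac{RP}{K_{\rm int}^{(2)}}+\frac{QK_{\rm int}^{(3)}}{xR^{1/\log P}}\Bigr)\sum_{n\le x}|a_n|\tau_3(n)\Bigr)\Biggr].\end{aligned}$$ -/

import Mathlib

namespace APVariance

noncomputable section

open scoped Classical

/-- The positive integers `n ≤ x`. -/
def upTo (x : ℝ) : Finset ℕ := Finset.Icc 1 ⌊x⌋₊

/-- `𝒜(z; q, b)`: the sum of `a n` over positive integers `n ≤ z` with `n ≡ b mod q`. -/
def progSum (a : ℕ → ℂ) (z : ℝ) (q b : ℕ) : ℂ :=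
  ∑ n ∈ (upTo z).filter (fun n : ℕ => n ≡ b [MOD q]), a n

/-- `Aver(𝒜, z; q, h)`, for `h ∣ q`. -/
def aver (a : ℕ → ℂ) (z : ℝ) (q h : ℕ) : ℂ :=
  (1 / ((Nat.totient (q / h) : ℕ) : ℂ)) *
    ∑ b ∈ (Finset.Icc 1 q).filter (fun b : ℕ => Nat.gcd b q = h), progSum a z q b

/-- The variance `V(𝒜, x, Q)`. -/
def variance (a : ℕ → ℂ) (x Q : ℝ) : ℝ :=
  ∑ q ∈ (upTo Q).filter (fun q : ℕ => Q / 2 < (q : ℝ)), ∑ b ∈ Finset.Icc 1 q,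
    ‖progSum a x q b - aver a x q (Nat.gcd b q)‖ ^ 2

/-- `∑_{n ≤ x} a n`. -/
def total (a : ℕ → ℂ) (x : ℝ) : ℂ := ∑ n ∈ upTo x, a n

/-- `∑_{n ≤ x} |a n|`. -/
def absTotal (a : ℕ → ℂ) (x : ℝ) : ℝ := ∑ n ∈ upTo x, ‖a n‖

/-- The divisor function. -/
def tau (n : ℕ) : ℕ := n.divisors.card

/-- The threefold divisor function: the number of triples `(u, v, w)` of positive integers with
`u * v * w = n`, for `n ≥ 1`. -/
def tau3 (n : ℕ) : ℕ :=
  ((n.divisors ×ˢ n.divisors ×ˢ n.divisors).filter (fun t => t.1 * t.2.1 * t.2.2 = n)).card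

/-- The multiplicative function that agrees with `tau3` on powers of primes `p ≤ y` and is `1` on
powers of larger primes. -/
def tau3Smooth (y : ℝ) (n : ℕ) : ℕ :=
  n.factorization.prod (fun p k => if (p : ℝ) ≤ y then tau3 (p ^ k) else 1)

/-- All prime factors of `n` are larger than `P`. -/
def Rough (P : ℝ) (n : ℕ) : Prop := ∀ p : ℕ, p.Prime → p ∣ n → P < (p : ℝ)

/-- The positive integers in a bounded set `I` of reals, for `I ⊆ [1, y]`. -/
def intsIn (I : Set ℝ) (y : ℝ) : Finset ℕ := (upTo y).filter (fun n : ℕ => (n : ℝ) ∈ I)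

/-- `max_{z ≤ x} |𝒜(z; r, b) - Aver(𝒜, z; r, (b, r))|`. -/
def maxDiscrepancy (a : ℕ → ℂ) (x : ℝ) (r b : ℕ) : ℝ :=
  ⨆ z : Set.Iic x, ‖progSum a (z : ℝ) r b - aver a (z : ℝ) r (Nat.gcd b r)‖

/-- The supremum in `maxDiscrepancy` is over a finite set of values, so it is a maximum. -/
theorem finite_range_discrepancy (a : ℕ → ℂ) (x : ℝ) (r b : ℕ) :
    (Set.range (fun z : Set.Iic x =>
      ‖progSum a (z : ℝ) r b - aver a (z : ℝ) r (Nat.gcd b r)‖)).Finite := by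
  refine ((Finset.range (⌊x⌋₊ + 1)).image (fun N : ℕ =>
    ‖progSum a (N : ℝ) r b - aver a (N : ℝ) r (Nat.gcd b r)‖)).finite_toSet.subset ?_
  rintro _ ⟨⟨z, hz⟩, rfl⟩
  simp only [Finset.coe_image, Set.mem_image, Finset.mem_coe, Finset.mem_range]
  refine ⟨⌊z⌋₊, Nat.lt_succ_of_le (Nat.floor_le_floor hz), ?_⟩
  simp [progSum, aver, upTo]

/-- The Progressions Condition with parameter `K = K_prog`. -/
def ProgressionsCondition (a : ℕ → ℂ) (x Q K : ℝ) : Prop :=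
  ∑ r ∈ upTo (2 * x / Q), ∑ b ∈ Finset.Icc 1 r,
      (∑ n ∈ (upTo x).filter (fun n : ℕ => n ≡ b [MOD r]), ‖a n‖) * maxDiscrepancy a x r b
    ≤ absTotal a x ^ 2 / K

/-- Non-concentration on Multiples, with parameters `K H = K_conc[H]`. -/
def NonConcentration (a : ℕ → ℂ) (x Q : ℝ) (K : ℝ → ℝ) : Prop :=
  ∀ H : ℝ, H ≤ Q →
    ∑ h ∈ (upTo Q).filter (fun h : ℕ => H ≤ (h : ℝ)),
        (∑ n ∈ (upTo x).filter (fun n : ℕ => h ∣ n), ‖a n‖) ^ 2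
      ≤ absTotal a x ^ 2 / K H

/-- Resembles the Integers I. The intervals `I` may be open, closed or half-open, empty or a
single point. -/
def ResemblesIntegersI (a : ℕ → ℂ) (x P K₁ K₂ : ℝ) : Prop :=
  ∀ h : ℕ, 1 ≤ h → ∀ I : Set ℝ, I.OrdConnected → I ⊆ Set.Icc 1 (x / h) →
    ‖∑ n ∈ (intsIn I (x / h)).filter (Rough P), a (n * h)
        - total a x / (x : ℂ) * ∑ _n ∈ (intsIn I (x / h)).filter (Rough P), (1 : ℂ)‖
      ≤ (MeasureTheory.volume I).toReal / K₁ * (absTotal a x / x) + absTotal a x / K₂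

/-- Resembles the Integers II. -/
def ResemblesIntegersII (a : ℕ → ℂ) (x K₂ K₃ : ℝ) : Prop :=
  ∀ h : ℕ, 1 ≤ h → ∀ I : Set ℝ, I.OrdConnected → I ⊆ Set.Icc 1 (x / h) →
    ∑ n ∈ intsIn I (x / h), ‖a (n * h)‖ * (tau n : ℝ)
      ≤ K₃ * (MeasureTheory.volume I).toReal * (absTotal a x / x) + absTotal a x / K₂

end

end APVariance

namespace APVariance

noncomputable section

open scoped Classical

open Finset ComplexConjugate

/-! Averaging over residues having the same gcd with `q` is an orthogonal projection, with kernel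
`gcdWeight q`. Expanding the square therefore leaves, for each `q`, the quadratic form in `a` with
kernel `1_{m ≡ n (q)} - gcdWeight q m n`. The diagonal `m = n` of the congruence part gives `Q / 2 *
∑ |a n|²`, up to a bounded multiple of `∑ |a n|²`.

Off the diagonal, a `q` in `(Q/2, Q]` dividing `|m - n|` is traded for the complementary divisor
`r`. The range of `r` is again dyadic, `r < j ≤ 2r` with `j = ⌈2|m - n| / Q⌉`, and `r < 2x / Q` is
short. Replacing `1_{m ≡ n (r)}` by `gcdWeight r m n` costs the Progressions Condition
(`norm_sum_progression_error_le`). What remains is `pairWeight`, the difference of the averaged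
kernels summed over the `r` and over the `q`.

Sorting by the common gcd `h` of `m` and `n` with the modulus, `pairWeight` becomes a sum over `h ∣
(m, n)` of differences of two sums of `1 / φ(r)` over dyadic ranges, restricted to `r` coprime to `k
= (m / h)(n / h)`. Since `r / φ(r)` is the divisor sum of `beta`, such a sum has a limit depending
only on `k`, reached with error `τ(k)(1 + log j) / j` (`exists_abs_dyadicTotientSum_sub_le`). So the
weights nearly cancel and decay in `j`, and summing over `j` costs only logarithms.

This decay allows `a` to be replaced by its mean. Primes above `P` are removed from the coprimality
condition at cost `log x / (P log P)`, which Non-concentration from `H = 1` on absorbs. For fixed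
`m`, the `n` with given `j` form two intervals of length at most `Q`, on which the weight depends
only on the `P`-smooth part of `n`. Smooth parts `s ≤ R` are treated by Resembles the Integers I on
the rough cofactors; larger ones by Resembles II and Rankin's trick, whence the factor `R^(-1 / log
P)` (`exists_norm_block_sum_le`). For `h ≥ 2x / Q` the index is at most 1, one of the two sums is
empty, and Cauchy-Schwarz with Non-concentration from `2x / Q` on takes over.

With one variable replaced by the mean, the row sums of `pairWeight` are computed over all integers:
on average `gcdWeight r m n` is `1 / r`, so `pairWeight` turns into `dyadicDefect j`, a dyadic
harmonic sum minus `log 2`. This weight depends on `j` alone, so the other variable may be replaced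
as well. There remains the sum of `dyadicDefect` over pairs of integers up to `x`. Counting pairs at
distance in `(rQ/2, rQ]` expresses it through `∑ (1/r) max(0, 1 - r/v)²` at `v = x/Q` and `v =
2x/Q`. The integral of `{v}(1 - {v}) / v³` has the same endpoint values up to `log 2` and `Q / (2x)`
(`integral_fract_eq`), and this `Q / (2x)` is the source of the second main term. -/

/-! ### Bounds for the divisor function and for reciprocals of the totient -/

theorem tau_mul_le (m n : ℕ) : tau (m * n) ≤ tau m * tau n := by
  unfold tau
  rw [Nat.divisors_mul]
  exact Finset.card_mul_le

theorem tau_le_of_dvd {m n : ℕ} (hn : n ≠ 0) (h : m ∣ n) : tau m ≤ tau n :=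
  Finset.card_le_card (Nat.divisors_subset_of_dvd hn h)

theorem one_le_tau {n : ℕ} (hn : n ≠ 0) : 1 ≤ tau n :=
  Finset.card_pos.mpr ⟨1, by simp [hn]⟩

/-- The tangent line of the exponential at 0 suffices, because `24 > 16 / log 2`. -/
theorem add_one_le_mul_two_rpow (k : ℕ) : (k : ℝ) + 1 ≤ 24 * (2 : ℝ) ^ ((k : ℝ) / 16) := by
  have h1 : (2 : ℝ) ^ ((k : ℝ) / 16) = Real.exp (Real.log 2 * (k / 16)) := by
    rw [Real.rpow_def_of_pos (by norm_num)]
  have h2 := Real.add_one_le_exp (Real.log 2 * ((k : ℝ) / 16))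
  have h3 := Real.log_two_gt_d9
  rw [h1]
  have hk : (0 : ℝ) ≤ k := Nat.cast_nonneg k
  nlinarith

/-- The divisor bound with exponent `1 / 16`. -/
theorem exists_tau_le_rpow :
    ∃ C : ℝ, 1 ≤ C ∧ ∀ n : ℕ, n ≠ 0 → (tau n : ℝ) ≤ C * (n : ℝ) ^ (1 / 16 : ℝ) := by
  -- From `M` on, `p ^ (1/16) ≥ 2`, so `k + 1 ≤ 2 ^ k` gives the local bound without loss. Only the
  -- fewer than `M` smaller primes cost a factor 24 each.
  obtain ⟨M, hM⟩ : ∃ M : ℕ, ∀ p : ℕ, M ≤ p → (2 : ℝ) ≤ (p : ℝ) ^ (1 / 16 : ℝ) := by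
    have h := (tendsto_rpow_atTop (y := (1 / 16 : ℝ)) (by norm_num)).comp
      (tendsto_natCast_atTop_atTop (R := ℝ))
    have h2 := h.eventually_ge_atTop 2
    rw [Filter.eventually_atTop] at h2
    exact h2
  refine ⟨24 ^ M, one_le_pow₀ (by norm_num), fun n hn => ?_⟩
  have e1 : (tau n : ℝ) = ∏ p ∈ n.primeFactors, ((n.factorization p : ℝ) + 1) := by
    unfold tau; rw [Nat.card_divisors hn]; push_cast; rfl
  have e2 : (n : ℝ) ^ (1 / 16 : ℝ)
      = ∏ p ∈ n.primeFactors, ((p : ℝ) ^ (1 / 16 : ℝ)) ^ (n.factorization p) := by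
    conv_lhs => rw [← Nat.prod_factorization_pow_eq_self hn]
    rw [Finsupp.prod, Nat.support_factorization]
    push_cast
    rw [← Real.finsetProd_rpow _ _ (fun i _ => by positivity)]
    refine Finset.prod_congr rfl fun p _ => ?_
    rw [← Real.rpow_natCast, ← Real.rpow_natCast, ← Real.rpow_mul (by positivity),
      ← Real.rpow_mul (by positivity), mul_comm]
  have key : ∀ p ∈ n.primeFactors, ((n.factorization p : ℝ) + 1)
      ≤ (if p < M then (24 : ℝ) else 1) * ((p : ℝ) ^ (1 / 16 : ℝ)) ^ (n.factorization p) := by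
    intro p hp
    have hp2 : (2 : ℝ) ≤ p := by exact_mod_cast (Nat.prime_of_mem_primeFactors hp).two_le
    set k := n.factorization p
    split_ifs with h
    · have := add_one_le_mul_two_rpow k
      refine this.trans ?_
      have : (2 : ℝ) ^ ((k : ℝ) / 16) ≤ ((p : ℝ) ^ (1 / 16 : ℝ)) ^ k := by
        rw [← Real.rpow_natCast, ← Real.rpow_mul (by positivity)]
        rw [show (1 / 16 : ℝ) * k = k / 16 by ring]
        exact Real.rpow_le_rpow (by norm_num) hp2 (by positivity)
      linarith
    · push Not at h
      have h2 := hM p h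
      rw [one_mul]
      have h3 : (2 : ℝ) ^ k ≤ ((p : ℝ) ^ (1 / 16 : ℝ)) ^ k := by gcongr
      have h4 : ((k + 1 : ℕ) : ℝ) ≤ (2 : ℝ) ^ k := by
        exact_mod_cast Nat.lt_two_pow_self (n := k)
      push_cast at h4
      linarith
  rw [e1, e2]
  calc _ ≤ ∏ p ∈ n.primeFactors, (if p < M then (24 : ℝ) else 1)
          * ((p : ℝ) ^ (1 / 16 : ℝ)) ^ (n.factorization p) :=
        Finset.prod_le_prod (fun i _ => by positivity) key
    _ ≤ _ := by
      rw [Finset.prod_mul_distrib]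
      refine mul_le_mul_of_nonneg_right ?_ (Finset.prod_nonneg fun i _ => by positivity)
      rw [Finset.prod_ite, Finset.prod_const, Finset.prod_const_one, mul_one]
      refine pow_le_pow_right₀ (by norm_num) ?_
      calc _ ≤ (Finset.range M).card := Finset.card_le_card fun p hp => by
            simp only [Finset.mem_filter] at hp; exact Finset.mem_range.2 hp.2
        _ = M := Finset.card_range M

/-- By multiplicativity this reduces to `p ≤ (k + 1)(p - 1)` at `p ^ k`. Together with the divisor
bound it gives a lower bound for `φ` with a small power loss. -/
theorem le_tau_mul_totient (n : ℕ) : n ≤ tau n * n.totient := by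
  induction n using Nat.recOnPosPrimePosCoprime with
  | zero => simp
  | one => simp [tau]
  | prime_pow p k hp hk =>
    rw [tau, Nat.divisors_prime_pow hp, Finset.card_map, Finset.card_range,
      Nat.totient_prime_pow hp hk]
    obtain ⟨j, rfl⟩ : ∃ j, k = j + 1 := ⟨k - 1, by omega⟩
    obtain ⟨q, rfl⟩ : ∃ q, p = q + 2 := ⟨p - 2, by have := hp.two_le; omega⟩
    rw [show j + 1 - 1 = j by omega, show q + 2 - 1 = q + 1 by omega, pow_succ]
    have : q + 2 ≤ (j + 1 + 1) * (q + 1) := by nlinarith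
    calc (q + 2) ^ j * (q + 2) ≤ (q + 2) ^ j * ((j + 1 + 1) * (q + 1)) := by gcongr
      _ = _ := by ring
  | coprime a b ha hb hab iha ihb =>
    rw [Nat.totient_mul hab]
    have : tau (a * b) = tau a * tau b := by
      unfold tau; exact hab.card_divisors_mul
    rw [this]
    calc a * b ≤ (tau a * a.totient) * (tau b * b.totient) := Nat.mul_le_mul iha ihb
      _ = _ := by ring

/-- The summatory function of `beta` over the divisors of `r` is `r / φ(r)`. -/
def beta (d : ℕ) : ℝ := if Squarefree d then 1 / (d.totient : ℝ) else 0

theorem beta_nonneg (d : ℕ) : 0 ≤ beta d := by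
  unfold beta; split_ifs <;> positivity

theorem beta_le (d : ℕ) : beta d ≤ 1 / (d.totient : ℝ) := by
  unfold beta; split_ifs
  · exact le_rfl
  · positivity

theorem totient_prod_primes (t : Finset ℕ) (ht : ∀ p ∈ t, p.Prime) :
    (∏ p ∈ t, p).totient = ∏ p ∈ t, (p - 1) := by
  induction t using Finset.induction_on with
  | empty => simp
  | insert p t hp ih =>
    rw [Finset.prod_insert hp, Finset.prod_insert hp, Nat.totient_mul,
      Nat.totient_prime (ht p (by simp)), ih fun q hq => ht q (by simp [hq])]
    refine Nat.Coprime.prod_right fun q hq => ?_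
    rw [Nat.coprime_primes (ht p (by simp)) (ht q (by simp [hq]))]
    rintro rfl; exact hp hq

/-- Expand `∏ (1 + 1/(p - 1))` over sets of primes dividing `r`; these sets are the squarefree
divisors. The identity turns sums of `1 / φ(r)` into harmonic sums. -/
theorem sum_divisors_beta {r : ℕ} (hr : r ≠ 0) :
    ∑ d ∈ r.divisors, beta d = r / (r.totient : ℝ) := by
  have h1 : ∑ d ∈ r.divisors, beta d = ∑ d ∈ r.divisors with Squarefree d, 1 / (d.totient : ℝ) := by
    rw [Finset.sum_filter]; rfl
  rw [h1, Nat.sum_divisors_filter_squarefree hr, Nat.factors_eq]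
  have h2 : ∀ i ∈ (r.primeFactors).powerset, 1 / ((i.val.prod).totient : ℝ)
      = ∏ p ∈ i, (1 / ((p : ℝ) - 1)) := by
    intro i hi
    have hi' := Finset.mem_powerset.1 hi
    have : i.val.prod = ∏ p ∈ i, p := by rw [Finset.prod, Multiset.map_id']
    rw [this, totient_prod_primes i fun p hp => Nat.prime_of_mem_primeFactors (hi' hp),
      Nat.cast_prod, Finset.prod_div_distrib, Finset.prod_const_one]
    congr 1
    refine Finset.prod_congr rfl fun p hp => ?_
    rw [Nat.cast_sub (Nat.prime_of_mem_primeFactors (hi' hp)).one_le, Nat.cast_one]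
  have h3 : (Multiset.toFinset (↑r.primeFactorsList : Multiset ℕ)) = r.primeFactors := rfl
  rw [h3, Finset.sum_congr rfl h2, ← Finset.prod_one_add]
  have hφ : (r.totient : ℝ) ≠ 0 := by
    have := Nat.totient_pos.2 (Nat.pos_of_ne_zero hr); positivity
  have h4 := Nat.totient_mul_prod_primeFactors r
  have h4' : (r.totient : ℝ) * ∏ p ∈ r.primeFactors, (p : ℝ)
      = r * ∏ p ∈ r.primeFactors, ((p : ℝ) - 1) := by
    have := congrArg (Nat.cast : ℕ → ℝ) h4
    push_cast at this
    rw [this]; congr 1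
    refine Finset.prod_congr rfl fun p hp => ?_
    rw [Nat.cast_sub (Nat.prime_of_mem_primeFactors hp).one_le, Nat.cast_one]
  have hpos : ∀ p ∈ r.primeFactors, (0 : ℝ) < (p : ℝ) - 1 := fun p hp => by
    have : (2 : ℝ) ≤ p := by exact_mod_cast (Nat.prime_of_mem_primeFactors hp).two_le
    linarith
  have h5 : ∏ p ∈ r.primeFactors, (1 + 1 / ((p : ℝ) - 1))
      = (∏ p ∈ r.primeFactors, (p : ℝ)) / ∏ p ∈ r.primeFactors, ((p : ℝ) - 1) := by
    rw [← Finset.prod_div_distrib]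
    refine Finset.prod_congr rfl fun p hp => ?_
    have := hpos p hp
    field_simp; ring
  rw [h5, div_eq_div_iff (Finset.prod_pos hpos).ne' hφ]
  linarith

theorem exists_sum_inv_totient_mul_le :
    ∃ C : ℝ, 0 < C ∧ ∀ n : ℕ, ∑ d ∈ Finset.Icc 1 n, 1 / ((d : ℝ) * d.totient) ≤ C := by
  obtain ⟨C, hC, h⟩ := exists_tau_le_rpow
  have hs : Summable fun n : ℕ => 1 / (n : ℝ) ^ (31 / 16 : ℝ) :=
    Real.summable_one_div_nat_rpow.2 (by norm_num)
  refine ⟨C * (∑' n : ℕ, 1 / (n : ℝ) ^ (31 / 16 : ℝ)) + 1, ?_, fun n => ?_⟩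
  · have : 0 ≤ ∑' n : ℕ, 1 / (n : ℝ) ^ (31 / 16 : ℝ) := tsum_nonneg fun n => by positivity
    positivity
  have h1 : ∑ d ∈ Finset.Icc 1 n, 1 / ((d : ℝ) * d.totient)
      ≤ ∑ d ∈ Finset.Icc 1 n, C * (1 / (d : ℝ) ^ (31 / 16 : ℝ)) := by
    refine Finset.sum_le_sum fun d hd => ?_
    have hd0 : d ≠ 0 := by have := (Finset.mem_Icc.1 hd).1; omega
    have hdp : (0 : ℝ) < d := by positivity
    have hφ : (0 : ℝ) < d.totient := by exact_mod_cast Nat.totient_pos.2 (Nat.pos_of_ne_zero hd0)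
    have h2 : (d : ℝ) ≤ C * (d : ℝ) ^ (1 / 16 : ℝ) * d.totient := by
      calc (d : ℝ) ≤ tau d * d.totient := by exact_mod_cast le_tau_mul_totient d
        _ ≤ _ := by gcongr; exact h d hd0
    rw [mul_one_div, div_le_div_iff₀ (by positivity) (by positivity), one_mul]
    calc (d : ℝ) ^ (31 / 16 : ℝ) = (d : ℝ) ^ (15 / 16 : ℝ) * d := by
          conv_rhs => rw [← Real.rpow_one (d : ℝ), ← Real.rpow_mul hdp.le, ← Real.rpow_add hdp]
          norm_num
      _ ≤ (d : ℝ) ^ (15 / 16 : ℝ) * (C * (d : ℝ) ^ (1 / 16 : ℝ) * d.totient) := by gcongr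
      _ = C * (((d : ℝ) ^ (15 / 16 : ℝ) * (d : ℝ) ^ (1 / 16 : ℝ)) * d.totient) := by ring
      _ = _ := by rw [← Real.rpow_add hdp]; norm_num
  refine h1.trans ?_
  rw [← Finset.mul_sum]
  have := hs.sum_le_tsum (Finset.Icc 1 n) (fun i _ => by positivity)
  nlinarith

/-! ### Harmonic and totient sums over dyadic ranges -/

/-- The integers `r` with `r < j ≤ 2r`. -/
def dyadic (j : ℕ) : Finset ℕ := (Finset.range j).filter (fun r => j ≤ 2 * r)

theorem mem_dyadic {j r : ℕ} : r ∈ dyadic j ↔ r < j ∧ j ≤ 2 * r := by simp [dyadic]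

theorem pos_of_mem_dyadic {j r : ℕ} (h : r ∈ dyadic j) : 0 < r := by
  rw [mem_dyadic] at h; omega

/-- The convention `r < j ≤ 2r` is exactly stable under division: both inequalities for `d * f`
become those for `f` with `j` replaced by `⌈j / d⌉`, without boundary error. -/
theorem sum_dyadic_dvd {M : Type*} [AddCommMonoid M] (j : ℕ) {d : ℕ} (hd : 0 < d) (g : ℕ → M) :
    ∑ r ∈ (dyadic j).filter (d ∣ ·), g r = ∑ f ∈ dyadic (j ⌈/⌉ d), g (d * f) := by
  symm
  have hm : ∀ f, f ∈ dyadic (j ⌈/⌉ d) ↔ d * f ∈ dyadic j := by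
    intro f
    rw [mem_dyadic, mem_dyadic, ceilDiv_le_iff_le_mul hd, ← not_le, ceilDiv_le_iff_le_mul hd,
      ← not_le, mul_left_comm]
  refine Finset.sum_bij (fun f _ => d * f) ?_ ?_ ?_ ?_
  · intro f hf
    exact Finset.mem_filter.2 ⟨(hm f).1 hf, dvd_mul_right d f⟩
  · intro a _ b _ hab
    exact Nat.eq_of_mul_eq_mul_left hd hab
  · intro b hb
    obtain ⟨hb, f, rfl⟩ := Finset.mem_filter.1 hb
    exact ⟨f, (hm f).2 hb, rfl⟩
  · intro _ _; rfl

/-- Induction on `j` using `1/(j+1) ≤ log (1 + 1/j) ≤ 1/j`; the excess in the upper bound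
telescopes. -/
theorem log_le_sum_Ico {a j : ℕ} (ha : 0 < a) (h : a ≤ j) :
    Real.log j - Real.log a ≤ ∑ r ∈ Finset.Ico a j, 1 / (r : ℝ) ∧
    ∑ r ∈ Finset.Ico a j, 1 / (r : ℝ) ≤ Real.log j - Real.log a + 1 / a - 1 / j := by
  induction j, h using Nat.le_induction with
  | base => simp
  | succ j hj ih =>
    rw [Finset.sum_Ico_succ_top hj]
    have hj0 : (0 : ℝ) < j := by exact_mod_cast (by omega : 0 < j)
    have e : Real.log (j + 1 : ℕ) = Real.log j + Real.log (1 + 1 / j) := by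
      rw [← Real.log_mul hj0.ne' (by positivity)]
      congr 1; push_cast; field_simp
    have u1 : Real.log (1 + 1 / j) ≤ 1 / (j : ℝ) := by
      have := Real.log_le_sub_one_of_pos (x := 1 + 1 / (j : ℝ)) (by positivity)
      linarith
    have u2 : 1 / ((j + 1 : ℕ) : ℝ) ≤ Real.log (1 + 1 / j) := by
      have := Real.one_sub_inv_le_log_of_pos (x := 1 + 1 / (j : ℝ)) (by positivity)
      refine le_trans (le_of_eq ?_) this
      push_cast; field_simp; ring
    rw [e]
    constructor
    · linarith [ih.1]
    · linarith [ih.2]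

theorem dyadic_eq_Ico (j : ℕ) : dyadic j = Finset.Ico ((j + 1) / 2) j := by
  ext r; rw [mem_dyadic, Finset.mem_Ico]; omega

/-- The range starts at `⌈j/2⌉`, so the comparison with `log j - log ⌈j/2⌉` loses at most `1/j` on
either side. -/
theorem abs_sum_dyadic_inv_sub_log_two {j : ℕ} (hj : 0 < j) :
    |∑ r ∈ dyadic j, 1 / (r : ℝ) - Real.log 2| ≤ 1 / j := by
  rw [dyadic_eq_Ico]
  set a := (j + 1) / 2 with ha
  have ha0 : 0 < a := by omega
  obtain ⟨h1, h2⟩ := log_le_sum_Ico ha0 (show a ≤ j by omega)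
  have hj0 : (0 : ℝ) < j := by exact_mod_cast hj
  have haR : (0 : ℝ) < a := by exact_mod_cast ha0
  have b1 : (j : ℝ) ≤ 2 * a := by exact_mod_cast (by omega : j ≤ 2 * a)
  have b2 : 2 * (a : ℝ) ≤ j + 1 := by exact_mod_cast (by omega : 2 * a ≤ j + 1)
  have c1 : Real.log j ≤ Real.log 2 + Real.log a := by
    rw [← Real.log_mul (by norm_num) haR.ne']
    exact Real.log_le_log hj0 b1
  have c2 : Real.log 2 + Real.log a ≤ Real.log j + 1 / j := by
    rw [← Real.log_mul (by norm_num) haR.ne']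
    have : Real.log (2 * a) ≤ Real.log (j * (1 + 1 / j)) := by
      refine Real.log_le_log (by positivity) ?_
      have : (j : ℝ) * (1 + 1 / j) = j + 1 := by field_simp
      linarith
    rw [Real.log_mul hj0.ne' (by positivity)] at this
    have u1 := Real.log_le_sub_one_of_pos (x := 1 + 1 / (j : ℝ)) (by positivity)
    linarith
  have c3 : 1 / (a : ℝ) ≤ 2 / j := by
    rw [div_le_div_iff₀ haR hj0]; linarith
  have c4 : (2 : ℝ) / j = 1 / j + 1 / j := by ring
  rw [abs_le]
  constructor <;> linarith

theorem sum_dyadic_inv_le (j : ℕ) : ∑ r ∈ dyadic j, 1 / (r : ℝ) ≤ 2 := by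
  rcases Nat.eq_zero_or_pos j with rfl | hj
  · simp [dyadic]
  have h := (abs_le.1 (abs_sum_dyadic_inv_sub_log_two hj)).2
  have h2 : 1 / (j : ℝ) ≤ 1 := by
    rw [div_le_one (by exact_mod_cast hj)]; exact_mod_cast hj
  have := Real.log_two_lt_d9
  linarith

theorem inv_totient_eq {r : ℕ} (hr : r ≠ 0) :
    1 / (r.totient : ℝ) = ∑ d ∈ r.divisors, beta d / r := by
  rw [← Finset.sum_div, sum_divisors_beta hr]
  have : (r : ℝ) ≠ 0 := by exact_mod_cast hr
  field_simp

theorem exists_sum_beta_div_le :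
    ∃ C : ℝ, 0 < C ∧ ∀ n : ℕ, ∑ d ∈ Finset.Icc 1 n, beta d / d ≤ C := by
  obtain ⟨C, hC, h⟩ := exists_sum_inv_totient_mul_le
  refine ⟨C, hC, fun n => le_trans (Finset.sum_le_sum fun d _ => ?_) (h n)⟩
  rw [← div_div, div_right_comm]
  exact div_le_div_of_nonneg_right (beta_le d) (Nat.cast_nonneg d)

/-- Interchanging the order of summation over multiples and divisors. -/
theorem sum_sum_divisors_comm {M : Type*} [AddCommMonoid M] (s : Finset ℕ) (n : ℕ)
    (hs : ∀ r ∈ s, 0 < r ∧ r ≤ n) (g : ℕ → ℕ → M) :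
    ∑ r ∈ s, ∑ d ∈ r.divisors, g r d
      = ∑ d ∈ Finset.Icc 1 n, ∑ r ∈ s.filter (d ∣ ·), g r d := by
  rw [Finset.sum_comm']
  intro r d
  simp only [Nat.mem_divisors, Finset.mem_filter, Finset.mem_Icc]
  constructor
  · rintro ⟨hr, hd, h0⟩
    exact ⟨⟨hr, hd⟩, Nat.pos_of_dvd_of_pos hd (hs r hr).1,
      (Nat.le_of_dvd (hs r hr).1 hd).trans (hs r hr).2⟩
  · rintro ⟨⟨hr, hd⟩, _⟩
    exact ⟨hr, hd, (hs r hr).1.ne'⟩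

theorem dyadic_bounds {j r : ℕ} (h : r ∈ dyadic j) : 0 < r ∧ r ≤ j :=
  ⟨pos_of_mem_dyadic h, (mem_dyadic.1 h).1.le⟩

theorem exists_sum_dyadic_inv_totient_le :
    ∃ C : ℝ, 0 < C ∧ ∀ j : ℕ, ∑ r ∈ dyadic j, 1 / (r.totient : ℝ) ≤ C := by
  obtain ⟨C, hC, h⟩ := exists_sum_beta_div_le
  refine ⟨C * 2, by positivity, fun j => ?_⟩
  have h1 : ∑ r ∈ dyadic j, 1 / (r.totient : ℝ) = ∑ r ∈ dyadic j, ∑ d ∈ r.divisors, beta d / r :=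
    Finset.sum_congr rfl fun r hr => inv_totient_eq (pos_of_mem_dyadic hr).ne'
  rw [h1, sum_sum_divisors_comm _ j fun r hr => dyadic_bounds hr]
  calc _ ≤ ∑ d ∈ Finset.Icc 1 j, beta d / d * 2 := by
        refine Finset.sum_le_sum fun d hd => ?_
        have hd1 := (Finset.mem_Icc.1 hd).1
        rw [sum_dyadic_dvd j hd1]
        have : ∀ f ∈ dyadic (j ⌈/⌉ d), beta d / ((d * f : ℕ) : ℝ) = beta d / d * (1 / (f : ℝ)) := by
          intro f _; push_cast; rw [div_mul_div_comm, mul_one]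
        rw [Finset.sum_congr rfl this, ← Finset.mul_sum]
        exact mul_le_mul_of_nonneg_left (sum_dyadic_inv_le _)
          (div_nonneg (beta_nonneg d) (Nat.cast_nonneg d))
    _ ≤ _ := by
      rw [← Finset.sum_mul]
      exact mul_le_mul_of_nonneg_right (h j) (by norm_num)

/-- Writing the multiples of `d` as `d * f`, supermultiplicativity `φ(d) φ(f) ≤ φ(d f)` pulls out `1
/ φ(d)` and leaves a dyadic sum in `f`. -/
theorem exists_sum_dyadic_dvd_inv_totient_le :
    ∃ C : ℝ, 0 < C ∧ ∀ j d : ℕ, 0 < d →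
      ∑ r ∈ (dyadic j).filter (d ∣ ·), 1 / (r.totient : ℝ) ≤ C / d.totient := by
  obtain ⟨C, hC, h⟩ := exists_sum_dyadic_inv_totient_le
  refine ⟨C, hC, fun j d hd => ?_⟩
  rw [sum_dyadic_dvd j hd]
  have hφ : (0 : ℝ) < d.totient := by exact_mod_cast Nat.totient_pos.2 hd
  calc _ ≤ ∑ f ∈ dyadic (j ⌈/⌉ d), (1 / (f.totient : ℝ)) / d.totient := by
        refine Finset.sum_le_sum fun f hf => ?_
        have hf : (0 : ℝ) < f.totient := by
          exact_mod_cast Nat.totient_pos.2 (pos_of_mem_dyadic hf)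
        rw [div_div]
        refine one_div_le_one_div_of_le (by positivity) ?_
        rw [mul_comm]
        exact_mod_cast Nat.totient_super_multiplicative d f
    _ ≤ _ := by
      rw [← Finset.sum_div]
      exact div_le_div_of_nonneg_right (h _) hφ.le

theorem sum_Icc_inv_le (n : ℕ) :
    ∑ d ∈ Finset.Icc 1 n, 1 / (d : ℝ) ≤ 1 + Real.log n := by
  have h := harmonic_le_one_add_log n
  rw [harmonic_eq_sum_Icc] at h
  push_cast at h
  simpa [one_div] using h

theorem sum_filter_dvd_Icc {M : Type*} [AddCommMonoid M] (n : ℕ) {d : ℕ} (hd : 0 < d)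
    (g : ℕ → M) :
    ∑ r ∈ (Finset.Icc 1 n).filter (d ∣ ·), g r = ∑ f ∈ Finset.Icc 1 (n / d), g (d * f) := by
  symm
  refine Finset.sum_bij (fun f _ => d * f) ?_ ?_ ?_ ?_
  · intro f hf
    rw [Finset.mem_Icc] at hf
    simp only [Finset.mem_filter, Finset.mem_Icc, dvd_mul_right, and_true]
    refine ⟨Nat.mul_pos hd hf.1, ?_⟩
    rw [mul_comm]; exact (Nat.le_div_iff_mul_le hd).1 hf.2
  · intro a _ b _ hab
    exact Nat.eq_of_mul_eq_mul_left hd hab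
  · intro b hb
    obtain ⟨hb, f, rfl⟩ := Finset.mem_filter.1 hb
    rw [Finset.mem_Icc] at hb
    refine ⟨f, ?_, rfl⟩
    rw [Finset.mem_Icc, Nat.le_div_iff_mul_le hd, mul_comm]
    exact ⟨Nat.pos_of_mul_pos_left (by omega : 0 < d * f), hb.2⟩
  · intro _ _; rfl

theorem exists_sum_inv_totient_le :
    ∃ C : ℝ, 0 < C ∧ ∀ n : ℕ, 1 ≤ n →
      ∑ d ∈ Finset.Icc 1 n, 1 / (d.totient : ℝ) ≤ C * (1 + Real.log n) := by
  obtain ⟨C, hC, h⟩ := exists_sum_beta_div_le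
  refine ⟨C, hC, fun n hn => ?_⟩
  have hl : 0 ≤ Real.log n := Real.log_natCast_nonneg n
  rw [Finset.sum_congr rfl fun r hr => inv_totient_eq
      (by have := (Finset.mem_Icc.1 hr).1; omega : r ≠ 0),
    sum_sum_divisors_comm _ n fun r hr => Finset.mem_Icc.1 hr]
  calc _ ≤ ∑ d ∈ Finset.Icc 1 n, beta d / d * (1 + Real.log n) := by
        refine Finset.sum_le_sum fun d hd => ?_
        have hd1 := (Finset.mem_Icc.1 hd).1
        rw [sum_filter_dvd_Icc n hd1]
        have : ∀ f ∈ Finset.Icc 1 (n / d), beta d / ((d * f : ℕ) : ℝ)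
            = beta d / d * (1 / (f : ℝ)) := by
          intro f _; push_cast; rw [div_mul_div_comm, mul_one]
        rw [Finset.sum_congr rfl this, ← Finset.mul_sum]
        refine mul_le_mul_of_nonneg_left ?_ (div_nonneg (beta_nonneg d) (Nat.cast_nonneg d))
        refine le_trans (Finset.sum_le_sum_of_subset_of_nonneg
          (Finset.Icc_subset_Icc_right (Nat.div_le_self n d)) fun _ _ _ => by positivity)
          (sum_Icc_inv_le n)
    _ ≤ _ := by
      rw [← Finset.sum_mul]
      exact mul_le_mul_of_nonneg_right (h n) (by positivity)

/-- Cut `[j, ∞)` at the points `j * 2 ^ n`. The piece beginning there contributes at most a constant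
over `j * 2 ^ n`, and the pieces form a geometric series. -/
theorem exists_sum_Ico_inv_totient_mul_le :
    ∃ C : ℝ, 0 < C ∧ ∀ j j' : ℕ, 1 ≤ j →
      ∑ d ∈ Finset.Ico j j', 1 / ((d : ℝ) * d.totient) ≤ C / j := by
  obtain ⟨C, hC, h⟩ := exists_sum_dyadic_inv_totient_le
  refine ⟨2 * C, by positivity, fun j j' hj => ?_⟩
  have hj0 : (0 : ℝ) < j := by exact_mod_cast hj
  have key : ∀ n : ℕ, ∑ d ∈ Finset.Ico j (j * 2 ^ n), 1 / ((d : ℝ) * d.totient)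
      ≤ C / j * (2 - 2 / 2 ^ n) := by
    intro n
    induction n with
    | zero => simp
    | succ n ih =>
      have hle : j ≤ j * 2 ^ n := Nat.le_mul_of_pos_right _ (by positivity)
      rw [← Finset.sum_Ico_consecutive _ hle
        (show j * 2 ^ n ≤ j * 2 ^ (n + 1) by rw [pow_succ, ← mul_assoc]; omega)]
      have e : Finset.Ico (j * 2 ^ n) (j * 2 ^ (n + 1)) = dyadic (j * 2 ^ (n + 1)) := by
        rw [dyadic_eq_Ico, pow_succ, ← mul_assoc]; congr 1; generalize j * 2 ^ n = m; omega
      have h2 : ∑ d ∈ Finset.Ico (j * 2 ^ n) (j * 2 ^ (n + 1)), 1 / ((d : ℝ) * d.totient)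
          ≤ C / (j * 2 ^ n) := by
        calc _ ≤ ∑ d ∈ Finset.Ico (j * 2 ^ n) (j * 2 ^ (n + 1)),
                (1 / (d.totient : ℝ)) / (j * 2 ^ n) := by
              refine Finset.sum_le_sum fun d hd => ?_
              have hd1 := (Finset.mem_Ico.1 hd).1
              have hd2 : (j : ℝ) * 2 ^ n ≤ d := by exact_mod_cast hd1
              have hφ : (0 : ℝ) < d.totient := by
                exact_mod_cast Nat.totient_pos.2 (by omega)
              rw [div_div]
              refine one_div_le_one_div_of_le (by positivity) ?_
              rw [mul_comm]; gcongr
          _ ≤ _ := by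
            rw [← Finset.sum_div, e]
            exact div_le_div_of_nonneg_right (h _) (by positivity)
      have e3 : C / (j * 2 ^ n) = C / j * (2 / 2 ^ (n + 1)) := by
        rw [pow_succ]; field_simp
      have e4 : C / j * (2 / 2 ^ n) = 2 * (C / j * (2 / 2 ^ (n + 1))) := by
        rw [pow_succ]; field_simp
      rw [mul_sub] at ih ⊢
      linarith
  calc _ ≤ ∑ d ∈ Finset.Ico j (j * 2 ^ j'), 1 / ((d : ℝ) * d.totient) := by
        refine Finset.sum_le_sum_of_subset_of_nonneg
          (Finset.Ico_subset_Ico_right ?_) fun _ _ _ => by positivity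
        calc j' ≤ 2 ^ j' := Nat.lt_two_pow_self.le
          _ ≤ _ := Nat.le_mul_of_pos_left _ (by omega)
    _ ≤ C / j * (2 - 2 / 2 ^ j') := key j'
    _ ≤ C / j * 2 := by
      refine mul_le_mul_of_nonneg_left ?_ (by positivity)
      have : (0 : ℝ) ≤ 2 / 2 ^ j' := by positivity
      linarith
    _ = _ := by ring

/-! ### Dyadic totient sums with a coprimality condition -/

theorem coprime_indicator_eq_sum_moebius (n : ℕ) {k : ℕ} (hk : k ≠ 0) :
    (if Nat.Coprime n k then (1 : ℝ) else 0)
      = ∑ e ∈ k.divisors.filter (· ∣ n), (ArithmeticFunction.moebius e : ℝ) := by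
  have h1 : k.divisors.filter (· ∣ n) = (Nat.gcd n k).divisors := by
    ext e
    have : Nat.gcd n k ≠ 0 := Nat.gcd_ne_zero_right hk
    simp [Nat.mem_divisors, Nat.dvd_gcd_iff, hk, and_comm]
  rw [h1]
  have h2 : ∑ e ∈ (Nat.gcd n k).divisors, ArithmeticFunction.moebius e
      = if Nat.gcd n k = 1 then 1 else 0 := by
    rw [← ArithmeticFunction.coe_mul_zeta_apply, ArithmeticFunction.moebius_mul_coe_zeta,
      ArithmeticFunction.one_apply]
  have h3 := congrArg (Int.cast : ℤ → ℝ) h2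
  push_cast at h3
  rw [h3]

theorem abs_moebius_le_one_real (e : ℕ) : |(ArithmeticFunction.moebius e : ℝ)| ≤ 1 := by
  exact_mod_cast ArithmeticFunction.abs_moebius_le_one (n := e)

/-- The sum `∑_{e ∣ k} μ(e) / e`. -/
def kappa (k : ℕ) : ℝ := ∑ e ∈ k.divisors, (ArithmeticFunction.moebius e : ℝ) / e

theorem abs_kappa_le (k : ℕ) : |kappa k| ≤ tau k := by
  unfold kappa tau
  refine (Finset.abs_sum_le_sum_abs _ _).trans ?_
  rw [← nsmul_one, ← Finset.sum_const]
  refine Finset.sum_le_sum fun e he => ?_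
  have h1 : (1 : ℝ) ≤ e := by exact_mod_cast Nat.pos_of_mem_divisors he
  rw [abs_div, Nat.abs_cast]
  exact div_le_one_of_le₀ ((abs_moebius_le_one_real e).trans h1) (by positivity)

theorem le_ceilDiv_cast (i : ℕ) {e : ℕ} (he : 0 < e) : (i : ℝ) / e ≤ ((i ⌈/⌉ e : ℕ) : ℝ) := by
  rw [div_le_iff₀ (by exact_mod_cast he)]
  have := (ceilDiv_le_iff_le_mul he).1 (le_refl (i ⌈/⌉ e))
  rw [mul_comm]; exact_mod_cast this

theorem ceilDiv_pos_of_pos {i e : ℕ} (hi : 0 < i) (he : 0 < e) : 0 < i ⌈/⌉ e := by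
  by_contra h
  have h0 : i ⌈/⌉ e ≤ 0 := by omega
  rw [ceilDiv_le_iff_le_mul he] at h0
  omega

/-- After Möbius inversion the divisor `e` has weight at most `1/e`, while the dyadic sum of index
`⌈i/e⌉` has error at most `e/i`. The two factors of `e` cancel, so each divisor of `k` contributes
`1/i`. -/
theorem abs_sum_dyadic_coprime_inv_sub {i k : ℕ} (hi : 0 < i) (hk : k ≠ 0) :
    |∑ f ∈ (dyadic i).filter (fun f => Nat.Coprime f k), 1 / (f : ℝ) - Real.log 2 * kappa k|
      ≤ tau k / i := by
  have h1 : ∑ f ∈ (dyadic i).filter (fun f => Nat.Coprime f k), 1 / (f : ℝ)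
      = ∑ e ∈ k.divisors, (ArithmeticFunction.moebius e : ℝ) / e
          * ∑ f ∈ dyadic (i ⌈/⌉ e), 1 / (f : ℝ) := by
    rw [Finset.sum_filter]
    calc _ = ∑ f ∈ dyadic i, ∑ e ∈ k.divisors,
          if e ∣ f then (ArithmeticFunction.moebius e : ℝ) * (1 / f) else 0 := by
          refine Finset.sum_congr rfl fun f _ => ?_
          rw [← Finset.sum_filter, ← Finset.sum_mul, ← coprime_indicator_eq_sum_moebius f hk]
          split_ifs <;> simp
      _ = _ := by
          rw [Finset.sum_comm]
          refine Finset.sum_congr rfl fun e he => ?_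
          rw [← Finset.sum_filter, sum_dyadic_dvd i (Nat.pos_of_mem_divisors he), Finset.mul_sum]
          refine Finset.sum_congr rfl fun f _ => ?_
          push_cast
          rw [div_mul_div_comm, mul_one, mul_one_div]
  rw [h1, kappa, Finset.mul_sum, ← Finset.sum_sub_distrib]
  refine (Finset.abs_sum_le_sum_abs _ _).trans ?_
  rw [tau, Finset.card_eq_sum_ones, Nat.cast_sum, Finset.sum_div]
  refine Finset.sum_le_sum fun e he => ?_
  have he0 := Nat.pos_of_mem_divisors he
  have heR : (0 : ℝ) < e := by exact_mod_cast he0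
  have hiR : (0 : ℝ) < i := by exact_mod_cast hi
  rw [mul_comm (Real.log 2), ← mul_sub, abs_mul, abs_div, Nat.abs_cast]
  have h2 := abs_sum_dyadic_inv_sub_log_two (ceilDiv_pos_of_pos hi he0)
  have h3 : 1 / ((i ⌈/⌉ e : ℕ) : ℝ) ≤ e / i := by
    rw [← one_div_div (i : ℝ) (e : ℝ)]
    exact one_div_le_one_div_of_le (by positivity) (le_ceilDiv_cast i he0)
  calc _ ≤ 1 / e * ((e : ℝ) / i) := by
        gcongr
        · exact abs_moebius_le_one_real e
        · exact h2.trans h3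
    _ = _ := by push_cast; field_simp

/-- The sum of `1 / φ(r)` over `r < j ≤ 2r` coprime to `k`. -/
def dyadicTotientSum (j k : ℕ) : ℝ :=
  ∑ r ∈ (dyadic j).filter (fun r => Nat.Coprime r k), 1 / (r.totient : ℝ)

theorem dyadicTotientSum_nonneg (j k : ℕ) : 0 ≤ dyadicTotientSum j k :=
  Finset.sum_nonneg fun _ _ => by positivity

theorem exists_dyadicTotientSum_le :
    ∃ C : ℝ, 0 < C ∧ ∀ j k : ℕ, dyadicTotientSum j k ≤ C := by
  obtain ⟨C, hC, h⟩ := exists_sum_dyadic_inv_totient_le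
  refine ⟨C, hC, fun j k => le_trans ?_ (h j)⟩
  exact Finset.sum_le_sum_of_subset_of_nonneg (Finset.filter_subset _ _) fun _ _ _ => by positivity

theorem dyadicTotientSum_eq (j k : ℕ) :
    dyadicTotientSum j k = ∑ d ∈ (Finset.Icc 1 j).filter (fun d => Nat.Coprime d k),
      beta d / d * ∑ f ∈ (dyadic (j ⌈/⌉ d)).filter (fun f => Nat.Coprime f k), 1 / (f : ℝ) := by
  unfold dyadicTotientSum
  rw [Finset.sum_congr rfl fun r hr => inv_totient_eq
      (pos_of_mem_dyadic (Finset.mem_filter.1 hr).1).ne',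
    sum_sum_divisors_comm _ j fun r hr => dyadic_bounds (Finset.mem_filter.1 hr).1,
    Finset.sum_filter]
  refine Finset.sum_congr rfl fun d hd => ?_
  have hd0 := (Finset.mem_Icc.1 hd).1
  rw [Finset.filter_filter, Finset.filter_congr (fun r _ => and_comm), ← Finset.filter_filter,
    Finset.sum_filter, sum_dyadic_dvd j hd0]
  split_ifs with hc
  · rw [Finset.mul_sum, Finset.sum_filter]
    refine Finset.sum_congr rfl fun f _ => ?_
    by_cases hf : Nat.Coprime f k
    · rw [if_pos hf, if_pos (Nat.Coprime.mul_left hc hf)]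
      push_cast; rw [div_mul_div_comm, mul_one]
    · rw [if_neg hf, if_neg fun h => hf (Nat.coprime_mul_iff_left.1 h).2]
  · refine Finset.sum_eq_zero fun f _ => ?_
    exact if_neg fun h => hc (Nat.coprime_mul_iff_left.1 h).1

/-- Write `r = d * f` as in the convolution for `1 / φ(r)` and evaluate the sum over `f`. The error
at `d` is `(β(d)/d) τ(k) d / j`, and summing `1 / φ(d)` over `d ≤ j` produces the logarithm. -/
theorem exists_abs_dyadicTotientSum_sub_main_le :
    ∃ C : ℝ, 0 < C ∧ ∀ j k : ℕ, 1 ≤ j → k ≠ 0 →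
      |dyadicTotientSum j k - Real.log 2 * kappa k
          * ∑ d ∈ (Finset.Icc 1 j).filter (fun d => Nat.Coprime d k), beta d / d|
        ≤ C * tau k * ((1 + Real.log j) / j) := by
  obtain ⟨C, hC, h⟩ := exists_sum_inv_totient_le
  refine ⟨C, hC, fun j k hj hk => ?_⟩
  have hjR : (0 : ℝ) < j := by exact_mod_cast hj
  rw [dyadicTotientSum_eq, Finset.mul_sum, ← Finset.sum_sub_distrib]
  refine (Finset.abs_sum_le_sum_abs _ _).trans ?_
  calc _ ≤ ∑ d ∈ (Finset.Icc 1 j).filter (fun d => Nat.Coprime d k),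
          1 / (d.totient : ℝ) * (tau k / j) := by
        refine Finset.sum_le_sum fun d hd => ?_
        have hd0 := (Finset.mem_Icc.1 (Finset.mem_filter.1 hd).1).1
        have hdR : (0 : ℝ) < d := by exact_mod_cast hd0
        have hc := ceilDiv_pos_of_pos hj hd0
        rw [mul_comm (Real.log 2 * kappa k), ← mul_sub, abs_mul, abs_div, Nat.abs_cast,
          abs_of_nonneg (beta_nonneg d)]
        have h3 : (tau k : ℝ) / ((j ⌈/⌉ d : ℕ) : ℝ) ≤ tau k * (d / j) := by
          rw [div_eq_mul_one_div, ← one_div_div (j : ℝ) (d : ℝ)]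
          gcongr
          exact le_ceilDiv_cast j hd0
        calc _ ≤ 1 / (d.totient : ℝ) / d * (tau k * (d / j)) := by
              gcongr
              · exact beta_le d
              · exact (abs_sum_dyadic_coprime_inv_sub hc hk).trans h3
          _ = _ := by field_simp
    _ ≤ (C * (1 + Real.log j)) * (tau k / j) := by
        rw [← Finset.sum_mul]
        gcongr
        exact le_trans (Finset.sum_le_sum_of_subset_of_nonneg (Finset.filter_subset _ _)
          fun _ _ _ => by positivity) (h j hj)
    _ = _ := by ring

theorem one_add_log_div_antitone {j j' : ℕ} (hj : 1 ≤ j) (h : j ≤ j') :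
    (1 + Real.log j') / j' ≤ (1 + Real.log j) / j := by
  have hjR : (1 : ℝ) ≤ j := by exact_mod_cast hj
  have h' : (j : ℝ) ≤ j' := by exact_mod_cast h
  have h1 : Real.log j' ≤ Real.log j + (j' / j - 1) := by
    have := Real.log_le_sub_one_of_pos (x := (j' : ℝ) / j) (div_pos (by linarith) (by linarith))
    rw [Real.log_div (by linarith) (by linarith)] at this
    linarith
  have hl := Real.log_nonneg hjR
  rw [div_le_div_iff₀ (by linarith) (by linarith)]
  have h2 : (j' : ℝ) / j * j = j' := by field_simp
  nlinarith

/-- `dyadicTotientSum j k` depends little on `j`. -/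
theorem exists_abs_dyadicTotientSum_sub_le :
    ∃ C : ℝ, 0 < C ∧ ∀ j j' k : ℕ, 1 ≤ j → j ≤ j' → k ≠ 0 →
      |dyadicTotientSum j k - dyadicTotientSum j' k| ≤ C * tau k * ((1 + Real.log j) / j) := by
  obtain ⟨C, hC, h⟩ := exists_abs_dyadicTotientSum_sub_main_le
  obtain ⟨C', hC', h'⟩ := exists_sum_Ico_inv_totient_mul_le
  refine ⟨2 * C + C', by positivity, fun j j' k hj hjj hk => ?_⟩
  have hjR : (1 : ℝ) ≤ j := by exact_mod_cast hj
  have hl := Real.log_nonneg hjR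
  have h1 := h j k hj hk
  have h2 := (h j' k (hj.trans hjj) hk).trans
    (mul_le_mul_of_nonneg_left (one_add_log_div_antitone hj hjj) (by positivity))
  set S := ∑ d ∈ (Finset.Icc 1 j).filter (fun d => Nat.Coprime d k), beta d / d
  set S' := ∑ d ∈ (Finset.Icc 1 j').filter (fun d => Nat.Coprime d k), beta d / d
  -- The main terms at `j` and `j'` differ only in the range of the convergent series `∑ β(d)/d`;
  -- the difference is part of its tail from `j` on.
  have hS : 0 ≤ S' - S ∧ S' - S ≤ C' / j := by
    have hsub : (Finset.Icc 1 j).filter (fun d => Nat.Coprime d k)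
        ⊆ (Finset.Icc 1 j').filter (fun d => Nat.Coprime d k) :=
      Finset.filter_subset_filter _ (Finset.Icc_subset_Icc_right hjj)
    have e : S' - S = ∑ d ∈ (Finset.Icc 1 j').filter (fun d => Nat.Coprime d k)
        \ (Finset.Icc 1 j).filter (fun d => Nat.Coprime d k), beta d / d := by
      rw [Finset.sum_sdiff_eq_sub hsub]
    rw [e]
    refine ⟨Finset.sum_nonneg fun d _ => div_nonneg (beta_nonneg d) (Nat.cast_nonneg d), ?_⟩
    refine le_trans ?_ (h' j (j' + 1) hj)
    calc _ ≤ ∑ d ∈ (Finset.Icc 1 j').filter (fun d => Nat.Coprime d k)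
        \ (Finset.Icc 1 j).filter (fun d => Nat.Coprime d k), 1 / ((d : ℝ) * d.totient) := by
          refine Finset.sum_le_sum fun d _ => ?_
          rw [mul_comm, ← div_div]
          exact div_le_div_of_nonneg_right (beta_le d) (Nat.cast_nonneg d)
      _ ≤ _ := by
          refine Finset.sum_le_sum_of_subset_of_nonneg ?_ fun _ _ _ => by positivity
          intro d hd
          simp only [Finset.mem_sdiff, Finset.mem_filter, Finset.mem_Icc, not_and] at hd
          rw [Finset.mem_Ico]
          have := hd.2
          by_contra hcon
          exact this ⟨hd.1.1.1, by omega⟩ hd.1.2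
  have h3 : |Real.log 2 * kappa k * S' - Real.log 2 * kappa k * S|
      ≤ C' * tau k * ((1 + Real.log j) / j) := by
    rw [← mul_sub, abs_mul, abs_mul, abs_of_nonneg hS.1,
      abs_of_pos (Real.log_pos one_lt_two)]
    have hlog : Real.log 2 ≤ 1 := by have := Real.log_two_lt_d9; linarith
    calc _ ≤ 1 * (tau k : ℝ) * (C' / j) := by
          refine mul_le_mul (mul_le_mul hlog (abs_kappa_le k) (abs_nonneg _) zero_le_one) hS.2
            hS.1 (by positivity)
      _ = C' * tau k * (1 / j) := by ring
      _ ≤ _ := by gcongr; linarith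
  have e : dyadicTotientSum j k - dyadicTotientSum j' k
      = (dyadicTotientSum j k - Real.log 2 * kappa k * S)
        - (dyadicTotientSum j' k - Real.log 2 * kappa k * S')
        - (Real.log 2 * kappa k * S' - Real.log 2 * kappa k * S) := by ring
  rw [e]
  refine (abs_sub _ _).trans ((add_le_add (abs_sub _ _) le_rfl).trans ?_)
  have : (2 * C + C') * tau k * ((1 + Real.log j) / j)
      = C * tau k * ((1 + Real.log j) / j) + C * tau k * ((1 + Real.log j) / j)
        + C' * tau k * ((1 + Real.log j) / j) := by ring
  rw [this]
  gcongr

theorem exists_sum_dyadic_tau_div_totient_le :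
    ∃ C : ℝ, 0 < C ∧ ∀ j : ℕ, 1 ≤ j →
      ∑ r ∈ dyadic j, (tau r : ℝ) / r.totient ≤ C * (1 + Real.log j) := by
  obtain ⟨C, hC, h⟩ := exists_sum_dyadic_dvd_inv_totient_le
  obtain ⟨C', hC', h'⟩ := exists_sum_inv_totient_le
  refine ⟨C * C', by positivity, fun j hj => ?_⟩
  have e : ∀ r ∈ dyadic j, (tau r : ℝ) / r.totient = ∑ d ∈ r.divisors, 1 / (r.totient : ℝ) := by
    intro r _
    rw [Finset.sum_const, nsmul_eq_mul, tau, mul_one_div]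
  rw [Finset.sum_congr rfl e, sum_sum_divisors_comm _ j fun r hr => dyadic_bounds hr]
  calc _ ≤ ∑ d ∈ Finset.Icc 1 j, C * (1 / (d.totient : ℝ)) := by
        refine Finset.sum_le_sum fun d hd => ?_
        rw [mul_one_div]
        exact h j d (Finset.mem_Icc.1 hd).1
    _ ≤ _ := by
      rw [← Finset.mul_sum, mul_assoc]
      exact mul_le_mul_of_nonneg_left (h' j hj) hC.le

/-! ### Counting in sets of consecutive integers -/

/-- Excluding 0 makes `D.min' - 1` a genuine predecessor in `ℕ`. -/
theorem ordConnected_eq_Ioc {D : Finset ℕ} (hD : (D : Set ℕ).OrdConnected) (h0 : 0 ∉ D) :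
    ∃ A B : ℕ, A ≤ B ∧ D = Finset.Ioc A B := by
  rcases D.eq_empty_or_nonempty with rfl | hne
  · exact ⟨0, 0, le_rfl, by simp⟩
  refine ⟨D.min' hne - 1, D.max' hne, ?_, ?_⟩
  · have := D.min'_le_max' hne; omega
  · have hm := D.min'_mem hne
    have hm0 : D.min' hne ≠ 0 := fun h => h0 (h ▸ hm)
    ext n
    rw [Finset.mem_Ioc]
    constructor
    · intro hn
      have := D.min'_le n hn
      exact ⟨by omega, D.le_max' n hn⟩
    · rintro ⟨h1, h2⟩
      exact hD.out hm (D.max'_mem hne) ⟨by omega, h2⟩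

theorem abs_card_filter_dvd_sub_le {D : Finset ℕ} (hD : (D : Set ℕ).OrdConnected) (h0 : 0 ∉ D)
    {e : ℕ} (he : 0 < e) : |((D.filter (e ∣ ·)).card : ℝ) - D.card / e| ≤ 1 := by
  obtain ⟨A, B, hAB, rfl⟩ := ordConnected_eq_Ioc hD h0
  have h1 : ((Finset.Ioc A B).filter (e ∣ ·)).card + ((Finset.Ioc 0 A).filter (e ∣ ·)).card
      = ((Finset.Ioc 0 B).filter (e ∣ ·)).card := by
    rw [← Finset.card_union_of_disjoint, ← Finset.filter_union]
    · congr 2; ext n; simp only [Finset.mem_union, Finset.mem_Ioc]; omega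
    · rw [Finset.disjoint_left]; intro n h1 h2
      simp only [Finset.mem_filter, Finset.mem_Ioc] at h1 h2; omega
  rw [Nat.Ioc_filter_dvd_card_eq_div, Nat.Ioc_filter_dvd_card_eq_div] at h1
  have h2 : (((Finset.Ioc A B).filter (e ∣ ·)).card : ℝ) = ((B / e : ℕ) : ℝ) - ((A / e : ℕ) : ℝ) := by
    rw [← h1]; push_cast; ring
  have heR : (0 : ℝ) < e := by exact_mod_cast he
  have hb1 : ((B / e : ℕ) : ℝ) ≤ B / e := Nat.cast_div_le
  have ha1 : ((A / e : ℕ) : ℝ) ≤ A / e := Nat.cast_div_le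
  have hb2 : (B : ℝ) / e < ((B / e : ℕ) : ℝ) + 1 := by
    rw [div_lt_iff₀ heR]; exact_mod_cast Nat.lt_mul_of_div_lt (Nat.lt_succ_self (B / e)) he
  have ha2 : (A : ℝ) / e < ((A / e : ℕ) : ℝ) + 1 := by
    rw [div_lt_iff₀ heR]; exact_mod_cast Nat.lt_mul_of_div_lt (Nat.lt_succ_self (A / e)) he
  rw [h2, Nat.card_Ioc, Nat.cast_sub hAB, sub_div, abs_le]
  constructor <;> linarith

theorem card_filter_coprime_eq (D : Finset ℕ) {r : ℕ} (hr : r ≠ 0) :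
    ((D.filter (fun n => Nat.Coprime n r)).card : ℝ)
      = ∑ e ∈ r.divisors, (ArithmeticFunction.moebius e : ℝ) * (D.filter (e ∣ ·)).card := by
  rw [Finset.card_filter, Nat.cast_sum]
  simp only [Nat.cast_ite, Nat.cast_one, Nat.cast_zero]
  calc _ = ∑ n ∈ D, ∑ e ∈ r.divisors, if e ∣ n then (ArithmeticFunction.moebius e : ℝ) else 0 := by
        refine Finset.sum_congr rfl fun n _ => ?_
        rw [coprime_indicator_eq_sum_moebius n hr, Finset.sum_filter]
    _ = _ := by
        rw [Finset.sum_comm]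
        refine Finset.sum_congr rfl fun e _ => ?_
        rw [← Finset.sum_filter, Finset.sum_const, nsmul_eq_mul, mul_comm]

/-- After multiplication by `r`, both sides count the integers up to `r` coprime to `r`; for that
interval the Möbius formula is exact, since every `e` divides `r`. -/
theorem kappa_eq {r : ℕ} (hr : r ≠ 0) : kappa r = r.totient / r := by
  have h := card_filter_coprime_eq (Finset.Ioc 0 r) hr
  have h1 : ((Finset.Ioc 0 r).filter (fun n => Nat.Coprime n r)).card = r.totient := by
    rw [← Nat.filter_coprime_Ico_eq_totient r 1]
    congr 1
    ext n
    simp only [Finset.mem_filter, Finset.mem_Ioc, Finset.mem_Ico, Nat.coprime_comm (n := r)]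
    refine and_congr_left fun _ => ?_
    omega
  have hrR : (r : ℝ) ≠ 0 := by exact_mod_cast hr
  rw [h1] at h
  rw [h, kappa, Finset.sum_div]
  refine Finset.sum_congr rfl fun e he => ?_
  have hed := Nat.dvd_of_mem_divisors he
  have heR : (e : ℝ) ≠ 0 := by exact_mod_cast (Nat.pos_of_mem_divisors he).ne'
  rw [Nat.Ioc_filter_dvd_card_eq_div, Nat.cast_div hed heR]
  field_simp

/-- Each divisor `e` of `r` enters with a Möbius factor and a counting error of at most 1. -/
theorem abs_card_filter_coprime_sub_le {D : Finset ℕ} (hD : (D : Set ℕ).OrdConnected)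
    (h0 : 0 ∉ D) {r : ℕ} (hr : r ≠ 0) :
    |((D.filter (fun n => Nat.Coprime n r)).card : ℝ) - r.totient / r * D.card| ≤ tau r := by
  rw [card_filter_coprime_eq D hr, ← kappa_eq hr, kappa, Finset.sum_mul, ← Finset.sum_sub_distrib]
  refine (Finset.abs_sum_le_sum_abs _ _).trans ?_
  rw [tau, Finset.card_eq_sum_ones r.divisors, Nat.cast_sum]
  refine Finset.sum_le_sum fun e he => ?_
  have he0 := Nat.pos_of_mem_divisors he
  rw [Nat.cast_one, div_mul_eq_mul_div, mul_div_assoc, ← mul_sub, abs_mul]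
  calc _ ≤ (1 : ℝ) * 1 := mul_le_mul (abs_moebius_le_one_real e)
        (abs_card_filter_dvd_sub_le hD h0 he0) (abs_nonneg _) zero_le_one
    _ = 1 := one_mul 1

/-! ### Mertens and Rankin bounds for smooth numbers -/

/-- The upper half of Mertens' first theorem: compare `∑ log m ≤ n log n` with `∑ Λ(d) ⌊n/d⌋`, and
pay for removing the floors with Chebyshev's bound for `ψ`. -/
theorem exists_sum_log_prime_div_le :
    ∃ C : ℝ, 0 < C ∧ ∀ n : ℕ, 1 ≤ n →
      ∑ p ∈ (Finset.Icc 1 n).filter Nat.Prime, Real.log p / p ≤ Real.log n + C := by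
  refine ⟨Real.log 4 + 4, by positivity, fun n hn => ?_⟩
  have hnR : (0 : ℝ) < n := by exact_mod_cast hn
  have h1 : ∑ m ∈ Finset.Icc 1 n, Real.log m
      = ∑ d ∈ Finset.Icc 1 n, ArithmeticFunction.vonMangoldt d * ((n / d : ℕ) : ℝ) := by
    rw [Finset.sum_congr rfl fun m _ => (ArithmeticFunction.vonMangoldt_sum (n := m)).symm,
      sum_sum_divisors_comm _ n fun r hr => Finset.mem_Icc.1 hr]
    refine Finset.sum_congr rfl fun d hd => ?_
    rw [sum_filter_dvd_Icc n (Finset.mem_Icc.1 hd).1 (fun _ => ArithmeticFunction.vonMangoldt d),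
      Finset.sum_const, Nat.card_Icc, nsmul_eq_mul, mul_comm]
    simp
  have h2 : ∑ m ∈ Finset.Icc 1 n, Real.log m ≤ n * Real.log n := by
    calc _ ≤ ∑ m ∈ Finset.Icc 1 n, Real.log n := by
          refine Finset.sum_le_sum fun m hm => ?_
          rw [Finset.mem_Icc] at hm
          exact Real.log_le_log (by exact_mod_cast hm.1) (by exact_mod_cast hm.2)
      _ = _ := by simp
  have h3 : ∑ d ∈ Finset.Icc 1 n, ArithmeticFunction.vonMangoldt d ≤ (Real.log 4 + 4) * n := by
    have := Chebyshev.psi_le_const_mul_self (x := (n : ℝ)) hnR.le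
    rw [Chebyshev.psi, Nat.floor_natCast] at this
    exact this
  have h4 : n * ∑ d ∈ Finset.Icc 1 n, ArithmeticFunction.vonMangoldt d / d
      ≤ ∑ d ∈ Finset.Icc 1 n, ArithmeticFunction.vonMangoldt d * ((n / d : ℕ) : ℝ)
        + ∑ d ∈ Finset.Icc 1 n, ArithmeticFunction.vonMangoldt d := by
    rw [Finset.mul_sum, ← Finset.sum_add_distrib]
    refine Finset.sum_le_sum fun d hd => ?_
    have hd0 : 0 < d := (Finset.mem_Icc.1 hd).1
    have h5 : (n : ℝ) / d ≤ ((n / d : ℕ) : ℝ) + 1 := by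
      rw [div_le_iff₀ (by exact_mod_cast hd0)]
      exact_mod_cast (Nat.lt_mul_of_div_lt (Nat.lt_succ_self (n / d)) hd0).le
    have h6 := mul_le_mul_of_nonneg_left h5 (ArithmeticFunction.vonMangoldt_nonneg (n := d))
    calc _ = ArithmeticFunction.vonMangoldt d * ((n : ℝ) / d) := by ring
      _ ≤ _ := h6
      _ = _ := by ring
  have h7 : ∑ p ∈ (Finset.Icc 1 n).filter Nat.Prime, Real.log p / p
      ≤ ∑ d ∈ Finset.Icc 1 n, ArithmeticFunction.vonMangoldt d / d := by
    calc _ = ∑ p ∈ (Finset.Icc 1 n).filter Nat.Prime, ArithmeticFunction.vonMangoldt p / p := by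
          refine Finset.sum_congr rfl fun p hp => ?_
          rw [ArithmeticFunction.vonMangoldt_apply_prime (Finset.mem_filter.1 hp).2]
      _ ≤ _ := Finset.sum_le_sum_of_subset_of_nonneg (Finset.filter_subset _ _) fun d _ _ =>
          div_nonneg ArithmeticFunction.vonMangoldt_nonneg (Nat.cast_nonneg d)
  refine h7.trans ?_
  rw [← h1] at h4
  refine le_of_mul_le_mul_left ?_ hnR
  linarith [h4, h2, h3]

/-- The completely multiplicative function `n ↦ n ^ t`, for `t ≠ 0`. -/
def rpowHom (t : ℝ) : ℕ →* ℝ where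
  toFun n := (n : ℝ) ^ t
  map_one' := by simp
  map_mul' m n := by push_cast; exact Real.mul_rpow (Nat.cast_nonneg m) (Nat.cast_nonneg n)

theorem sum_smooth_rpow_le {N : ℕ} {t : ℝ} (ht : t < 0) (S : Finset ℕ)
    (hS : ∀ n ∈ S, n ∈ Nat.smoothNumbers N) :
    ∑ n ∈ S, (n : ℝ) ^ t ≤ ∏ p ∈ N.primesBelow, (1 - (p : ℝ) ^ t)⁻¹ := by
  have h := EulerProduct.summable_and_hasSum_smoothNumbers_prod_primesBelow_geometric
    (f := rpowHom t) (fun {p} hp => by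
      have hp1 : (1 : ℝ) < p := by exact_mod_cast hp.one_lt
      change ‖(p : ℝ) ^ t‖ < 1
      rw [Real.norm_of_nonneg (by positivity)]
      exact Real.rpow_lt_one_of_one_lt_of_neg hp1 ht) N
  have e : ∑ n ∈ S, (n : ℝ) ^ t
      = ∑ n ∈ S.subtype (fun n => n ∈ Nat.smoothNumbers N), rpowHom t (n : ℕ) :=
    (Finset.sum_subtype_of_mem (rpowHom t) hS).symm
  rw [e]
  refine sum_le_hasSum _ (fun n _ => ?_) h.2
  change 0 ≤ ((n : ℕ) : ℝ) ^ t
  positivity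

/-- The Euler product is the sum over smooth numbers, so a bound for all partial sums over integers
bounds it. The preceding lemma uses the same identity in the opposite direction. -/
theorem prod_primesBelow_le {N : ℕ} {t B : ℝ} (ht : t < 0)
    (h : ∀ n : ℕ, ∑ m ∈ Finset.Icc 1 n, (m : ℝ) ^ t ≤ B) :
    ∏ p ∈ N.primesBelow, (1 - (p : ℝ) ^ t)⁻¹ ≤ B := by
  have h1 := EulerProduct.summable_and_hasSum_smoothNumbers_prod_primesBelow_geometric
    (f := rpowHom t) (fun {p} hp => by
      have hp1 : (1 : ℝ) < p := by exact_mod_cast hp.one_lt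
      change ‖(p : ℝ) ^ t‖ < 1
      rw [Real.norm_of_nonneg (by positivity)]
      exact Real.rpow_lt_one_of_one_lt_of_neg hp1 ht) N
  refine hasSum_le_of_sum_le h1.2 fun s => ?_
  have e : ∑ n ∈ s, rpowHom t (n : ℕ) = ∑ n ∈ s.map (Function.Embedding.subtype _), (n : ℝ) ^ t := by
    rw [Finset.sum_map]; rfl
  refine e.le.trans (le_trans (Finset.sum_le_sum_of_subset_of_nonneg ?_ fun n _ _ => ?_)
    (h ((s.map (Function.Embedding.subtype _)).sup id)))
  · intro n hn
    rw [Finset.mem_Icc]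
    refine ⟨?_, Finset.le_sup (f := id) hn⟩
    obtain ⟨⟨m, hm⟩, _, rfl⟩ := Finset.mem_map.1 hn
    exact Nat.pos_of_ne_zero hm.1
  · positivity

theorem sum_Icc_rpow_le {δ : ℝ} (hδ : 0 < δ) (n : ℕ) :
    ∑ m ∈ Finset.Icc 1 n, (m : ℝ) ^ (-1 - δ) ≤ 1 + 1 / δ := by
  have key : ∀ n : ℕ, 1 ≤ n →
      ∑ m ∈ Finset.Icc 1 n, (m : ℝ) ^ (-1 - δ) ≤ 1 + 1 / δ * (1 - (n : ℝ) ^ (-δ)) := by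
    intro n hn
    induction n, hn using Nat.le_induction with
    | base => simp
    | succ n hn ih =>
      rw [Finset.sum_Icc_succ_top (by omega)]
      have hn0 : (0 : ℝ) < n := by exact_mod_cast hn
      have hn1 : (0 : ℝ) < n + 1 := by positivity
      have h1 : ((n : ℝ) + 1) ^ (-1 - δ) ≤ 1 / δ * ((n : ℝ) ^ (-δ) - ((n : ℝ) + 1) ^ (-δ)) := by
        have e1 : ((n : ℝ) + 1) ^ (-1 - δ) = ((n : ℝ) + 1) ^ (-δ) * (1 / ((n : ℝ) + 1)) := by
          rw [show -1 - δ = -δ + -1 by ring, Real.rpow_add hn1, Real.rpow_neg_one, one_div]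
        have e2 : (n : ℝ) ^ (-δ) = ((n : ℝ) + 1) ^ (-δ) * (n / ((n : ℝ) + 1)) ^ (-δ) := by
          rw [← Real.mul_rpow (by positivity) (by positivity)]; congr 1; field_simp
        have e3 : 1 + δ * (1 / ((n : ℝ) + 1)) ≤ (n / ((n : ℝ) + 1)) ^ (-δ) := by
          rw [Real.rpow_def_of_pos (by positivity)]
          have h4 : Real.log (n / ((n : ℝ) + 1)) ≤ -(1 / ((n : ℝ) + 1)) := by
            refine (Real.log_le_sub_one_of_pos (by positivity)).trans (le_of_eq ?_)
            field_simp; ring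
          have h5 := Real.add_one_le_exp (Real.log (n / ((n : ℝ) + 1)) * -δ)
          nlinarith
        rw [e1, e2]
        have hp : 0 < ((n : ℝ) + 1) ^ (-δ) := by positivity
        rw [one_div_mul_eq_div, le_div_iff₀ hδ]
        nlinarith
      push_cast
      linarith
  rcases Nat.eq_zero_or_pos n with rfl | hn
  · simp; positivity
  · refine (key n hn).trans ?_
    have : 0 ≤ 1 / δ * (n : ℝ) ^ (-δ) := by positivity
    linarith

theorem exp_sub_exp_neg_le {u : ℝ} (h0 : 0 ≤ u) (h1 : u ≤ 1) :
    Real.exp u - Real.exp (-u) ≤ 3 * u := by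
  have h2 := (abs_le.1 (Real.abs_exp_sub_one_sub_id_le (x := u) (by rwa [abs_of_nonneg h0]))).2
  have h3 := Real.add_one_le_exp (-u)
  nlinarith

/-- Keeps the Euler factors at exponent `1 - 1 / log P` away from their pole. The critical prime is
2: from `8 ≤ P ^ 2` one gets `log 2 / log P ≤ 2/3`, and `exp (2/3) < 1.96`. For `p ≥ 3` the quotient
is at most `e / 3`. -/
theorem exp_log_div_log_le {p : ℕ} {P : ℝ} (hp : p.Prime) (hP : 3 ≤ P) (hpP : p ≤ P) :
    Real.exp (Real.log p / Real.log P) / p ≤ 49 / 50 := by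
  have hlP : 0 < Real.log P := Real.log_pos (by linarith)
  have hp0 : (0 : ℝ) < p := by exact_mod_cast hp.pos
  rw [div_le_iff₀ hp0]
  rcases hp.two_le.lt_or_eq with h | h
  · have hp3 : (3 : ℝ) ≤ p := by exact_mod_cast h
    have h1 : Real.log p / Real.log P ≤ 1 :=
      div_le_one_of_le₀ (Real.log_le_log hp0 hpP) hlP.le
    have h2 := Real.exp_le_exp.2 h1
    have h3 := Real.exp_one_lt_d9
    linarith
  · subst h
    have hl3 : 3 / 2 * Real.log 2 ≤ Real.log P := by
      have h1 : Real.log ((2 : ℝ) ^ 3) ≤ Real.log (P ^ 2) :=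
        Real.log_le_log (by norm_num) (by nlinarith)
      rw [Real.log_pow, Real.log_pow] at h1
      push_cast at h1; linarith
    have h1 : Real.log ((2 : ℕ) : ℝ) / Real.log P ≤ 2 / 3 := by
      push_cast
      rw [div_le_iff₀ hlP]; linarith
    have h2 := Real.exp_le_exp.2 h1
    have h3 : Real.exp (2 / 3) ≤ 49 / 25 := by
      have h4 : Real.exp (2 / 3) ^ 3 ≤ (49 / 25) ^ 3 := by
        rw [← Real.exp_nat_mul]
        have : ((3 : ℕ) : ℝ) * (2 / 3) = 1 + 1 := by norm_num
        rw [this, Real.exp_add]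
        have h5 := Real.exp_one_lt_d9
        have h6 := Real.exp_pos 1
        nlinarith
      exact le_of_pow_le_pow_left₀ (by norm_num) (by norm_num) h4
    push_cast
    push_cast at h2
    linarith

/-- With `δ = 1 / log P`, compare the product at exponent `1 - δ` with the one at `1 + δ`, which is
at most `1 + 1/δ`. The ratio is the exponential of `O(δ ∑ log p / p)`, bounded by Mertens. -/
theorem exists_prod_primesBelow_le :
    ∃ C : ℝ, 0 < C ∧ ∀ P : ℝ, 3 ≤ P →
      ∏ p ∈ (⌊P⌋₊ + 1).primesBelow, (1 - (p : ℝ) ^ (-1 + 1 / Real.log P))⁻¹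
        ≤ C * Real.log P := by
  obtain ⟨C, hC, h⟩ := exists_sum_log_prime_div_le
  refine ⟨Real.exp (150 * (1 + C)) * 2, by positivity, fun P hP => ?_⟩
  have hlP : 1 ≤ Real.log P := by
    rw [Real.le_log_iff_exp_le (by linarith)]
    have := Real.exp_one_lt_d9; linarith
  set δ := 1 / Real.log P with hδ
  have hδ0 : 0 < δ := by positivity
  have hprime : ∀ p ∈ (⌊P⌋₊ + 1).primesBelow, p.Prime ∧ (p : ℝ) ≤ P := by
    intro p hp
    rw [Nat.mem_primesBelow] at hp
    exact ⟨hp.2, (Nat.le_floor_iff (by linarith)).1 (by omega)⟩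
  -- The factor 150 is `3 * 50`: the two local terms differ by at most `3u/p`, and the denominator
  -- `1 - A` is at least `1/50`.
  have hratio : ∀ p ∈ (⌊P⌋₊ + 1).primesBelow, (1 - (p : ℝ) ^ (-1 + δ))⁻¹
      ≤ Real.exp (150 * δ * (Real.log p / p)) * (1 - (p : ℝ) ^ (-1 - δ))⁻¹ := by
    intro p hp
    obtain ⟨hpp, hpP⟩ := hprime p hp
    have hp0 : (0 : ℝ) < p := by exact_mod_cast hpp.pos
    have hp1 : (1 : ℝ) < p := by exact_mod_cast hpp.one_lt
    set u := Real.log p / Real.log P with hu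
    have hu' : u = δ * Real.log p := by rw [hu, hδ]; ring
    have e1 : (p : ℝ) ^ (-1 + δ) = Real.exp u / p := by
      rw [Real.rpow_add hp0, Real.rpow_neg_one, Real.rpow_def_of_pos hp0, hu', mul_comm δ]; ring
    have e2 : (p : ℝ) ^ (-1 - δ) = Real.exp (-u) / p := by
      rw [show -1 - δ = -1 + -δ by ring, Real.rpow_add hp0, Real.rpow_neg_one,
        Real.rpow_def_of_pos hp0, hu', show Real.log p * -δ = -(δ * Real.log p) by ring]; ring
    have hu0 : 0 ≤ u := div_nonneg (Real.log_nonneg hp1.le) (by linarith)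
    have hu1 : u ≤ 1 := div_le_one_of_le₀ (Real.log_le_log hp0 hpP) (by linarith)
    have h1 := exp_log_div_log_le hpp hP hpP
    rw [← hu] at h1
    have h2 := exp_sub_exp_neg_le hu0 hu1
    have h3 : Real.exp (-u) / p ≤ Real.exp u / p := by gcongr; linarith
    rw [e1, e2]
    set A := Real.exp u / p
    set B := Real.exp (-u) / p
    have hA : 0 < 1 - A := by linarith
    have hB : 0 < 1 - B := by linarith
    have h4 : A - B ≤ 3 * (u / p) := by
      have : A - B = (Real.exp u - Real.exp (-u)) / p := by simp only [A, B]; ring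
      rw [this, ← mul_div_assoc]; gcongr
    have h5 : 150 * δ * (Real.log p / p) = 150 * (u / p) := by rw [hu']; ring
    rw [h5]
    have h6 := Real.add_one_le_exp (150 * (u / p))
    have h7 : 0 ≤ u / p := by positivity
    rw [inv_eq_one_div, ← div_eq_mul_inv, div_le_div_iff₀ hA hB, one_mul]
    nlinarith
  have h2 : ∏ p ∈ (⌊P⌋₊ + 1).primesBelow, (1 - (p : ℝ) ^ (-1 - δ))⁻¹ ≤ 1 + 1 / δ :=
    prod_primesBelow_le (by linarith) (sum_Icc_rpow_le hδ0)
  have h3 : ∏ p ∈ (⌊P⌋₊ + 1).primesBelow, Real.exp (150 * δ * (Real.log p / p))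
      ≤ Real.exp (150 * (1 + C)) := by
    rw [← Real.exp_sum, ← Finset.mul_sum]
    refine Real.exp_le_exp.2 ?_
    have h4 : ∑ p ∈ (⌊P⌋₊ + 1).primesBelow, Real.log p / p ≤ Real.log P + C := by
      have hf : 1 ≤ ⌊P⌋₊ := (Nat.one_le_floor_iff P).2 (by linarith)
      have h5 := h ⌊P⌋₊ hf
      have h6 : Real.log ⌊P⌋₊ ≤ Real.log P :=
        Real.log_le_log (by exact_mod_cast hf) (Nat.floor_le (by linarith))
      refine le_trans (Finset.sum_le_sum_of_subset_of_nonneg ?_ ?_) (h5.trans (by linarith))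
      · intro p hp
        rw [Nat.mem_primesBelow] at hp
        rw [Finset.mem_filter, Finset.mem_Icc]
        exact ⟨⟨hp.2.pos, by omega⟩, hp.2⟩
      · intro p hp _
        exact div_nonneg (Real.log_natCast_nonneg p) (Nat.cast_nonneg p)
    have h7 : δ * Real.log P = 1 := by rw [hδ]; field_simp
    have h8 : δ ≤ 1 := by rw [hδ]; exact div_le_one_of_le₀ hlP (by linarith)
    rw [mul_assoc]
    have := mul_le_mul_of_nonneg_left h4 hδ0.le
    nlinarith
  calc _ ≤ ∏ p ∈ (⌊P⌋₊ + 1).primesBelow, (Real.exp (150 * δ * (Real.log p / p))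
          * (1 - (p : ℝ) ^ (-1 - δ))⁻¹) := by
        refine Finset.prod_le_prod (fun p hp => ?_) hratio
        obtain ⟨hpp, hpP⟩ := hprime p hp
        refine inv_nonneg.2 ?_
        have hp0 : (0 : ℝ) < p := by exact_mod_cast hpp.pos
        have h1 := exp_log_div_log_le hpp hP hpP
        have e1 : (p : ℝ) ^ (-1 + δ) = Real.exp (Real.log p / Real.log P) / p := by
          rw [Real.rpow_add hp0, Real.rpow_neg_one, Real.rpow_def_of_pos hp0, hδ]
          ring_nf
        rw [e1]; linarith
    _ ≤ Real.exp (150 * (1 + C)) * (1 + 1 / δ) := by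
        rw [Finset.prod_mul_distrib]
        refine mul_le_mul h3 h2 (Finset.prod_nonneg fun p hp => inv_nonneg.2 ?_) (by positivity)
        obtain ⟨hpp, hpP⟩ := hprime p hp
        have hp1 : (1 : ℝ) < p := by exact_mod_cast hpp.one_lt
        have := Real.rpow_lt_one_of_one_lt_of_neg hp1 (show -1 - δ < 0 by linarith)
        linarith
    _ ≤ _ := by
        rw [mul_assoc]
        gcongr
        rw [hδ, one_div_one_div]; linarith

/-- Rankin-type bound for smooth numbers. -/
theorem exists_sum_smooth_le :
    ∃ C : ℝ, 0 < C ∧ ∀ P : ℝ, 3 ≤ P → ∀ S : Finset ℕ,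
      (∀ n ∈ S, n ∈ Nat.smoothNumbers (⌊P⌋₊ + 1)) →
      ∑ n ∈ S, (n : ℝ) ^ (-1 + 1 / Real.log P) ≤ C * Real.log P := by
  obtain ⟨C, hC, h⟩ := exists_prod_primesBelow_le
  refine ⟨C, hC, fun P hP S hS => (sum_smooth_rpow_le ?_ S hS).trans (h P hP)⟩
  have hlP : 1 < Real.log P := by
    rw [Real.lt_log_iff_exp_lt (by linarith)]
    have := Real.exp_one_lt_d9; linarith
  have : 1 / Real.log P < 1 := by rw [div_lt_one (by linarith)]; exact hlP
  linarith

/-- The weight `n ^ t` is completely multiplicative, so `τ(n) n ^ t` is a sum over factorisations of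
`n`. Divisors of smooth numbers are smooth, and the square of the previous sum bounds everything. -/
theorem exists_sum_smooth_tau_le :
    ∃ C : ℝ, 0 < C ∧ ∀ P : ℝ, 3 ≤ P → ∀ S : Finset ℕ,
      (∀ n ∈ S, n ∈ Nat.smoothNumbers (⌊P⌋₊ + 1)) →
      ∑ n ∈ S, (tau n : ℝ) * (n : ℝ) ^ (-1 + 1 / Real.log P) ≤ C * Real.log P ^ 2 := by
  obtain ⟨C, hC, h⟩ := exists_sum_smooth_le
  refine ⟨C ^ 2, by positivity, fun P hP S hS => ?_⟩
  set t := -1 + 1 / Real.log P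
  set S' := S.biUnion Nat.divisors
  have hS' : ∀ n ∈ S', n ∈ Nat.smoothNumbers (⌊P⌋₊ + 1) := by
    intro n hn
    obtain ⟨m, hm, hnm⟩ := Finset.mem_biUnion.1 hn
    exact Nat.mem_smoothNumbers_of_dvd (hS m hm) (Nat.dvd_of_mem_divisors hnm)
  have h1 := h P hP S' hS'
  have e : ∀ n ∈ S, (tau n : ℝ) * (n : ℝ) ^ t
      = ∑ x ∈ n.divisorsAntidiagonal, (x.1 : ℝ) ^ t * (x.2 : ℝ) ^ t := by
    intro n _
    have : ∀ x ∈ n.divisorsAntidiagonal, (x.1 : ℝ) ^ t * (x.2 : ℝ) ^ t = (n : ℝ) ^ t := by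
      intro x hx
      rw [← Real.mul_rpow (Nat.cast_nonneg _) (Nat.cast_nonneg _), ← Nat.cast_mul,
        (Nat.mem_divisorsAntidiagonal.1 hx).1]
    rw [Finset.sum_congr rfl this, Finset.sum_const, nsmul_eq_mul, tau,
      ← Nat.map_div_right_divisors, Finset.card_map]
  rw [Finset.sum_congr rfl e, ← Finset.sum_biUnion]
  · calc _ ≤ ∑ x ∈ S' ×ˢ S', (x.1 : ℝ) ^ t * (x.2 : ℝ) ^ t := by
          refine Finset.sum_le_sum_of_subset_of_nonneg ?_ fun _ _ _ => by positivity
          intro x hx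
          obtain ⟨n, hn, hx⟩ := Finset.mem_biUnion.1 hx
          rw [Finset.mem_product]
          exact ⟨Finset.mem_biUnion.2 ⟨n, hn, Nat.fst_mem_divisors_of_mem_antidiagonal hx⟩,
            Finset.mem_biUnion.2 ⟨n, hn, Nat.snd_mem_divisors_of_mem_antidiagonal hx⟩⟩
      _ = (∑ n ∈ S', (n : ℝ) ^ t) * (∑ n ∈ S', (n : ℝ) ^ t) := by
          rw [Finset.sum_product, Finset.sum_mul_sum]
      _ ≤ (C * Real.log P) * (C * Real.log P) := by
          have : 0 ≤ ∑ n ∈ S', (n : ℝ) ^ t := Finset.sum_nonneg fun _ _ => by positivity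
          exact mul_le_mul h1 h1 this (this.trans h1)
      _ = _ := by ring
  · intro a _ b _ hab
    rw [Function.onFun, Finset.disjoint_left]
    intro x hx hx'
    exact hab ((Nat.mem_divisorsAntidiagonal.1 hx).1.symm.trans
      (Nat.mem_divisorsAntidiagonal.1 hx').1)

/-! ### Smooth parts and the threefold divisor function -/

/-- The largest divisor of `n` composed of primes less than `N`. -/
def smoothPart (N n : ℕ) : ℕ := (n.factorization.filter (· < N)).prod fun p k => p ^ k

theorem factorization_smoothPart (N n : ℕ) :
    (smoothPart N n).factorization = n.factorization.filter (· < N) := by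
  refine Nat.prod_pow_factorization_eq_self fun p hp => ?_
  rw [Finsupp.support_filter, Finset.mem_filter] at hp
  exact Nat.prime_of_mem_primeFactors hp.1

theorem smoothPart_ne_zero (N n : ℕ) : smoothPart N n ≠ 0 := by
  unfold smoothPart
  rw [Finsupp.prod, Finset.prod_ne_zero_iff]
  intro p hp
  rw [Finsupp.support_filter, Finset.mem_filter] at hp
  exact pow_ne_zero _ (Nat.prime_of_mem_primeFactors hp.1).ne_zero

theorem smoothPart_dvd (N : ℕ) {n : ℕ} (hn : n ≠ 0) : smoothPart N n ∣ n := by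
  rw [← Nat.factorization_le_iff_dvd (smoothPart_ne_zero N n) hn, factorization_smoothPart]
  intro p
  rw [Finsupp.filter_apply]
  split_ifs <;> simp

theorem prime_dvd_smoothPart_iff {N n p : ℕ} (hn : n ≠ 0) (hp : p.Prime) :
    p ∣ smoothPart N n ↔ p ∣ n ∧ p < N := by
  rw [hp.dvd_iff_one_le_factorization (smoothPart_ne_zero N n), factorization_smoothPart,
    Finsupp.filter_apply, hp.dvd_iff_one_le_factorization hn]
  split_ifs with h <;> simp [h]

theorem smoothPart_mem (N : ℕ) {n : ℕ} (hn : n ≠ 0) : smoothPart N n ∈ Nat.smoothNumbers N := by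
  rw [Nat.mem_smoothNumbers']
  exact fun p hp h => ((prime_dvd_smoothPart_iff hn hp).1 h).2

theorem smoothPart_mul (N : ℕ) {m n : ℕ} (hm : m ≠ 0) (hn : n ≠ 0) :
    smoothPart N (m * n) = smoothPart N m * smoothPart N n := by
  refine Nat.eq_of_factorization_eq (smoothPart_ne_zero _ _)
    (mul_ne_zero (smoothPart_ne_zero _ _) (smoothPart_ne_zero _ _)) fun p => ?_
  rw [Nat.factorization_mul (smoothPart_ne_zero _ _) (smoothPart_ne_zero _ _),
    factorization_smoothPart, factorization_smoothPart, factorization_smoothPart,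
    Nat.factorization_mul hm hn, Finsupp.filter_add]

theorem smoothPart_eq_self {N s : ℕ} (hs : s ∈ Nat.smoothNumbers N) : smoothPart N s = s := by
  refine Nat.eq_of_factorization_eq (smoothPart_ne_zero _ _) hs.1 fun p => ?_
  rw [factorization_smoothPart, Finsupp.filter_apply]
  split_ifs with h
  · rfl
  · by_contra hne
    have hp := Nat.prime_of_mem_primeFactors (Nat.support_factorization s ▸
      Finsupp.mem_support_iff.2 (Ne.symm hne))
    exact h (Nat.mem_smoothNumbers'.1 hs p hp (Nat.dvd_of_factorization_pos (Ne.symm hne)))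

theorem smoothPart_eq_one {N k : ℕ} (hk : ∀ p : ℕ, p.Prime → p ∣ k → N ≤ p) :
    smoothPart N k = 1 := by
  refine Nat.eq_of_factorization_eq (smoothPart_ne_zero _ _) one_ne_zero fun p => ?_
  rw [factorization_smoothPart, Finsupp.filter_apply]
  split_ifs with h
  · by_contra hne
    rw [Nat.factorization_one, Finsupp.zero_apply] at hne
    have hp := Nat.prime_of_mem_primeFactors (Nat.support_factorization k ▸
      Finsupp.mem_support_iff.2 hne)
    have := hk p hp (Nat.dvd_of_factorization_pos hne)
    omega
  · simp

theorem le_of_prime_dvd_div_smoothPart {N n p : ℕ} (hn : n ≠ 0) (hp : p.Prime)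
    (h : p ∣ n / smoothPart N n) : N ≤ p := by
  by_contra hlt
  push Not at hlt
  have hq : n / smoothPart N n ≠ 0 :=
    (Nat.div_pos (Nat.le_of_dvd (Nat.pos_of_ne_zero hn) (smoothPart_dvd N hn))
      (Nat.pos_of_ne_zero (smoothPart_ne_zero N n))).ne'
  have h1 := (hp.dvd_iff_one_le_factorization hq).1 h
  rw [Nat.factorization_div (smoothPart_dvd N hn), factorization_smoothPart] at h1
  simp [hlt] at h1

theorem smoothPart_dvd_smoothPart_of_le {M N : ℕ} (h : M ≤ N) (n : ℕ) :
    smoothPart M n ∣ smoothPart N n := by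
  rw [← Nat.factorization_le_iff_dvd (smoothPart_ne_zero M n) (smoothPart_ne_zero N n),
    factorization_smoothPart, factorization_smoothPart]
  intro p
  rw [Finsupp.filter_apply, Finsupp.filter_apply]
  split_ifs <;> omega

/-- Take the least divisor exceeding `R`. Removing one prime, which is at most `P`, brings it to `R`
or below by minimality. -/
theorem exists_dvd_of_mem_smoothNumbers {P R : ℝ} (hP : 0 ≤ P) (hR : 1 ≤ R) {s : ℕ}
    (hs : s ∈ Nat.smoothNumbers (⌊P⌋₊ + 1)) (h : R < s) :
    ∃ d : ℕ, d ∣ s ∧ R < d ∧ (d : ℝ) ≤ R * P := by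
  have hex : ∃ d : ℕ, d ∣ s ∧ R < d := ⟨s, dvd_rfl, h⟩
  set d := Nat.find hex
  obtain ⟨hd1, hd2⟩ := Nat.find_spec hex
  refine ⟨d, hd1, hd2, ?_⟩
  have hd1' : (1 : ℝ) < d := hR.trans_lt hd2
  have hne : d ≠ 1 := by rintro h1; rw [h1] at hd1'; simp at hd1'
  obtain ⟨p, hp, e, he⟩ := Nat.exists_prime_and_dvd hne
  have hpP : (p : ℝ) ≤ P := by
    have := Nat.mem_smoothNumbers'.1 hs p hp ((Dvd.intro e he.symm).trans hd1)
    exact (Nat.le_floor_iff hP).1 (by omega)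
  have he0 : 0 < e := by
    rcases Nat.eq_zero_or_pos e with h0 | h0
    · rw [h0, mul_zero] at he; rw [he] at hd1'; norm_num at hd1'
    · exact h0
  have hlt : e < d := by
    rw [he]; exact lt_mul_of_one_lt_left he0 hp.one_lt
  have hmin := Nat.find_min hex hlt
  have heR : (e : ℝ) ≤ R := by
    by_contra hcon
    push Not at hcon
    exact hmin ⟨(Dvd.intro_left p he.symm).trans hd1, hcon⟩
  calc (d : ℝ) = p * e := by rw [he]; push_cast; ring
    _ ≤ P * R := by gcongr
    _ = _ := mul_comm _ _

theorem tau3_eq_sum {n : ℕ} (hn : n ≠ 0) : tau3 n = ∑ d ∈ n.divisors, tau (n / d) := by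
  unfold tau3
  rw [Finset.card_filter, Finset.sum_product]
  refine Finset.sum_congr rfl fun d hd => ?_
  have hτ : tau (n / d) = (n / d).divisorsAntidiagonal.card := by
    rw [tau, ← Nat.map_div_right_divisors, Finset.card_map]
  rw [← Finset.card_filter, hτ]
  have hd0 := Nat.pos_of_mem_divisors hd
  have hdn := Nat.dvd_of_mem_divisors hd
  have e : ∀ v w : ℕ, d * v * w = n ↔ v * w = n / d := by
    intro v w
    constructor
    · intro h; rw [← h, mul_assoc, Nat.mul_div_cancel_left _ hd0]
    · intro h; rw [mul_assoc, h, Nat.mul_div_cancel' hdn]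
  have hq : n / d ≠ 0 := (Nat.div_pos (Nat.le_of_dvd (Nat.pos_of_ne_zero hn) hdn) hd0).ne'
  congr 1
  ext ⟨v, w⟩
  simp only [Finset.mem_filter, Finset.mem_product, Nat.mem_divisors, Nat.mem_divisorsAntidiagonal,
    e]
  constructor
  · rintro ⟨_, h⟩; exact ⟨h, hq⟩
  · rintro ⟨h, _⟩
    refine ⟨⟨⟨(Dvd.intro w h).trans (Nat.div_dvd_of_dvd hdn), hn⟩,
      (Dvd.intro_left v h).trans (Nat.div_dvd_of_dvd hdn), hn⟩, h⟩

theorem tau3_le_tau_sq {n : ℕ} (hn : n ≠ 0) : tau3 n ≤ tau n ^ 2 := by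
  rw [tau3_eq_sum hn, sq]
  calc _ ≤ ∑ d ∈ n.divisors, tau n := Finset.sum_le_sum fun d hd =>
        tau_le_of_dvd hn (Nat.div_dvd_of_dvd (Nat.dvd_of_mem_divisors hd))
    _ = _ := by rw [Finset.sum_const, smul_eq_mul]; rfl

theorem tau_le_tau3 {n : ℕ} (hn : n ≠ 0) : tau n ≤ tau3 n := by
  rw [tau3_eq_sum hn]
  calc tau n = tau (n / 1) := by rw [Nat.div_one]
    _ ≤ _ := Finset.single_le_sum (f := fun d => tau (n / d)) (fun _ _ => Nat.zero_le _)
        (Nat.one_mem_divisors.2 hn)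

theorem tau3_eq_arithmeticFunction {n : ℕ} (hn : n ≠ 0) :
    tau3 n = (ArithmeticFunction.sigma 0 * (ArithmeticFunction.zeta : ArithmeticFunction ℕ)) n := by
  rw [tau3_eq_sum hn, ArithmeticFunction.mul_zeta_apply,
    ← Nat.sum_div_divisors n (fun d => ArithmeticFunction.sigma 0 d)]
  refine Finset.sum_congr rfl fun d _ => ?_
  rw [ArithmeticFunction.sigma_zero_apply]; rfl

/-- Multiplicativity of `tau3` on the smooth part. `Nat.smoothNumbers N` concerns primes strictly
below `N`, so primes `p ≤ y` correspond to `N = ⌊y⌋₊ + 1`. -/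
theorem tau3Smooth_eq {y : ℝ} (hy : 0 ≤ y) (n : ℕ) :
    tau3Smooth y n = tau3 (smoothPart (⌊y⌋₊ + 1) n) := by
  have hmul : (ArithmeticFunction.sigma 0 *
      (ArithmeticFunction.zeta : ArithmeticFunction ℕ)).IsMultiplicative :=
    ArithmeticFunction.isMultiplicative_sigma.mul ArithmeticFunction.isMultiplicative_zeta
  rw [tau3_eq_arithmeticFunction (smoothPart_ne_zero _ _),
    hmul.multiplicative_factorization _ (smoothPart_ne_zero _ _), factorization_smoothPart,
    Finsupp.prod, Finsupp.support_filter, tau3Smooth, Finsupp.prod, Finset.prod_filter]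
  refine Finset.prod_congr rfl fun p hp => ?_
  have hpp := Nat.prime_of_mem_primeFactors hp
  have hiff : (p : ℝ) ≤ y ↔ p < ⌊y⌋₊ + 1 := by rw [Nat.lt_succ_iff, Nat.le_floor_iff hy]
  by_cases h : p < ⌊y⌋₊ + 1
  · rw [if_pos (hiff.2 h), if_pos h, Finsupp.filter_apply, if_pos h,
      tau3_eq_arithmeticFunction (pow_ne_zero _ hpp.ne_zero)]
  · rw [if_neg (fun h' => h (hiff.1 h')), if_neg h]

theorem one_le_tau3 {n : ℕ} (hn : n ≠ 0) : 1 ≤ tau3 n := (one_le_tau hn).trans (tau_le_tau3 hn)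

theorem one_le_tau3Smooth {y : ℝ} (hy : 0 ≤ y) (n : ℕ) : 1 ≤ tau3Smooth y n := by
  rw [tau3Smooth_eq hy]; exact one_le_tau3 (smoothPart_ne_zero _ _)

theorem sum_tau_div_le_tau3 {m : ℕ} (hm : m ≠ 0) {S : Finset ℕ} (hS : S ⊆ m.divisors) :
    ∑ h ∈ S, tau (m / h) ≤ tau3 m := by
  rw [tau3_eq_sum hm]
  exact Finset.sum_le_sum_of_subset hS

/-- This produces the weight `tau3Smooth`. A divisor `h ≤ y` is itself `y`-smooth, so it divides the
`y`-smooth part of `m`, with cofactor the smooth part of `m / h`; the sum is then a piece of the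
divisor sum for `tau3`. -/
theorem sum_tau_smoothPart_div_le {y : ℝ} (hy : 0 ≤ y) {M m : ℕ} (hM : M ≤ ⌊y⌋₊ + 1) (hm : m ≠ 0)
    {S : Finset ℕ} (hS : S ⊆ m.divisors) (hSy : ∀ h ∈ S, (h : ℝ) ≤ y) :
    ∑ h ∈ S, tau (smoothPart M (m / h)) ≤ tau3Smooth y m := by
  rw [tau3Smooth_eq hy]
  set N := ⌊y⌋₊ + 1
  have hs : ∀ h ∈ S, h ∈ Nat.smoothNumbers N := fun h hh =>
    Nat.mem_smoothNumbers_of_lt (Nat.pos_of_mem_divisors (hS hh))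
      (Nat.lt_succ_of_le (Nat.le_floor (hSy h hh)))
  have hmul : ∀ h ∈ S, h * smoothPart N (m / h) = smoothPart N m := by
    intro h hh
    have hd := Nat.dvd_of_mem_divisors (hS hh)
    have h0 := Nat.pos_of_mem_divisors (hS hh)
    have hq : m / h ≠ 0 := (Nat.div_pos (Nat.le_of_dvd (Nat.pos_of_ne_zero hm) hd) h0).ne'
    conv_lhs => rw [← smoothPart_eq_self (hs h hh)]
    conv_rhs => rw [← Nat.mul_div_cancel' hd, smoothPart_mul N h0.ne' hq]
    rw [smoothPart_eq_self (hs h hh)]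
  have hS' : S ⊆ (smoothPart N m).divisors := fun h hh =>
    Nat.mem_divisors.2 ⟨Dvd.intro _ (hmul h hh), smoothPart_ne_zero N m⟩
  refine le_trans (Finset.sum_le_sum fun h hh => ?_)
    (sum_tau_div_le_tau3 (smoothPart_ne_zero N m) hS')
  have h0 := Nat.pos_of_mem_divisors (hS hh)
  rw [← hmul h hh, Nat.mul_div_cancel_left _ h0]
  exact tau_le_of_dvd (smoothPart_ne_zero _ _) (smoothPart_dvd_smoothPart_of_le hM _)

/-! ### Blocks of consecutive integers and their quotients -/

/-- The integers `k` with `s * k ∈ D`. -/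
def quot (D : Finset ℕ) (s : ℕ) : Finset ℕ := (D.filter (s ∣ ·)).image (· / s)

theorem mem_quot {D : Finset ℕ} {s : ℕ} (hs : 0 < s) {k : ℕ} : k ∈ quot D s ↔ s * k ∈ D := by
  unfold quot
  simp only [Finset.mem_image, Finset.mem_filter]
  constructor
  · rintro ⟨n, ⟨hn, e, rfl⟩, rfl⟩
    rwa [Nat.mul_div_cancel_left e hs]
  · intro h
    exact ⟨s * k, ⟨h, dvd_mul_right s k⟩, Nat.mul_div_cancel_left k hs⟩

theorem sum_filter_dvd_eq_sum_quot {M : Type*} [AddCommMonoid M] (D : Finset ℕ) {s : ℕ}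
    (hs : 0 < s) (f : ℕ → M) :
    ∑ n ∈ D.filter (s ∣ ·), f n = ∑ k ∈ quot D s, f (s * k) := by
  symm
  refine Finset.sum_bij (fun k _ => s * k) ?_ ?_ ?_ ?_
  · intro k hk
    exact Finset.mem_filter.2 ⟨(mem_quot hs).1 hk, dvd_mul_right s k⟩
  · intro a _ b _ hab
    exact Nat.eq_of_mul_eq_mul_left hs hab
  · intro n hn
    obtain ⟨hn, k, rfl⟩ := Finset.mem_filter.1 hn
    exact ⟨k, (mem_quot hs).2 hn, rfl⟩
  · intro _ _; rfl

theorem rough_iff {P : ℝ} (hP : 0 ≤ P) (k : ℕ) :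
    Rough P k ↔ ∀ p : ℕ, p.Prime → p ∣ k → ⌊P⌋₊ + 1 ≤ p := by
  unfold Rough
  refine forall_congr' fun p => forall_congr' fun _ => forall_congr' fun _ => ?_
  rw [← Nat.floor_lt hP, Nat.succ_le_iff]

/-- Every `n` with smooth part `s` is uniquely `s * k` with `k` free of primes up to `P`. This
exposes the rough integers on which Resembles the Integers I is stated. -/
theorem sum_filter_smoothPart_eq {M : Type*} [AddCommMonoid M] {P : ℝ} (hP : 0 ≤ P)
    {D : Finset ℕ} (h0 : 0 ∉ D) {s : ℕ} (hs : s ∈ Nat.smoothNumbers (⌊P⌋₊ + 1)) (f : ℕ → M) :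
    ∑ n ∈ D.filter (fun n => smoothPart (⌊P⌋₊ + 1) n = s), f n
      = ∑ k ∈ (quot D s).filter (Rough P), f (s * k) := by
  have hs0 : 0 < s := Nat.pos_of_ne_zero hs.1
  symm
  refine Finset.sum_bij (fun k _ => s * k) ?_ ?_ ?_ ?_
  · intro k hk
    obtain ⟨hk, hr⟩ := Finset.mem_filter.1 hk
    rw [mem_quot hs0] at hk
    have hk0 : k ≠ 0 := by rintro rfl; exact h0 (by simpa using hk)
    refine Finset.mem_filter.2 ⟨hk, ?_⟩
    rw [smoothPart_mul _ hs.1 hk0, smoothPart_eq_self hs, smoothPart_eq_one ((rough_iff hP k).1 hr),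
      mul_one]
  · intro a _ b _ hab
    exact Nat.eq_of_mul_eq_mul_left hs0 hab
  · intro n hn
    obtain ⟨hn, hns⟩ := Finset.mem_filter.1 hn
    have hn0 : n ≠ 0 := by rintro rfl; exact h0 hn
    have hd : s * (n / s) = n := by
      rw [← hns]; exact Nat.mul_div_cancel' (smoothPart_dvd _ hn0)
    refine ⟨n / s, Finset.mem_filter.2 ⟨(mem_quot hs0).2 (hd.symm ▸ hn :), ?_⟩, hd⟩
    rw [rough_iff hP]
    intro p hp hpd
    rw [← hns] at hpd
    exact le_of_prime_dvd_div_smoothPart hn0 hp hpd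
  · intro _ _; rfl

/-- `D` consists of consecutive positive integers, with differences at most `ℓ`. -/
structure IsBlock (D : Finset ℕ) (ℓ : ℝ) : Prop where
  ordConnected : (D : Set ℕ).OrdConnected
  zero_notMem : 0 ∉ D
  sub_le : ∀ m ∈ D, ∀ n ∈ D, (n : ℝ) - m ≤ ℓ

theorem IsBlock.quot {D : Finset ℕ} {ℓ : ℝ} (hD : IsBlock D ℓ) {s : ℕ} (hs : 0 < s) :
    IsBlock (quot D s) (ℓ / s) := by
  have hsR : (0 : ℝ) < s := by exact_mod_cast hs
  refine ⟨⟨fun a ha b hb k hk => ?_⟩, fun h => ?_, fun m hm n hn => ?_⟩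
  · rw [Finset.mem_coe, mem_quot hs] at *
    exact hD.ordConnected.out ha hb ⟨Nat.mul_le_mul_left s hk.1, Nat.mul_le_mul_left s hk.2⟩
  · rw [mem_quot hs] at h
    exact hD.zero_notMem (by simpa using h)
  · rw [mem_quot hs] at hm hn
    have := hD.sub_le _ hm _ hn
    push_cast at this
    rw [le_div_iff₀ hsR]; linarith

theorem IsBlock.card_le {D : Finset ℕ} {ℓ : ℝ} (hD : IsBlock D ℓ) (hℓ : 0 ≤ ℓ) :
    (D.card : ℝ) ≤ ℓ + 1 := by
  obtain ⟨A, B, hAB, rfl⟩ := ordConnected_eq_Ioc hD.ordConnected hD.zero_notMem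
  rw [Nat.card_Ioc]
  rcases hAB.eq_or_lt with rfl | h
  · simp; linarith
  have := hD.sub_le (A + 1) (Finset.mem_Ioc.2 ⟨by omega, h⟩) B (Finset.mem_Ioc.2 ⟨h, le_rfl⟩)
  push_cast at this
  rw [Nat.cast_sub hAB]; linarith

/-- Dirichlet's symmetry `d ↔ k / d`: one member of each pair is at most `y`. -/
theorem tau_le_two_mul_card {k : ℕ} {y : ℕ} (hk : k ≠ 0) (hky : k < (y + 1) * (y + 1)) :
    tau k ≤ 2 * ((Finset.Icc 1 y).filter (· ∣ k)).card := by
  set A := (Finset.Icc 1 y).filter (· ∣ k)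
  have h1 : k.divisors ⊆ A ∪ A.image (k / ·) := by
    intro d hd
    have hd0 := Nat.pos_of_mem_divisors hd
    have hdk := Nat.dvd_of_mem_divisors hd
    rw [Finset.mem_union, Finset.mem_image]
    rcases le_or_gt d y with h | h
    · left; exact Finset.mem_filter.2 ⟨Finset.mem_Icc.2 ⟨hd0, h⟩, hdk⟩
    · right
      have hq0 : 0 < k / d := Nat.div_pos (Nat.le_of_dvd (Nat.pos_of_ne_zero hk) hdk) hd0
      refine ⟨k / d, Finset.mem_filter.2 ⟨Finset.mem_Icc.2 ⟨hq0, ?_⟩, Nat.div_dvd_of_dvd hdk⟩,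
        Nat.div_div_self hdk hk⟩
      have h2 := Nat.div_mul_cancel hdk
      by_contra hcon
      push Not at hcon
      nlinarith
  calc tau k ≤ (A ∪ A.image (k / ·)).card := Finset.card_le_card h1
    _ ≤ A.card + (A.image (k / ·)).card := Finset.card_union_le _ _
    _ ≤ A.card + A.card := Nat.add_le_add_left Finset.card_image_le _
    _ = _ := by ring

/-- Using only divisors up to `√x` keeps the accumulated rounding errors at `√x` instead of `x`, so
the bound remains useful on short blocks. -/
theorem IsBlock.sum_tau_le {D : Finset ℕ} {ℓ x : ℝ} (hD : IsBlock D ℓ) (hℓ : 0 ≤ ℓ) (hx : 1 ≤ x)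
    (hDx : ∀ n ∈ D, (n : ℝ) ≤ x) :
    ∑ k ∈ D, (tau k : ℝ) ≤ 2 * (ℓ + 1) * (1 + Real.log x) + 4 * Real.sqrt x := by
  set y := Nat.sqrt ⌊x⌋₊
  have hfx : 1 ≤ ⌊x⌋₊ := (Nat.one_le_floor_iff x).2 hx
  have hy1 : 1 ≤ y := Nat.sqrt_pos.2 hfx
  have hy2 : (y : ℝ) ≤ Real.sqrt x := by
    refine Real.le_sqrt_of_sq_le ?_
    have h1 : y ^ 2 ≤ ⌊x⌋₊ := by rw [sq]; exact Nat.sqrt_le _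
    calc (y : ℝ) ^ 2 ≤ (⌊x⌋₊ : ℝ) := by exact_mod_cast h1
      _ ≤ x := Nat.floor_le (by linarith)
  have hyx : (y : ℝ) ≤ x := by
    have : y ≤ ⌊x⌋₊ := Nat.sqrt_le_self _
    exact (Nat.cast_le.2 this).trans (Nat.floor_le (by linarith))
  have h1 : ∑ k ∈ D, (tau k : ℝ) ≤ ∑ k ∈ D, 2 * (((Finset.Icc 1 y).filter (· ∣ k)).card : ℝ) := by
    refine Finset.sum_le_sum fun k hk => ?_
    have hk0 : k ≠ 0 := by rintro rfl; exact hD.zero_notMem hk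
    have hkx : k ≤ ⌊x⌋₊ := Nat.le_floor (hDx k hk)
    exact_mod_cast tau_le_two_mul_card hk0 (hkx.trans_lt (Nat.lt_succ_sqrt _))
  have h2 : ∑ k ∈ D, (((Finset.Icc 1 y).filter (· ∣ k)).card : ℝ)
      = ∑ e ∈ Finset.Icc 1 y, ((D.filter (e ∣ ·)).card : ℝ) := by
    simp only [Finset.card_filter, Nat.cast_sum]
    rw [Finset.sum_comm]
  have h3 : ∑ e ∈ Finset.Icc 1 y, ((D.filter (e ∣ ·)).card : ℝ)
      ≤ ∑ e ∈ Finset.Icc 1 y, ((ℓ + 1) * (1 / (e : ℝ)) + 1) := by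
    refine Finset.sum_le_sum fun e he => ?_
    have he0 := (Finset.mem_Icc.1 he).1
    have h4 := (abs_le.1 (abs_card_filter_dvd_sub_le hD.ordConnected hD.zero_notMem he0)).2
    have h5 : (D.card : ℝ) / e ≤ (ℓ + 1) / e :=
      div_le_div_of_nonneg_right (hD.card_le hℓ) (Nat.cast_nonneg e)
    rw [mul_one_div]; linarith
  have h4 := sum_Icc_inv_le y
  have h5 : Real.log y ≤ Real.log x := Real.log_le_log (by exact_mod_cast hy1) hyx
  rw [← Finset.mul_sum, h2] at h1
  rw [Finset.sum_add_distrib, ← Finset.mul_sum, Finset.sum_const, Nat.card_Icc, nsmul_eq_mul,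
    mul_one, Nat.add_sub_cancel] at h3
  have h6 := mul_le_mul_of_nonneg_left (h4.trans (add_le_add_right h5 1))
    (show 0 ≤ ℓ + 1 by linarith)
  have h7 := Real.sqrt_nonneg x
  linarith

/-! ### Replacing the sequence by its mean on one block -/

theorem mem_upTo {x : ℝ} {n : ℕ} : n ∈ upTo x ↔ 1 ≤ n ∧ (n : ℝ) ≤ x := by
  unfold upTo
  rw [Finset.mem_Icc]
  refine and_congr_right fun h => ?_
  exact Nat.le_floor_iff' (by omega)

theorem absTotal_nonneg (a : ℕ → ℂ) (x : ℝ) : 0 ≤ absTotal a x :=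
  Finset.sum_nonneg fun _ _ => norm_nonneg _

theorem norm_total_le (a : ℕ → ℂ) (x : ℝ) : ‖total a x‖ ≤ absTotal a x := norm_sum_le _ _

/-- A nonempty block is the set of integers in a closed interval of at most its length. -/
theorem IsBlock.exists_interval {D : Finset ℕ} {ℓ y : ℝ} (hD : IsBlock D ℓ) (hne : D.Nonempty)
    (hDy : ∀ n ∈ D, (n : ℝ) ≤ y) :
    ∃ I : Set ℝ, I.OrdConnected ∧ I ⊆ Set.Icc 1 y ∧ intsIn I y = D ∧
      (MeasureTheory.volume I).toReal ≤ ℓ := by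
  have hm := D.min'_mem hne
  have hM := D.max'_mem hne
  have hm0 : 1 ≤ D.min' hne := Nat.one_le_iff_ne_zero.2 fun h => hD.zero_notMem (h ▸ hm)
  refine ⟨Set.Icc (D.min' hne : ℝ) (D.max' hne), Set.ordConnected_Icc,
    Set.Icc_subset_Icc (by exact_mod_cast hm0) (hDy _ hM), ?_, ?_⟩
  · ext n
    unfold intsIn
    simp only [Finset.mem_filter, mem_upTo, Set.mem_Icc, Nat.cast_le]
    constructor
    · rintro ⟨_, h1, h2⟩
      exact hD.ordConnected.out hm hM ⟨h1, h2⟩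
    · intro hn
      exact ⟨⟨hm0.trans (D.min'_le n hn), hDy n hn⟩, D.min'_le n hn, D.le_max' n hn⟩
  · rw [Real.volume_Icc, ENNReal.toReal_ofReal]
    · exact hD.sub_le _ hm _ hM
    · have : (D.min' hne : ℝ) ≤ D.max' hne := by exact_mod_cast D.min'_le_max' hne
      linarith

theorem norm_sum_rough_le {a : ℕ → ℂ} {x P K₁ K₂ : ℝ} (hx : 0 < x) (hK₁ : 0 < K₁) (hK₂ : 0 < K₂)
    (hI : ResemblesIntegersI a x P K₁ K₂) {h : ℕ} (hh : 1 ≤ h) {D : Finset ℕ} {ℓ : ℝ}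
    (hD : IsBlock D ℓ) (hℓ : 0 ≤ ℓ) (hDx : ∀ n ∈ D, (n : ℝ) ≤ x / h) :
    ‖∑ k ∈ D.filter (Rough P), (a (k * h) - total a x / x)‖
      ≤ ℓ / K₁ * (absTotal a x / x) + absTotal a x / K₂ := by
  have hN := absTotal_nonneg a x
  rcases D.eq_empty_or_nonempty with rfl | hne
  · simp only [Finset.filter_empty, Finset.sum_empty, norm_zero]; positivity
  obtain ⟨I, hI1, hI2, hI3, hI4⟩ := hD.exists_interval hne hDx
  have := hI h hh I hI1 hI2
  rw [hI3, Finset.mul_sum, ← Finset.sum_sub_distrib] at this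
  simp only [mul_one] at this
  refine this.trans ?_
  gcongr

theorem sum_norm_tau_le {a : ℕ → ℂ} {x K₂ K₃ : ℝ} (hx : 0 < x) (hK₂ : 0 < K₂) (hK₃ : 0 < K₃)
    (hI : ResemblesIntegersII a x K₂ K₃) {h : ℕ} (hh : 1 ≤ h) {D : Finset ℕ} {ℓ : ℝ}
    (hD : IsBlock D ℓ) (hℓ : 0 ≤ ℓ) (hDx : ∀ n ∈ D, (n : ℝ) ≤ x / h) :
    ∑ k ∈ D, ‖a (k * h)‖ * (tau k : ℝ)
      ≤ K₃ * ℓ * (absTotal a x / x) + absTotal a x / K₂ := by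
  have hN := absTotal_nonneg a x
  rcases D.eq_empty_or_nonempty with rfl | hne
  · simp only [Finset.sum_empty]; positivity
  obtain ⟨I, hI1, hI2, hI3, hI4⟩ := hD.exists_interval hne hDx
  have := hI h hh I hI1 hI2
  rw [hI3] at this
  refine this.trans ?_
  gcongr

theorem sum_tau_Icc_le (n : ℕ) :
    ∑ d ∈ Finset.Icc 1 n, (tau d : ℝ) ≤ n * (1 + Real.log n) := by
  have e : ∀ d ∈ Finset.Icc 1 n, (tau d : ℝ) = ∑ _e ∈ d.divisors, (1 : ℝ) := by
    intro d _; simp [tau]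
  rw [Finset.sum_congr rfl e, sum_sum_divisors_comm _ n fun r hr => Finset.mem_Icc.1 hr]
  calc _ ≤ ∑ d ∈ Finset.Icc 1 n, n * (1 / (d : ℝ)) := by
        refine Finset.sum_le_sum fun d hd => ?_
        rw [sum_filter_dvd_Icc n (Finset.mem_Icc.1 hd).1]
        simp only [Finset.sum_const, Nat.card_Icc, Nat.add_sub_cancel, nsmul_eq_mul, mul_one]
        rw [mul_one_div]
        exact Nat.cast_div_le
    _ ≤ _ := by
      rw [← Finset.mul_sum]
      exact mul_le_mul_of_nonneg_left (sum_Icc_inv_le n) (Nat.cast_nonneg n)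

/-- The positive integers up to `R` composed of primes up to `P`. -/
def smoothUpTo (P R : ℝ) : Finset ℕ :=
  (upTo R).filter (fun s => s ∈ Nat.smoothNumbers (⌊P⌋₊ + 1))

/-- The error caused by integers having a large smooth part. -/
def tailBound (N x P R K₂ K₃ ℓ : ℝ) : ℝ :=
  N * Real.log x * (R * P / K₂ + Real.log P ^ 2 * K₃ * ℓ / (x * R ^ (1 / Real.log P))
    + R * P / Real.sqrt x)

theorem sum_filter_smoothPart_le_eq {P R : ℝ} (hP : 0 ≤ P) {D : Finset ℕ} (h0 : 0 ∉ D)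
    (f : ℕ → ℂ) :
    ∑ n ∈ D.filter (fun n => (smoothPart (⌊P⌋₊ + 1) n : ℝ) ≤ R), f n
      = ∑ s ∈ smoothUpTo P R, ∑ k ∈ (quot D s).filter (Rough P), f (s * k) := by
  have hmaps : ∀ n ∈ D.filter (fun n => (smoothPart (⌊P⌋₊ + 1) n : ℝ) ≤ R),
      smoothPart (⌊P⌋₊ + 1) n ∈ smoothUpTo P R := by
    intro n hn
    obtain ⟨hn, hR⟩ := Finset.mem_filter.1 hn
    have hn0 : n ≠ 0 := by rintro rfl; exact h0 hn
    exact Finset.mem_filter.2 ⟨mem_upTo.2 ⟨Nat.pos_of_ne_zero (smoothPart_ne_zero _ _), hR⟩,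
      smoothPart_mem _ hn0⟩
  rw [← Finset.sum_fiberwise_of_maps_to hmaps]
  refine Finset.sum_congr rfl fun s hs => ?_
  obtain ⟨hs1, hs2⟩ := Finset.mem_filter.1 hs
  rw [← sum_filter_smoothPart_eq hP h0 hs2, Finset.filter_filter]
  refine Finset.sum_congr (Finset.filter_congr fun n _ => ?_) fun _ _ => rfl
  constructor
  · exact fun h => h.2
  · rintro rfl; exact ⟨(mem_upTo.1 hs1).2, rfl⟩

/-- A smooth part above `R` has a smooth divisor in `(R, R * P]`. A union bound over these divisors
keeps the moduli below `R * P`, however large the smooth part is. -/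
theorem sum_filter_lt_smoothPart_le {P R : ℝ} (hP : 0 ≤ P) (hR : 1 ≤ R) {D : Finset ℕ}
    (h0 : 0 ∉ D) {g : ℕ → ℝ} (hg : ∀ n, 0 ≤ g n) :
    ∑ n ∈ D.filter (fun n => R < (smoothPart (⌊P⌋₊ + 1) n : ℝ)), g n
      ≤ ∑ d ∈ (smoothUpTo P (R * P)).filter (fun d : ℕ => R < (d : ℝ)),
          ∑ k ∈ quot D d, g (d * k) := by
  have e : ∀ d ∈ (smoothUpTo P (R * P)).filter (fun d : ℕ => R < (d : ℝ)),
      ∑ k ∈ quot D d, g (d * k) = ∑ n ∈ D.filter (d ∣ ·), g n := by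
    intro d hd
    have hd0 : 0 < d :=
      (mem_upTo.1 (Finset.mem_filter.1 (Finset.mem_filter.1 hd).1).1).1
    rw [sum_filter_dvd_eq_sum_quot D hd0]
  rw [Finset.sum_congr rfl e]
  simp only [Finset.sum_filter (p := fun n => _ ∣ n)]
  rw [Finset.sum_comm]
  calc _ ≤ ∑ n ∈ D.filter (fun n => R < (smoothPart (⌊P⌋₊ + 1) n : ℝ)),
        ∑ d ∈ (smoothUpTo P (R * P)).filter (fun d : ℕ => R < (d : ℝ)),
          (if d ∣ n then g n else 0) := by
        refine Finset.sum_le_sum fun n hn => ?_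
        obtain ⟨hn, hnR⟩ := Finset.mem_filter.1 hn
        have hn0 : n ≠ 0 := by rintro rfl; exact h0 hn
        obtain ⟨d, hd, hd2, hd3⟩ := exists_dvd_of_mem_smoothNumbers hP hR (smoothPart_mem _ hn0) hnR
        have hds : d ∈ Nat.smoothNumbers (⌊P⌋₊ + 1) :=
          Nat.mem_smoothNumbers_of_dvd (smoothPart_mem _ hn0) hd
        have hmem : d ∈ (smoothUpTo P (R * P)).filter (fun d : ℕ => R < (d : ℝ)) :=
          Finset.mem_filter.2 ⟨Finset.mem_filter.2
            ⟨mem_upTo.2 ⟨Nat.pos_of_ne_zero hds.1, hd3⟩, hds⟩, hd2⟩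
        refine le_trans (le_of_eq ?_) (Finset.single_le_sum (f := fun d => if d ∣ n then g n else 0)
          (fun d _ => ?_) hmem)
        · exact (if_pos (hd.trans (smoothPart_dvd _ hn0))).symm
        · split_ifs <;> simp [hg n]
    _ ≤ _ := Finset.sum_le_sum_of_subset_of_nonneg (Finset.filter_subset _ _) fun n _ _ =>
        Finset.sum_nonneg fun d _ => by split_ifs <;> simp [hg n]

theorem log_le_two_mul_sqrt {x : ℝ} (hx : 0 < x) : Real.log x ≤ 2 * Real.sqrt x := by
  have h := Real.log_le_sub_one_of_pos (Real.sqrt_pos.2 hx)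
  rw [Real.log_sqrt hx.le] at h
  linarith

theorem sum_tau_smoothUpTo_le {P y x : ℝ} (hy1 : 1 ≤ y) (hyx : y ≤ x) (hlx : 1 ≤ Real.log x) :
    ∑ d ∈ smoothUpTo P y, (tau d : ℝ) ≤ y * (2 * Real.log x) := by
  have hf : 1 ≤ ⌊y⌋₊ := (Nat.one_le_floor_iff y).2 hy1
  have hf2 : (⌊y⌋₊ : ℝ) ≤ y := Nat.floor_le (by linarith)
  calc _ ≤ ∑ d ∈ Finset.Icc 1 ⌊y⌋₊, (tau d : ℝ) :=
        Finset.sum_le_sum_of_subset_of_nonneg (Finset.filter_subset _ _) fun _ _ _ => by positivity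
    _ ≤ ⌊y⌋₊ * (1 + Real.log ⌊y⌋₊) := sum_tau_Icc_le _
    _ ≤ _ := by
      have h1 : Real.log ⌊y⌋₊ ≤ Real.log x :=
        Real.log_le_log (by exact_mod_cast hf) (hf2.trans hyx)
      have h2 : 0 ≤ Real.log ⌊y⌋₊ := Real.log_natCast_nonneg _
      exact mul_le_mul hf2 (by linarith) (by linarith) (by linarith)

/-- The contribution of integers whose smooth part exceeds `R`. -/
theorem exists_sum_large_smoothPart_le :
    ∃ C : ℝ, 0 < C ∧ ∀ (a : ℕ → ℂ) (x P R K₂ K₃ : ℝ), 3 ≤ P → P ≤ R → R * P ≤ x →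
      0 < K₂ → 1 ≤ K₃ → ResemblesIntegersII a x K₂ K₃ →
      ∀ (h : ℕ) (D : Finset ℕ) (ℓ : ℝ), 1 ≤ h → IsBlock D ℓ → 0 ≤ ℓ → (∀ n ∈ D, (n : ℝ) ≤ x / h) →
        ∑ n ∈ D.filter (fun n => R < (smoothPart (⌊P⌋₊ + 1) n : ℝ)),
            (‖a (n * h)‖ + absTotal a x / x) * tau n
          ≤ C * tailBound (absTotal a x) x P R K₂ K₃ ℓ := by
  obtain ⟨C, hC, hsm⟩ := exists_sum_smooth_tau_le
  refine ⟨5 * C + 24, by positivity, ?_⟩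
  intro a x P R K₂ K₃ hP hPR hRP hK₂ hK₃ hII h D ℓ hh hD hℓ hDx
  have hR : 3 ≤ R := hP.trans hPR
  have hx9 : 9 ≤ x := by nlinarith
  have hx : 0 < x := by linarith
  have hlx : 1 ≤ Real.log x := by
    rw [Real.le_log_iff_exp_le hx]
    have := Real.exp_one_lt_d9; linarith
  have hN := absTotal_nonneg a x
  set N := absTotal a x
  set E := (smoothUpTo P (R * P)).filter (fun d : ℕ => R < (d : ℝ))
  have hhR : (1 : ℝ) ≤ h := by exact_mod_cast hh
  refine (sum_filter_lt_smoothPart_le (by linarith) (by linarith) hD.zero_notMem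
    (fun n => by positivity)).trans ?_
  -- For multiples of `d` use `τ(d k) ≤ τ(d) τ(k)`. The part with `a` is Resembles II at modulus `d
  -- * h`; the constant part is the elementary divisor sum over a block.
  have hinner : ∀ d ∈ E, ∑ k ∈ quot D d, (‖a (d * k * h)‖ + N / x) * (tau (d * k) : ℝ)
      ≤ (5 * K₃ * Real.log x * ℓ * (N / x)) * (tau d / d)
        + (N / K₂ + 12 * Real.sqrt x * (N / x)) * tau d := by
    intro d hd
    have hd0 : 0 < d := (mem_upTo.1 (Finset.mem_filter.1 (Finset.mem_filter.1 hd).1).1).1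
    have hdR : (1 : ℝ) ≤ d := by exact_mod_cast hd0
    have hq := hD.quot hd0
    have hqx : ∀ k ∈ quot D d, (k : ℝ) ≤ x / ((d * h : ℕ) : ℝ) := by
      intro k hk
      have := hDx _ ((mem_quot hd0).1 hk)
      push_cast at this ⊢
      rw [le_div_iff₀ (by positivity)] at this ⊢
      linarith
    have h1 := sum_norm_tau_le hx hK₂ (by linarith) hII (h := d * h) (Nat.mul_pos hd0 hh) hq
      (by positivity) hqx
    have h2 := hq.sum_tau_le (by positivity) (x := x) (by linarith) (fun k hk =>
      (hqx k hk).trans (div_le_self hx.le (by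
        push_cast; nlinarith)))
    have h3 : ∑ k ∈ quot D d, (‖a (d * k * h)‖ + N / x) * (tau (d * k) : ℝ)
        ≤ ∑ k ∈ quot D d, (tau d * (‖a (k * (d * h))‖ * tau k) + (tau d * (N / x)) * tau k) := by
      refine Finset.sum_le_sum fun k _ => ?_
      have : (tau (d * k) : ℝ) ≤ tau d * tau k := by exact_mod_cast tau_mul_le d k
      have e : d * k * h = k * (d * h) := by ring
      rw [e]
      calc _ ≤ (‖a (k * (d * h))‖ + N / x) * (tau d * tau k) := by gcongr
        _ = _ := by ring
    refine h3.trans ?_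
    rw [Finset.sum_add_distrib, ← Finset.mul_sum, ← Finset.mul_sum]
    have h4 := mul_le_mul_of_nonneg_left h1 (Nat.cast_nonneg (α := ℝ) (tau d))
    have h5 := mul_le_mul_of_nonneg_left h2
      (show (0 : ℝ) ≤ tau d * (N / x) by positivity)
    refine (add_le_add h4 h5).trans ?_
    have h6 := log_le_two_mul_sqrt hx
    have hs3 : 1 ≤ Real.sqrt x := Real.one_le_sqrt.2 (by linarith)
    -- Here `K₃ ≥ 1` lets the divisor sum of the integers themselves be absorbed in the `K₃` term;
    -- `log x ≤ 2√x` takes care of the rest.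
    have h7 : 2 * (ℓ / d + 1) * (1 + Real.log x) + 4 * Real.sqrt x
        ≤ 4 * K₃ * Real.log x * (ℓ / d) + 12 * Real.sqrt x := by
      have : 0 ≤ ℓ / d := by positivity
      have h8 : (ℓ / d) * (1 + Real.log x) ≤ (ℓ / d) * (2 * (K₃ * Real.log x)) := by
        gcongr; nlinarith
      linarith
    have h9 : K₃ * (ℓ / d) ≤ K₃ * (ℓ / d) * Real.log x :=
      le_mul_of_one_le_right (by positivity) hlx
    calc _ ≤ (tau d : ℝ) * (K₃ * (ℓ / d) * Real.log x * (N / x) + N / K₂)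
          + tau d * (N / x) * (4 * K₃ * Real.log x * (ℓ / d) + 12 * Real.sqrt x) := by
          gcongr
      _ = _ := by ring
  refine (Finset.sum_le_sum hinner).trans ?_
  rw [Finset.sum_add_distrib, ← Finset.mul_sum, ← Finset.mul_sum]
  set δ := 1 / Real.log P
  have hlP : 0 < Real.log P := Real.log_pos (by linarith)
  have hδ : 0 < δ := by positivity
  have hRδ : 0 < R ^ δ := by positivity
  -- Rankin's trick: every `d` here exceeds `R`, so inserting `(d / R) ^ δ ≥ 1` gains `R ^ (-δ)`.
  have hA : ∑ d ∈ E, (tau d : ℝ) / d ≤ C * Real.log P ^ 2 / R ^ δ := by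
    have h1 := hsm P hP E fun n hn => (Finset.mem_filter.1 (Finset.mem_filter.1 hn).1).2
    rw [le_div_iff₀ hRδ, Finset.sum_mul]
    refine le_trans (Finset.sum_le_sum fun d hd => ?_) h1
    obtain ⟨hd1, hd2⟩ := Finset.mem_filter.1 hd
    have hd0 : 0 < d := (mem_upTo.1 (Finset.mem_filter.1 hd1).1).1
    have hdR : (0 : ℝ) < d := by exact_mod_cast hd0
    rw [Real.rpow_add hdR, Real.rpow_neg_one, div_mul_eq_mul_div, mul_div_assoc, div_eq_inv_mul]
    gcongr
  have hB : ∑ d ∈ E, (tau d : ℝ) ≤ (R * P) * (2 * Real.log x) :=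
    (Finset.sum_le_sum_of_subset_of_nonneg (Finset.filter_subset _ _)
      fun _ _ _ => by positivity).trans (sum_tau_smoothUpTo_le (by nlinarith) hRP hlx)
  have hsx : Real.sqrt x * (N / x) = N / Real.sqrt x := by
    rw [← mul_div_assoc, div_eq_div_iff hx.ne' (Real.sqrt_pos.2 hx).ne']
    have := Real.mul_self_sqrt hx.le
    linear_combination N * this
  have h1 : (5 * K₃ * Real.log x * ℓ * (N / x)) * ∑ d ∈ E, (tau d : ℝ) / d
      ≤ (5 * K₃ * Real.log x * ℓ * (N / x)) * (C * Real.log P ^ 2 / R ^ δ) := by gcongr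
  have h2 : (N / K₂ + 12 * Real.sqrt x * (N / x)) * ∑ d ∈ E, (tau d : ℝ)
      ≤ (N / K₂ + 12 * Real.sqrt x * (N / x)) * ((R * P) * (2 * Real.log x)) := by gcongr
  refine (add_le_add h1 h2).trans ?_
  rw [mul_assoc 12, hsx]
  have hR0 : 0 < R := by linarith
  have hP0 : 0 < P := by linarith
  have hsx0 : 0 < Real.sqrt x := Real.sqrt_pos.2 hx
  have t1 : 0 ≤ N * Real.log x * (R * P / K₂) := by positivity
  have t2 : 0 ≤ N * Real.log x * (Real.log P ^ 2 * K₃ * ℓ / (x * R ^ δ)) := by positivity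
  have t3 : 0 ≤ N * Real.log x * (R * P / Real.sqrt x) := by positivity
  have e : (5 * K₃ * Real.log x * ℓ * (N / x)) * (C * Real.log P ^ 2 / R ^ δ)
        + (N / K₂ + 12 * (N / Real.sqrt x)) * ((R * P) * (2 * Real.log x))
      = 5 * C * (N * Real.log x * (Real.log P ^ 2 * K₃ * ℓ / (x * R ^ δ)))
        + 2 * (N * Real.log x * (R * P / K₂)) + 24 * (N * Real.log x * (R * P / Real.sqrt x)) := by
    field_simp
    ring
  rw [e, tailBound]
  rw [mul_add (N * Real.log x), mul_add (N * Real.log x)]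
  nlinarith [mul_nonneg hC.le t1, mul_nonneg hC.le t3]

/-- Over a block, `a` may be replaced by its mean value against weights depending only on the
smooth part. -/
theorem exists_norm_block_sum_le :
    ∃ C : ℝ, 0 < C ∧ ∀ (a : ℕ → ℂ) (x P R K₁ K₂ K₃ : ℝ), 3 ≤ P → P ≤ R → R * P ≤ x →
      0 < K₁ → 0 < K₂ → 1 ≤ K₃ →
      ResemblesIntegersI a x P K₁ K₂ → ResemblesIntegersII a x K₂ K₃ →
      ∀ (h : ℕ) (D : Finset ℕ) (ℓ : ℝ), 1 ≤ h → IsBlock D ℓ → 0 ≤ ℓ → (∀ n ∈ D, (n : ℝ) ≤ x / h) →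
      ∀ (c : ℕ → ℝ) (B : ℝ), 0 ≤ B → (∀ s, s ≠ 0 → |c s| ≤ B * tau s) →
        ‖∑ n ∈ D, (a (n * h) - total a x / x) * (c (smoothPart (⌊P⌋₊ + 1) n) : ℂ)‖
          ≤ ℓ * absTotal a x / (x * K₁) * ∑ s ∈ smoothUpTo P R, |c s| / s
            + C * B * tailBound (absTotal a x) x P R K₂ K₃ ℓ := by
  obtain ⟨C, hC, hL⟩ := exists_sum_large_smoothPart_le
  refine ⟨C + 2, by positivity, ?_⟩
  intro a x P R K₁ K₂ K₃ hP hPR hRP hK₁ hK₂ hK₃ hI hII h D ℓ hh hD hℓ hDx c B hB hc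
  have hR : 3 ≤ R := hP.trans hPR
  have hx9 : 9 ≤ x := by nlinarith
  have hx : 0 < x := by linarith
  have hlx : 1 ≤ Real.log x := by
    rw [Real.le_log_iff_exp_le hx]
    have := Real.exp_one_lt_d9; linarith
  have hN := absTotal_nonneg a x
  have hS := norm_total_le a x
  have hL' := hL a x P R K₂ K₃ hP hPR hRP hK₂ hK₃ hII h D ℓ hh hD hℓ hDx
  set N := absTotal a x
  set S := total a x
  have hlarge : ‖∑ n ∈ D.filter (fun n => R < (smoothPart (⌊P⌋₊ + 1) n : ℝ)),
      (a (n * h) - S / x) * (c (smoothPart (⌊P⌋₊ + 1) n) : ℂ)‖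
      ≤ B * (C * tailBound N x P R K₂ K₃ ℓ) := by
    refine (norm_sum_le _ _).trans ?_
    refine le_trans ?_ (mul_le_mul_of_nonneg_left hL' hB)
    rw [Finset.mul_sum]
    refine Finset.sum_le_sum fun n hn => ?_
    have hn0 : n ≠ 0 := by rintro rfl; exact hD.zero_notMem (Finset.mem_filter.1 hn).1
    rw [norm_mul, Complex.norm_real, Real.norm_eq_abs]
    have h1 := (hc _ (smoothPart_ne_zero (⌊P⌋₊ + 1) n)).trans (mul_le_mul_of_nonneg_left
      (Nat.cast_le.2 (tau_le_of_dvd hn0 (smoothPart_dvd (⌊P⌋₊ + 1) hn0))) hB)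
    have h2 : ‖a (n * h) - S / x‖ ≤ ‖a (n * h)‖ + N / x := by
      refine (norm_sub_le _ _).trans (add_le_add_right ?_ _)
      rw [norm_div, Complex.norm_real, Real.norm_of_nonneg hx.le]
      gcongr
    calc _ ≤ (‖a (n * h)‖ + N / x) * (B * tau n) :=
          mul_le_mul h2 h1 (abs_nonneg _) (by positivity)
      _ = _ := by ring
  have hsmall : ‖∑ n ∈ D.filter (fun n => (smoothPart (⌊P⌋₊ + 1) n : ℝ) ≤ R),
      (a (n * h) - S / x) * (c (smoothPart (⌊P⌋₊ + 1) n) : ℂ)‖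
      ≤ ℓ * N / (x * K₁) * ∑ s ∈ smoothUpTo P R, |c s| / s
        + B * (2 * (N * Real.log x * (R * P / K₂))) := by
    rw [sum_filter_smoothPart_le_eq (by linarith) hD.zero_notMem]
    refine (norm_sum_le _ _).trans ?_
    have hterm : ∀ s ∈ smoothUpTo P R, ‖∑ k ∈ (quot D s).filter (Rough P),
        (a (s * k * h) - S / x) * (c (smoothPart (⌊P⌋₊ + 1) (s * k)) : ℂ)‖
        ≤ ℓ * N / (x * K₁) * (|c s| / s) + B * (N / K₂) * tau s := by
      intro s hs
      obtain ⟨hs1, hs2⟩ := Finset.mem_filter.1 hs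
      have hs0 : 0 < s := (mem_upTo.1 hs1).1
      have hsR : (0 : ℝ) < s := by exact_mod_cast hs0
      have hq := hD.quot hs0
      have hqx : ∀ k ∈ quot D s, (k : ℝ) ≤ x / ((s * h : ℕ) : ℝ) := by
        intro k hk
        have hhR : (1 : ℝ) ≤ h := by exact_mod_cast hh
        have := hDx _ ((mem_quot hs0).1 hk)
        push_cast at this ⊢
        rw [le_div_iff₀ (by positivity)] at this ⊢
        linarith
      have h1 := norm_sum_rough_le hx hK₁ hK₂ hI (h := s * h) (Nat.mul_pos hs0 hh) hq
        (by positivity) hqx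
      -- On `n = s * k` with `k` rough, the smooth part is constantly `s`, so the weight leaves the
      -- sum.
      have e : ∑ k ∈ (quot D s).filter (Rough P),
          (a (s * k * h) - S / x) * (c (smoothPart (⌊P⌋₊ + 1) (s * k)) : ℂ)
          = (∑ k ∈ (quot D s).filter (Rough P), (a (k * (s * h)) - S / x)) * (c s : ℂ) := by
        rw [Finset.sum_mul]
        refine Finset.sum_congr rfl fun k hk => ?_
        obtain ⟨hk1, hk2⟩ := Finset.mem_filter.1 hk
        have hk0 : k ≠ 0 := by rintro rfl; exact hq.zero_notMem hk1
        rw [smoothPart_mul _ hs2.1 hk0, smoothPart_eq_self hs2,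
          smoothPart_eq_one ((rough_iff (by linarith) k).1 hk2), mul_one,
          show s * k * h = k * (s * h) by ring]
      rw [e, norm_mul, Complex.norm_real, Real.norm_eq_abs]
      calc _ ≤ (ℓ / s / K₁ * (N / x) + N / K₂) * |c s| := by gcongr
        _ = ℓ * N / (x * K₁) * (|c s| / s) + (N / K₂) * |c s| := by field_simp
        _ ≤ ℓ * N / (x * K₁) * (|c s| / s) + (N / K₂) * (B * tau s) := by
            gcongr; exact hc s hs0.ne'
        _ = _ := by ring
    refine (Finset.sum_le_sum hterm).trans ?_
    rw [Finset.sum_add_distrib, ← Finset.mul_sum, ← Finset.mul_sum]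
    refine add_le_add_right ?_ _
    have h2 := sum_tau_smoothUpTo_le (P := P) (y := R) (x := x) (by linarith) (by nlinarith) hlx
    calc _ ≤ B * (N / K₂) * (R * (2 * Real.log x)) := by gcongr
      _ ≤ B * (N / K₂) * (R * P * (2 * Real.log x)) := by
          gcongr; exact le_mul_of_one_le_right (by linarith) (by linarith)
      _ = _ := by ring
  have hsplit := Finset.sum_filter_add_sum_filter_not D
    (fun n => (smoothPart (⌊P⌋₊ + 1) n : ℝ) ≤ R)
    (fun n => (a (n * h) - S / x) * (c (smoothPart (⌊P⌋₊ + 1) n) : ℂ))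
  simp only [not_le] at hsplit
  rw [← hsplit]
  refine (norm_add_le _ _).trans ((add_le_add hsmall hlarge).trans ?_)
  have hT : N * Real.log x * (R * P / K₂) ≤ tailBound N x P R K₂ K₃ ℓ := by
    rw [tailBound]
    have hR0 : 0 < R := by linarith
    have hP0 : 0 < P := by linarith
    refine mul_le_mul_of_nonneg_left ?_ (by positivity)
    have t2 : 0 ≤ Real.log P ^ 2 * K₃ * ℓ / (x * R ^ (1 / Real.log P)) := by positivity
    have t3 : 0 ≤ R * P / Real.sqrt x := by positivity
    linarith
  have := mul_le_mul_of_nonneg_left hT hB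
  linarith

/-! ### The variance as a quadratic form -/

theorem filter_Icc_modEq_eq_singleton {q : ℕ} (hq : 0 < q) (n : ℕ) :
    ∃ c : ℕ, (Finset.Icc 1 q).filter (fun b => n ≡ b [MOD q]) = {c} ∧ n ≡ c [MOD q] := by
  have key : ∀ c : ℕ, 1 ≤ c → c ≤ q → n ≡ c [MOD q] →
      (Finset.Icc 1 q).filter (fun b => n ≡ b [MOD q]) = {c} := by
    intro c h1 h2 h3
    ext b
    simp only [Finset.mem_filter, Finset.mem_Icc, Finset.mem_singleton]
    constructor
    · rintro ⟨⟨hb1, hb2⟩, hb3⟩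
      have h4 : b ≡ c [MOD q] := hb3.symm.trans h3
      have h5 := (Nat.modEq_iff_dvd.1 h4)
      obtain ⟨e, he⟩ := h5
      have : e = 0 := by
        rcases lt_trichotomy e 0 with h | h | h
        · have : (q : ℤ) * e ≤ q * (-1) := by gcongr; omega
          omega
        · exact h
        · have : (q : ℤ) * 1 ≤ q * e := by gcongr; omega
          omega
      rw [this] at he; omega
    · rintro rfl; exact ⟨⟨h1, h2⟩, h3⟩
  by_cases h0 : n % q = 0
  · have : n ≡ q [MOD q] := by rw [Nat.ModEq, h0, Nat.mod_self]
    exact ⟨q, key q hq le_rfl this, this⟩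
  · have : n ≡ n % q [MOD q] := (Nat.mod_modEq n q).symm
    exact ⟨n % q, key _ (Nat.pos_of_ne_zero h0) (Nat.mod_lt n hq).le this, this⟩

/-- Summation over residue classes. -/
theorem sum_Icc_sum_filter_modEq {M : Type*} [AddCommMonoid M] {q : ℕ} (hq : 0 < q)
    (s : Finset ℕ) (g : ℕ → ℕ → M) (hg : ∀ n b, n ≡ b [MOD q] → g b n = g n n) :
    ∑ b ∈ Finset.Icc 1 q, ∑ n ∈ s.filter (fun n => n ≡ b [MOD q]), g b n = ∑ n ∈ s, g n n := by
  simp only [Finset.sum_filter]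
  rw [Finset.sum_comm]
  refine Finset.sum_congr rfl fun n _ => ?_
  obtain ⟨c, hc, hnc⟩ := filter_Icc_modEq_eq_singleton hq n
  rw [← Finset.sum_filter, hc, Finset.sum_singleton]
  exact hg n c hnc

/-- The kernel of the averaging operator modulo `q`. -/
def gcdWeight (q m n : ℕ) : ℝ :=
  if Nat.gcd m q = Nat.gcd n q then 1 / ((q / Nat.gcd m q).totient : ℝ) else 0

theorem gcdWeight_comm (q m n : ℕ) : gcdWeight q m n = gcdWeight q n m := by
  unfold gcdWeight
  by_cases h : Nat.gcd m q = Nat.gcd n q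
  · rw [if_pos h, if_pos h.symm, h]
  · rw [if_neg h, if_neg (Ne.symm h)]

theorem gcdWeight_congr {q m b : ℕ} (h : m ≡ b [MOD q]) (n : ℕ) :
    gcdWeight q b n = gcdWeight q m n := by
  unfold gcdWeight
  rw [h.gcd_eq]

theorem aver_eq (a : ℕ → ℂ) (z : ℝ) {q : ℕ} (hq : 0 < q) (m : ℕ) :
    aver a z q (Nat.gcd m q) = ∑ n ∈ upTo z, (gcdWeight q m n : ℂ) * a n := by
  unfold aver progSum
  have h := sum_Icc_sum_filter_modEq hq (upTo z)
    (fun b n => if Nat.gcd b q = Nat.gcd m q then a n else 0) (fun n b hnb => by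
      simp only [hnb.gcd_eq])
  rw [Finset.sum_filter]
  have e : ∑ b ∈ Finset.Icc 1 q, (if Nat.gcd b q = Nat.gcd m q then
        ∑ n ∈ (upTo z).filter (fun n => n ≡ b [MOD q]), a n else 0)
      = ∑ b ∈ Finset.Icc 1 q, ∑ n ∈ (upTo z).filter (fun n => n ≡ b [MOD q]),
        (if Nat.gcd b q = Nat.gcd m q then a n else 0) := by
    refine Finset.sum_congr rfl fun b _ => ?_
    split_ifs with hb
    · rfl
    · simp
  rw [e, h, Finset.mul_sum]
  refine Finset.sum_congr rfl fun n _ => ?_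
  unfold gcdWeight
  by_cases hn : Nat.gcd m q = Nat.gcd n q
  · rw [if_pos hn, if_pos hn.symm]; push_cast; rfl
  · rw [if_neg hn, if_neg (Ne.symm hn)]; simp

theorem card_filter_gcd_eq {q m : ℕ} (hq : 0 < q) :
    ((Finset.Icc 1 q).filter (fun b => Nat.gcd b q = Nat.gcd m q)).card
      = (q / Nat.gcd m q).totient := by
  rw [Nat.totient_div_of_dvd (Nat.gcd_dvd_right m q)]
  refine Finset.card_bij' (fun b _ => b % q) (fun b _ => if b = 0 then q else b) ?_ ?_ ?_ ?_
  · intro b hb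
    simp only [Finset.mem_filter, Finset.mem_Icc, Finset.mem_range] at hb ⊢
    refine ⟨Nat.mod_lt b hq, ?_⟩
    rw [Nat.gcd_comm, (Nat.mod_modEq b q).gcd_eq, hb.2]
  · intro b hb
    simp only [Finset.mem_filter, Finset.mem_Icc, Finset.mem_range] at hb ⊢
    split_ifs with h
    · subst h; exact ⟨⟨hq, le_rfl⟩, by simpa using hb.2⟩
    · exact ⟨⟨by omega, hb.1.le⟩, by rw [Nat.gcd_comm]; exact hb.2⟩
  · intro b hb
    simp only [Finset.mem_filter, Finset.mem_Icc] at hb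
    rcases hb.1.2.eq_or_lt with rfl | h
    · simp
    · rw [Nat.mod_eq_of_lt h, if_neg (by omega)]
  · intro b hb
    simp only [Finset.mem_filter, Finset.mem_range] at hb
    split_ifs with h
    · rw [Nat.mod_self, h]
    · exact Nat.mod_eq_of_lt hb.1

/-- The averaging operator is idempotent: the residues of a given gcd with `q` number exactly `φ(q /
gcd)`. -/
theorem sum_gcdWeight_mul_gcdWeight {q : ℕ} (hq : 0 < q) (m n : ℕ) :
    ∑ b ∈ Finset.Icc 1 q, gcdWeight q b m * gcdWeight q b n = gcdWeight q m n := by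
  have hφ : ((q / Nat.gcd m q).totient : ℝ) ≠ 0 := by
    have : 0 < q / Nat.gcd m q := Nat.div_pos (Nat.gcd_le_right m hq) (Nat.gcd_pos_of_pos_right m hq)
    exact_mod_cast (Nat.totient_pos.2 this).ne'
  have e : ∀ b ∈ Finset.Icc 1 q, gcdWeight q b m * gcdWeight q b n
      = if Nat.gcd b q = Nat.gcd m q then
          1 / ((q / Nat.gcd m q).totient : ℝ) * gcdWeight q m n else 0 := by
    intro b _
    by_cases h : Nat.gcd b q = Nat.gcd m q
    · rw [if_pos h]; unfold gcdWeight; rw [if_pos h, h]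
    · rw [if_neg h]; unfold gcdWeight; rw [if_neg h, zero_mul]
  rw [Finset.sum_congr rfl e, ← Finset.sum_filter, Finset.sum_const, nsmul_eq_mul,
    card_filter_gcd_eq hq, ← mul_assoc, mul_one_div_cancel hφ, one_mul]

theorem sum_progSum_mul_conj_aver (a : ℕ → ℂ) (x : ℝ) {q : ℕ} (hq : 0 < q) :
    ∑ b ∈ Finset.Icc 1 q, progSum a x q b * conj (aver a x q (Nat.gcd b q))
      = ∑ m ∈ upTo x, ∑ n ∈ upTo x, a m * conj (a n) * (gcdWeight q m n : ℂ) := by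
  rw [← sum_Icc_sum_filter_modEq hq (upTo x)
    (fun b m => ∑ n ∈ upTo x, a m * conj (a n) * (gcdWeight q b n : ℂ))
    (fun m b h => by simp only [gcdWeight_congr h])]
  refine Finset.sum_congr rfl fun b _ => ?_
  rw [aver_eq a x hq, progSum, map_sum, Finset.sum_mul_sum]
  refine Finset.sum_congr rfl fun m _ => Finset.sum_congr rfl fun n _ => ?_
  rw [map_mul, Complex.conj_ofReal]; ring

theorem sum_aver_mul_conj_aver (a : ℕ → ℂ) (x : ℝ) {q : ℕ} (hq : 0 < q) :
    ∑ b ∈ Finset.Icc 1 q, aver a x q (Nat.gcd b q) * conj (aver a x q (Nat.gcd b q))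
      = ∑ m ∈ upTo x, ∑ n ∈ upTo x, a m * conj (a n) * (gcdWeight q m n : ℂ) := by
  have e : ∀ b ∈ Finset.Icc 1 q, aver a x q (Nat.gcd b q) * conj (aver a x q (Nat.gcd b q))
      = ∑ m ∈ upTo x, ∑ n ∈ upTo x, a m * conj (a n) *
        ((gcdWeight q b m * gcdWeight q b n : ℝ) : ℂ) := by
    intro b _
    rw [aver_eq a x hq, map_sum, Finset.sum_mul_sum]
    refine Finset.sum_congr rfl fun m _ => Finset.sum_congr rfl fun n _ => ?_
    rw [map_mul, Complex.conj_ofReal]; push_cast; ring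
  rw [Finset.sum_congr rfl e, Finset.sum_comm]
  refine Finset.sum_congr rfl fun m _ => ?_
  rw [Finset.sum_comm]
  refine Finset.sum_congr rfl fun n _ => ?_
  rw [← Finset.mul_sum, ← sum_gcdWeight_mul_gcdWeight hq m n]
  push_cast; rfl

theorem sum_progSum_mul_conj_progSum (a : ℕ → ℂ) (x : ℝ) {q : ℕ} (hq : 0 < q) :
    ∑ b ∈ Finset.Icc 1 q, progSum a x q b * conj (progSum a x q b)
      = ∑ m ∈ upTo x, ∑ n ∈ upTo x, if n ≡ m [MOD q] then a m * conj (a n) else 0 := by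
  rw [← sum_Icc_sum_filter_modEq hq (upTo x)
    (fun b m => ∑ n ∈ upTo x, if n ≡ b [MOD q] then a m * conj (a n) else 0)
    (fun m b h => by
      refine Finset.sum_congr rfl fun n _ => ?_
      exact if_congr ⟨fun h' => h'.trans h.symm, fun h' => h'.trans h⟩ rfl rfl)]
  refine Finset.sum_congr rfl fun b _ => ?_
  rw [progSum, map_sum, Finset.sum_mul_sum]
  refine Finset.sum_congr rfl fun m _ => ?_
  rw [Finset.sum_filter]

/-- For a self-adjoint projection `A`, `‖f - A f‖² = ⟨f, f⟩ - ⟨f, A f⟩`; both cross terms and the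
square of the average have the same value. -/
theorem sum_norm_sq_progSum_sub_aver (a : ℕ → ℂ) (x : ℝ) {q : ℕ} (hq : 0 < q) :
    ((∑ b ∈ Finset.Icc 1 q, ‖progSum a x q b - aver a x q (Nat.gcd b q)‖ ^ 2 : ℝ) : ℂ)
      = ∑ m ∈ upTo x, ∑ n ∈ upTo x, a m * conj (a n) *
        ((if n ≡ m [MOD q] then (1 : ℂ) else 0) - (gcdWeight q m n : ℂ)) := by
  have h1 := sum_progSum_mul_conj_aver a x hq
  have h2 := sum_aver_mul_conj_aver a x hq
  have h3 := sum_progSum_mul_conj_progSum a x hq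
  have h4 : ∑ b ∈ Finset.Icc 1 q, aver a x q (Nat.gcd b q) * conj (progSum a x q b)
      = ∑ m ∈ upTo x, ∑ n ∈ upTo x, a m * conj (a n) * (gcdWeight q m n : ℂ) := by
    have := congrArg conj h1
    simp only [map_sum, map_mul, Complex.conj_conj, Complex.conj_ofReal] at this
    rw [Finset.sum_congr rfl fun b _ => mul_comm _ _, this, Finset.sum_comm]
    refine Finset.sum_congr rfl fun m _ => Finset.sum_congr rfl fun n _ => ?_
    rw [gcdWeight_comm]; ring
  have e : ∀ b : ℕ, ((‖progSum a x q b - aver a x q (Nat.gcd b q)‖ ^ 2 : ℝ) : ℂ)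
      = progSum a x q b * conj (progSum a x q b) - progSum a x q b * conj (aver a x q (Nat.gcd b q))
        - aver a x q (Nat.gcd b q) * conj (progSum a x q b)
        + aver a x q (Nat.gcd b q) * conj (aver a x q (Nat.gcd b q)) := by
    intro b
    rw [← Complex.normSq_eq_norm_sq, Complex.normSq_eq_conj_mul_self, map_sub]; ring
  rw [Complex.ofReal_sum, Finset.sum_congr rfl fun b _ => e b, Finset.sum_add_distrib,
    Finset.sum_sub_distrib, Finset.sum_sub_distrib, h1, h2, h3, h4, sub_add_cancel,
    ← Finset.sum_sub_distrib]
  refine Finset.sum_congr rfl fun m _ => ?_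
  rw [← Finset.sum_sub_distrib]
  refine Finset.sum_congr rfl fun n _ => ?_
  split_ifs <;> ring

/-! ### Complementary divisors -/

/-- The distance between two natural numbers. -/
def gap (m n : ℕ) : ℕ := ((m : ℤ) - n).natAbs

/-- `⌈2|m - n| / Q⌉`. -/
def gapIndex (Q : ℝ) (m n : ℕ) : ℕ := ⌈2 * (gap m n : ℝ) / Q⌉₊

theorem modEq_iff_dvd_gap {q m n : ℕ} : n ≡ m [MOD q] ↔ q ∣ gap m n := by
  rw [Nat.modEq_iff_dvd, gap, Int.natCast_dvd]

theorem gap_comm (m n : ℕ) : gap m n = gap n m := by unfold gap; omega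

theorem gapIndex_comm (Q : ℝ) (m n : ℕ) : gapIndex Q m n = gapIndex Q n m := by
  unfold gapIndex; rw [gap_comm]

theorem filter_upTo_eq_dyadic {Q : ℝ} (hQ : 0 ≤ Q) :
    (upTo Q).filter (fun q : ℕ => Q / 2 < (q : ℝ)) = dyadic (⌊Q⌋₊ + 1) := by
  ext q
  have h : ⌊Q⌋₊ + 1 ≤ 2 * q ↔ Q < ((2 * q : ℕ) : ℝ) := by
    rw [Nat.succ_le_iff, Nat.floor_lt hQ]
  rw [Finset.mem_filter, mem_upTo, mem_dyadic, Nat.lt_succ_iff, Nat.le_floor_iff hQ, h]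
  push_cast
  constructor
  · rintro ⟨⟨_, h1⟩, h2⟩; exact ⟨h1, by linarith⟩
  · rintro ⟨h1, h2⟩
    refine ⟨⟨?_, h1⟩, by linarith⟩
    by_contra h
    have : q = 0 := by omega
    subst this; simp at h2; linarith

theorem mem_dyadic_ceil {Q : ℝ} (hQ : 0 < Q) {t r : ℕ} :
    r ∈ dyadic ⌈2 * (t : ℝ) / Q⌉₊ ↔ (r : ℝ) * Q / 2 < t ∧ (t : ℝ) ≤ r * Q := by
  rw [mem_dyadic, Nat.lt_ceil, Nat.ceil_le, lt_div_iff₀ hQ, div_le_iff₀ hQ]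
  push_cast
  constructor
  · rintro ⟨h1, h2⟩; constructor <;> linarith
  · rintro ⟨h1, h2⟩; constructor <;> linarith

/-- Switching to the complementary divisor. -/
theorem card_dyadic_filter_dvd {Q : ℝ} (hQ : 0 < Q) {t : ℕ} (ht : 0 < t) :
    ((dyadic (⌊Q⌋₊ + 1)).filter (· ∣ t)).card
      = ((dyadic ⌈2 * (t : ℝ) / Q⌉₊).filter (· ∣ t)).card := by
  rw [← filter_upTo_eq_dyadic hQ.le]
  have h1 : ∀ q r : ℕ, 0 < q → 0 < r → q * r = t → ((q : ℝ) ≤ Q ↔ (t : ℝ) ≤ r * Q) ∧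
      (Q / 2 < q ↔ (r : ℝ) * Q / 2 < t) := by
    intro q r hq hr h
    have hR : (0 : ℝ) < r := by exact_mod_cast hr
    have e : (t : ℝ) = r * q := by rw [← h]; push_cast; ring
    rw [e, mul_div_assoc, mul_le_mul_iff_right₀ hR, mul_lt_mul_iff_right₀ hR]
    exact ⟨Iff.rfl, Iff.rfl⟩
  refine Finset.card_bij' (fun q _ => t / q) (fun r _ => t / r) ?_ ?_ ?_ ?_
  · intro q hq
    obtain ⟨hq, hqt⟩ := Finset.mem_filter.1 hq
    obtain ⟨hq, hq3⟩ := Finset.mem_filter.1 hq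
    obtain ⟨hq1, hq2⟩ := mem_upTo.1 hq
    have := h1 q (t / q) hq1 (Nat.div_pos (Nat.le_of_dvd ht hqt) hq1) (Nat.mul_div_cancel' hqt)
    rw [Finset.mem_filter, mem_dyadic_ceil hQ]
    exact ⟨⟨this.2.1 hq3, this.1.1 hq2⟩, Nat.div_dvd_of_dvd hqt⟩
  · intro r hr
    obtain ⟨hr, hrt⟩ := Finset.mem_filter.1 hr
    have hr0 := pos_of_mem_dyadic hr
    rw [mem_dyadic_ceil hQ] at hr
    have hq0 := Nat.div_pos (Nat.le_of_dvd ht hrt) hr0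
    have := h1 (t / r) r hq0 hr0 (Nat.div_mul_cancel hrt)
    rw [Finset.mem_filter, Finset.mem_filter, mem_upTo]
    exact ⟨⟨⟨hq0, this.1.2 hr.2⟩, this.2.2 hr.1⟩, Nat.div_dvd_of_dvd hrt⟩
  · intro q hq
    exact Nat.div_div_self (Finset.mem_filter.1 hq).2 ht.ne'
  · intro r hr
    exact Nat.div_div_self (Finset.mem_filter.1 hr).2 ht.ne'

theorem gap_self (m : ℕ) : gap m m = 0 := by simp [gap]

theorem gapIndex_self (Q : ℝ) (m : ℕ) : gapIndex Q m m = 0 := by simp [gapIndex, gap_self]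

/-- The difference of the two averaged kernels. -/
def pairWeight (Q : ℝ) (m n : ℕ) : ℝ :=
  ∑ r ∈ dyadic (gapIndex Q m n), gcdWeight r m n - ∑ q ∈ dyadic (⌊Q⌋₊ + 1), gcdWeight q m n

/-- On the diagonal every modulus qualifies, and `gapIndex` is 0, so the complementary range is
empty. Off it, divisors are switched. -/
theorem card_dyadic_modEq {Q : ℝ} (hQ : 0 < Q) (m n : ℕ) :
    ((dyadic (⌊Q⌋₊ + 1)).filter (fun q => n ≡ m [MOD q])).card
      = (if m = n then (dyadic (⌊Q⌋₊ + 1)).card else 0)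
        + ((dyadic (gapIndex Q m n)).filter (fun r => n ≡ m [MOD r])).card := by
  by_cases h : m = n
  · subst h
    rw [if_pos rfl, gapIndex_self]
    have : (dyadic (⌊Q⌋₊ + 1)).filter (fun q => m ≡ m [MOD q]) = dyadic (⌊Q⌋₊ + 1) :=
      Finset.filter_true_of_mem fun q _ => Nat.ModEq.refl m
    rw [this]; simp [dyadic]
  · rw [if_neg h, zero_add]
    have h0 : 0 < gap m n := by unfold gap; omega
    simp only [modEq_iff_dvd_gap]
    exact card_dyadic_filter_dvd hQ h0

/-- After the switch, `gcdWeight r` is subtracted from and added to the congruence indicator modulo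
`r`. The three terms are the diagonal, the smooth bilinear form, and the error in progressions to
small moduli. -/
theorem variance_eq (a : ℕ → ℂ) (x : ℝ) {Q : ℝ} (hQ : 0 < Q) :
    (variance a x Q : ℂ) = (dyadic (⌊Q⌋₊ + 1)).card * ∑ n ∈ upTo x, (‖a n‖ ^ 2 : ℂ)
      + ∑ m ∈ upTo x, ∑ n ∈ upTo x, a m * conj (a n) * (pairWeight Q m n : ℂ)
      + ∑ m ∈ upTo x, a m * ∑ n ∈ upTo x, conj (a n) * ∑ r ∈ dyadic (gapIndex Q m n),
          ((if n ≡ m [MOD r] then (1 : ℂ) else 0) - (gcdWeight r m n : ℂ)) := by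
  unfold variance
  rw [filter_upTo_eq_dyadic hQ.le, Complex.ofReal_sum,
    Finset.sum_congr rfl fun q hq => sum_norm_sq_progSum_sub_aver a x (pos_of_mem_dyadic hq),
    Finset.sum_comm]
  have hdiag : (dyadic (⌊Q⌋₊ + 1)).card * ∑ n ∈ upTo x, (‖a n‖ ^ 2 : ℂ)
      = ∑ m ∈ upTo x, ∑ n ∈ upTo x, a m * conj (a n)
        * (if m = n then ((dyadic (⌊Q⌋₊ + 1)).card : ℂ) else 0) := by
    rw [Finset.mul_sum]
    refine Finset.sum_congr rfl fun m hm => ?_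
    rw [Finset.sum_eq_single m]
    · rw [if_pos rfl, Complex.mul_conj, Complex.normSq_eq_norm_sq]; push_cast; ring
    · intro n _ hn; rw [if_neg (Ne.symm hn), mul_zero]
    · exact fun h => absurd hm h
  rw [hdiag, ← Finset.sum_add_distrib, ← Finset.sum_add_distrib]
  refine Finset.sum_congr rfl fun m _ => ?_
  rw [Finset.sum_comm, ← Finset.sum_add_distrib, Finset.mul_sum, ← Finset.sum_add_distrib]
  refine Finset.sum_congr rfl fun n _ => ?_
  have h := card_dyadic_modEq hQ m n
  have h' := congrArg (Nat.cast : ℕ → ℂ) h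
  rw [Finset.card_filter, Nat.cast_sum] at h'
  push_cast at h'
  rw [← Finset.mul_sum, Finset.sum_sub_distrib, h', pairWeight, Finset.sum_sub_distrib,
    Finset.card_filter]
  push_cast
  ring

/-! ### The error controlled by the Progressions Condition -/

theorem upTo_natCast (B : ℕ) : upTo (B : ℝ) = Finset.Ioc 0 B := by
  unfold upTo; rw [Nat.floor_natCast]; rfl

theorem progSum_sub_aver_eq (a : ℕ → ℂ) (z : ℝ) {r : ℕ} (hr : 0 < r) (m : ℕ) :
    progSum a z r m - aver a z r (Nat.gcd m r)
      = ∑ n ∈ upTo z, a n * ((if n ≡ m [MOD r] then (1 : ℂ) else 0) - (gcdWeight r m n : ℂ)) := by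
  rw [aver_eq a z hr, progSum, Finset.sum_filter, ← Finset.sum_sub_distrib]
  refine Finset.sum_congr rfl fun n _ => ?_
  split_ifs <;> ring

theorem norm_le_maxDiscrepancy (a : ℕ → ℂ) {x z : ℝ} (hz : z ≤ x) (r m : ℕ) :
    ‖progSum a z r m - aver a z r (Nat.gcd m r)‖ ≤ maxDiscrepancy a x r m :=
  le_ciSup (f := fun z : Set.Iic x =>
    ‖progSum a (z : ℝ) r m - aver a (z : ℝ) r (Nat.gcd m r)‖)
    (finite_range_discrepancy a x r m).bddAbove ⟨z, hz⟩

theorem maxDiscrepancy_nonneg (a : ℕ → ℂ) (x : ℝ) (r m : ℕ) : 0 ≤ maxDiscrepancy a x r m :=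
  (norm_nonneg _).trans (norm_le_maxDiscrepancy a (le_refl x) r m)

theorem maxDiscrepancy_congr (a : ℕ → ℂ) (x : ℝ) {r m b : ℕ} (h : m ≡ b [MOD r]) :
    maxDiscrepancy a x r m = maxDiscrepancy a x r b := by
  unfold maxDiscrepancy progSum
  rw [h.gcd_eq]
  have e : ∀ z : ℝ, (upTo z).filter (fun n => n ≡ m [MOD r])
      = (upTo z).filter (fun n => n ≡ b [MOD r]) := fun z =>
    Finset.filter_congr fun n _ => ⟨fun h' => h'.trans h, fun h' => h'.trans h.symm⟩
  simp only [e]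

/-- A block is a difference of two initial segments, hence the factor 2. -/
theorem norm_sum_discrepancy_le (a : ℕ → ℂ) {x : ℝ} {r : ℕ} (hr : 0 < r) (m : ℕ) {D : Finset ℕ}
    (hD : (D : Set ℕ).OrdConnected) (h0 : 0 ∉ D) (hDx : ∀ n ∈ D, (n : ℝ) ≤ x) :
    ‖∑ n ∈ D, conj (a n) * ((if n ≡ m [MOD r] then (1 : ℂ) else 0) - (gcdWeight r m n : ℂ))‖
      ≤ 2 * maxDiscrepancy a x r m := by
  have hconj : ‖∑ n ∈ D, conj (a n) * ((if n ≡ m [MOD r] then (1 : ℂ) else 0)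
        - (gcdWeight r m n : ℂ))‖
      = ‖∑ n ∈ D, a n * ((if n ≡ m [MOD r] then (1 : ℂ) else 0) - (gcdWeight r m n : ℂ))‖ := by
    rw [← Complex.norm_conj, map_sum]
    congr 1
    refine Finset.sum_congr rfl fun n _ => ?_
    rw [map_mul, Complex.conj_conj, map_sub, Complex.conj_ofReal, apply_ite conj, map_one, map_zero]
  rw [hconj]
  rcases D.eq_empty_or_nonempty with rfl | hne
  · have := maxDiscrepancy_nonneg a x r m
    simp; linarith
  obtain ⟨A, B, hAB, rfl⟩ := ordConnected_eq_Ioc hD h0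
  have hlt : A < B := Finset.nonempty_Ioc.1 hne
  have hBx : (B : ℝ) ≤ x := hDx B (Finset.mem_Ioc.2 ⟨hlt, le_rfl⟩)
  have hAx : (A : ℝ) ≤ x := (Nat.cast_le.2 hAB).trans hBx
  have h1 := norm_le_maxDiscrepancy a hBx r m
  have h2 := norm_le_maxDiscrepancy a hAx r m
  rw [progSum_sub_aver_eq a _ hr, upTo_natCast] at h1 h2
  rw [← Finset.Ioc_union_Ioc_eq_Ioc (Nat.zero_le A) hAB, Finset.sum_union
    (Finset.disjoint_left.2 fun n hn hn' => by
      rw [Finset.mem_Ioc] at hn hn'; omega)] at h1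
  set S := ∑ n ∈ Finset.Ioc 0 A,
    a n * ((if n ≡ m [MOD r] then (1 : ℂ) else 0) - (gcdWeight r m n : ℂ))
  set T := ∑ n ∈ Finset.Ioc A B,
    a n * ((if n ≡ m [MOD r] then (1 : ℂ) else 0) - (gcdWeight r m n : ℂ))
  calc ‖T‖ = ‖(S + T) - S‖ := by rw [add_sub_cancel_left]
    _ ≤ ‖S + T‖ + ‖S‖ := norm_sub_le _ _
    _ ≤ _ := by linarith

theorem gap_cast_of_le {m n : ℕ} (h : m ≤ n) : (gap m n : ℝ) = n - m := by
  have : (gap m n : ℤ) = n - m := by unfold gap; omega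
  exact_mod_cast congrArg (Int.cast : ℤ → ℝ) this

theorem gap_cast_of_ge {m n : ℕ} (h : n ≤ m) : (gap m n : ℝ) = m - n := by
  rw [gap_comm, gap_cast_of_le h]

theorem gap_lt {x : ℝ} {m n : ℕ} (hm : m ∈ upTo x) (hn : n ∈ upTo x) : (gap m n : ℝ) < x := by
  rw [mem_upTo] at hm hn
  have hm1 : (1 : ℝ) ≤ m := by exact_mod_cast hm.1
  have hn1 : (1 : ℝ) ≤ n := by exact_mod_cast hn.1
  rcases le_total m n with h | h
  · rw [gap_cast_of_le h]; linarith
  · rw [gap_cast_of_ge h]; linarith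

/-- For fixed `m` and `r` the admissible `n` satisfy `rQ/2 < |m - n| ≤ rQ`: one block on each side
of `m`, each costing twice the maximal discrepancy. As `|m - n| < x`, only `r ≤ 2x / Q` occur, and
grouping `m` by residue modulo `r` gives the left side of the condition. -/
theorem norm_sum_progression_error_le {a : ℕ → ℂ} {x Q K : ℝ} (hQ : 0 < Q)
    (hP : ProgressionsCondition a x Q K) :
    ‖∑ m ∈ upTo x, a m * ∑ n ∈ upTo x, conj (a n) * ∑ r ∈ dyadic (gapIndex Q m n),
          ((if n ≡ m [MOD r] then (1 : ℂ) else 0) - (gcdWeight r m n : ℂ))‖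
      ≤ 4 * (absTotal a x ^ 2 / K) := by
  have hfix : ∀ m ∈ upTo x, ‖a m * ∑ n ∈ upTo x, conj (a n) * ∑ r ∈ dyadic (gapIndex Q m n),
          ((if n ≡ m [MOD r] then (1 : ℂ) else 0) - (gcdWeight r m n : ℂ))‖
      ≤ ∑ r ∈ upTo (2 * x / Q), 4 * (‖a m‖ * maxDiscrepancy a x r m) := by
    intro m hm
    simp only [Finset.mul_sum (s := dyadic _)]
    rw [Finset.sum_comm' (t' := upTo (2 * x / Q))
      (s' := fun r => (upTo x).filter (fun n => r ∈ dyadic (gapIndex Q m n))), norm_mul]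
    · have h1 : ∀ r ∈ upTo (2 * x / Q),
          ‖∑ n ∈ (upTo x).filter (fun n => r ∈ dyadic (gapIndex Q m n)),
            conj (a n) * ((if n ≡ m [MOD r] then (1 : ℂ) else 0) - (gcdWeight r m n : ℂ))‖
          ≤ 4 * maxDiscrepancy a x r m := by
        intro r hr
        have hr0 : 0 < r := (mem_upTo.1 hr).1
        rw [← Finset.sum_filter_add_sum_filter_not _ (fun n => m < n)]
        refine (norm_add_le _ _).trans ?_
        have e1 := norm_sum_discrepancy_le a (x := x) hr0 m
          (D := ((upTo x).filter (fun n => r ∈ dyadic (gapIndex Q m n))).filter (fun n => m < n))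
          ⟨fun u hu v hv w hw => by
            simp only [Finset.coe_filter, Set.mem_ofPred_eq, Finset.mem_filter, mem_upTo, gapIndex,
              mem_dyadic_ceil hQ] at hu hv ⊢
            have huw : (u : ℝ) ≤ w := Nat.cast_le.2 hw.1
            have hwv : (w : ℝ) ≤ v := Nat.cast_le.2 hw.2
            rw [gap_cast_of_le hu.2.le] at hu
            rw [gap_cast_of_le hv.2.le] at hv
            have hmw : m < w := hu.2.trans_le hw.1
            rw [gap_cast_of_le hmw.le]
            exact ⟨⟨⟨hu.1.1.1.trans hw.1, hwv.trans hv.1.1.2⟩, by linarith [hu.1.2.1],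
              by linarith [hv.1.2.2]⟩, hmw⟩⟩
          (by simp [mem_upTo])
          (fun n hn => (mem_upTo.1 (Finset.mem_filter.1 (Finset.mem_filter.1 hn).1).1).2)
        have e2 := norm_sum_discrepancy_le a (x := x) hr0 m
          (D := ((upTo x).filter (fun n => r ∈ dyadic (gapIndex Q m n))).filter (fun n => ¬ m < n))
          ⟨fun u hu v hv w hw => by
            simp only [Finset.coe_filter, Set.mem_ofPred_eq, Finset.mem_filter, mem_upTo, gapIndex,
              mem_dyadic_ceil hQ, not_lt] at hu hv ⊢
            have huw : (u : ℝ) ≤ w := Nat.cast_le.2 hw.1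
            have hwv : (w : ℝ) ≤ v := Nat.cast_le.2 hw.2
            rw [gap_cast_of_ge hu.2] at hu
            rw [gap_cast_of_ge hv.2] at hv
            have hmw : w ≤ m := hw.2.trans hv.2
            rw [gap_cast_of_ge hmw]
            exact ⟨⟨⟨hu.1.1.1.trans hw.1, hwv.trans hv.1.1.2⟩, by linarith [hv.1.2.1],
              by linarith [hu.1.2.2]⟩, hmw⟩⟩
          (by simp [mem_upTo])
          (fun n hn => (mem_upTo.1 (Finset.mem_filter.1 (Finset.mem_filter.1 hn).1).1).2)
        linarith
      rw [← Finset.mul_sum, ← Finset.mul_sum, mul_left_comm]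
      refine mul_le_mul_of_nonneg_left ?_ (norm_nonneg _)
      rw [Finset.mul_sum]
      exact (norm_sum_le _ _).trans (Finset.sum_le_sum h1)
    · intro n r
      simp only [Finset.mem_filter]
      constructor
      · rintro ⟨hn, hr⟩
        refine ⟨⟨hn, hr⟩, mem_upTo.2 ⟨pos_of_mem_dyadic hr, ?_⟩⟩
        rw [gapIndex, mem_dyadic_ceil hQ] at hr
        have := gap_lt hm hn
        rw [le_div_iff₀ hQ]; linarith [hr.1]
      · rintro ⟨h, _⟩; exact h
  refine (norm_sum_le _ _).trans ((Finset.sum_le_sum hfix).trans ?_)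
  rw [Finset.sum_comm]
  simp only [← Finset.mul_sum]
  refine mul_le_mul_of_nonneg_left (le_trans (le_of_eq ?_) hP) (by norm_num)
  refine Finset.sum_congr rfl fun r hr => ?_
  rw [← sum_Icc_sum_filter_modEq (mem_upTo.1 hr).1 (upTo x)
    (fun b m => ‖a m‖ * maxDiscrepancy a x r b)
    (fun m b h => by rw [maxDiscrepancy_congr a x h])]
  refine Finset.sum_congr rfl fun b _ => ?_
  rw [Finset.sum_mul]

/-! ### Splitting the pair weight by common divisors -/

/-- At most one `h` survives, the common value of `gcd m q` and `gcd n q`: coprimality of `q / h` to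
both cofactors says that `h` is the full gcd with each of `m` and `n`. -/
theorem gcdWeight_eq_sum {q m n : ℕ} (hq : 0 < q) (hm : 0 < m) :
    gcdWeight q m n = ∑ h ∈ (Nat.gcd m n).divisors,
      if h ∣ q then (if Nat.Coprime (q / h) (m / h * (n / h)) then
        1 / ((q / h).totient : ℝ) else 0) else 0 := by
  have key : ∀ h k, 0 < h → h ∣ k → h ∣ q → (Nat.Coprime (q / h) (k / h) ↔ Nat.gcd k q = h) := by
    rintro h _ hh ⟨k', rfl⟩ ⟨q', rfl⟩
    rw [Nat.mul_div_cancel_left _ hh, Nat.mul_div_cancel_left _ hh, Nat.gcd_mul_left,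
      Nat.coprime_comm]
    unfold Nat.Coprime
    constructor
    · intro e; rw [e, mul_one]
    · intro e
      exact Nat.eq_of_mul_eq_mul_left hh (by rw [e, mul_one])
  have key2 : ∀ h ∈ (Nat.gcd m n).divisors, h ∣ q →
      (Nat.Coprime (q / h) (m / h * (n / h)) ↔ Nat.gcd m q = h ∧ Nat.gcd n q = h) := by
    intro h hh hhq
    have h0 := Nat.pos_of_mem_divisors hh
    have hd := Nat.dvd_of_mem_divisors hh
    rw [Nat.coprime_mul_iff_right, key h m h0 (hd.trans (Nat.gcd_dvd_left m n)) hhq,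
      key h n h0 (hd.trans (Nat.gcd_dvd_right m n)) hhq]
  unfold gcdWeight
  by_cases hg : Nat.gcd m q = Nat.gcd n q
  · rw [if_pos hg]
    have hmem : Nat.gcd m q ∈ (Nat.gcd m n).divisors := by
      rw [Nat.mem_divisors]
      refine ⟨Nat.dvd_gcd (Nat.gcd_dvd_left m q) (hg ▸ Nat.gcd_dvd_left n q), ?_⟩
      exact (Nat.gcd_pos_of_pos_left n hm).ne'
    rw [Finset.sum_eq_single_of_mem _ hmem]
    · rw [if_pos (Nat.gcd_dvd_right m q),
        if_pos ((key2 _ hmem (Nat.gcd_dvd_right m q)).2 ⟨rfl, hg.symm⟩)]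
    · intro h hh hne
      split_ifs with h1 h2
      · exact absurd ((key2 h hh h1).1 h2).1.symm hne
      · rfl
      · rfl
  · rw [if_neg hg]
    symm
    refine Finset.sum_eq_zero fun h hh => ?_
    split_ifs with h1 h2
    · have := (key2 h hh h1).1 h2
      exact absurd (this.1.trans this.2.symm) hg
    · rfl
    · rfl

theorem sum_dyadic_gcdWeight (j : ℕ) {m n : ℕ} (hm : 0 < m) :
    ∑ q ∈ dyadic j, gcdWeight q m n
      = ∑ h ∈ (Nat.gcd m n).divisors, dyadicTotientSum (j ⌈/⌉ h) (m / h * (n / h)) := by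
  rw [Finset.sum_congr rfl fun q hq => gcdWeight_eq_sum (n := n) (pos_of_mem_dyadic hq) hm,
    Finset.sum_comm]
  refine Finset.sum_congr rfl fun h hh => ?_
  have h0 := Nat.pos_of_mem_divisors hh
  rw [← Finset.sum_filter, sum_dyadic_dvd j h0, dyadicTotientSum, Finset.sum_filter]
  refine Finset.sum_congr rfl fun f _ => ?_
  rw [Nat.mul_div_cancel_left f h0]

/-- Nested ceilings collapse and the distance scales by `h`, so rescaling `m` and `n` matches
rescaling the dyadic range exactly. -/
theorem gapIndex_ceilDiv {Q : ℝ} (hQ : 0 < Q) {h m n : ℕ} (hh : 0 < h) (hm : h ∣ m) (hn : h ∣ n) :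
    gapIndex Q m n ⌈/⌉ h = gapIndex Q (m / h) (n / h) := by
  obtain ⟨m', rfl⟩ := hm
  obtain ⟨n', rfl⟩ := hn
  rw [Nat.mul_div_cancel_left _ hh, Nat.mul_div_cancel_left _ hh]
  refine eq_of_forall_ge_iff fun c => ?_
  have hhR : (0 : ℝ) < h := by exact_mod_cast hh
  have hgap : gap (h * m') (h * n') = h * gap m' n' := by
    unfold gap
    have e : ((h * m' : ℕ) : ℤ) - ((h * n' : ℕ) : ℤ) = h * ((m' : ℤ) - n') := by push_cast; ring
    rw [e, Int.natAbs_mul, Int.natAbs_natCast]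
  rw [ceilDiv_le_iff_le_mul hh, gapIndex, gapIndex, Nat.ceil_le, Nat.ceil_le, div_le_iff₀ hQ,
    div_le_iff₀ hQ, hgap]
  push_cast
  constructor
  · intro H; exact le_of_mul_le_mul_left (by linarith) hhR
  · intro H; have := mul_le_mul_of_nonneg_left H hhR.le; linarith

theorem floor_add_one_ceilDiv {Q : ℝ} (hQ : 0 < Q) {h : ℕ} (hh : 0 < h) :
    (⌊Q⌋₊ + 1) ⌈/⌉ h = ⌊Q / h⌋₊ + 1 := by
  refine eq_of_forall_ge_iff fun c => ?_
  have hhR : (0 : ℝ) < h := by exact_mod_cast hh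
  rw [ceilDiv_le_iff_le_mul hh, Nat.succ_le_iff, Nat.succ_le_iff, Nat.floor_lt hQ.le,
    Nat.floor_lt (by positivity), div_lt_iff₀ hhR]
  push_cast
  rw [mul_comm]

/-- The weight attached to pairs of multiples of `h`. -/
def scaledWeight (Q : ℝ) (h k j : ℕ) : ℝ :=
  dyadicTotientSum j k - dyadicTotientSum (⌊Q / h⌋₊ + 1) k

theorem pairWeight_eq {Q : ℝ} (hQ : 0 < Q) {m n : ℕ} (hm : 0 < m) :
    pairWeight Q m n = ∑ h ∈ (Nat.gcd m n).divisors,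
      scaledWeight Q h (m / h * (n / h)) (gapIndex Q (m / h) (n / h)) := by
  unfold pairWeight scaledWeight
  rw [sum_dyadic_gcdWeight _ hm, sum_dyadic_gcdWeight _ hm, ← Finset.sum_sub_distrib]
  refine Finset.sum_congr rfl fun h hh => ?_
  have h0 := Nat.pos_of_mem_divisors hh
  have hd := Nat.dvd_of_mem_divisors hh
  rw [gapIndex_ceilDiv hQ h0 (hd.trans (Nat.gcd_dvd_left m n)) (hd.trans (Nat.gcd_dvd_right m n)),
    floor_add_one_ceilDiv hQ h0]

theorem sum_filter_dvd_upTo {M : Type*} [AddCommMonoid M] (x : ℝ) {h : ℕ} (hh : 0 < h)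
    (f : ℕ → M) :
    ∑ n ∈ (upTo x).filter (h ∣ ·), f n = ∑ k ∈ upTo (x / h), f (k * h) := by
  rw [sum_filter_dvd_eq_sum_quot _ hh]
  have e : quot (upTo x) h = upTo (x / h) := by
    ext k
    have hhR : (0 : ℝ) < h := by exact_mod_cast hh
    rw [mem_quot hh, mem_upTo, mem_upTo, le_div_iff₀ hhR]
    push_cast
    rw [mul_comm (h : ℝ)]
    refine and_congr_left fun _ => ?_
    constructor
    · intro H; exact Nat.pos_of_mul_pos_left H
    · intro H; exact Nat.mul_pos hh H
  rw [e]
  exact Finset.sum_congr rfl fun k _ => by rw [mul_comm]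

theorem sum_mul_pairWeight {Q : ℝ} (hQ : 0 < Q) (x : ℝ) {m : ℕ} (hm : 0 < m) (f : ℕ → ℂ) :
    ∑ n ∈ upTo x, f n * (pairWeight Q m n : ℂ)
      = ∑ h ∈ m.divisors, ∑ k ∈ upTo (x / h),
          f (k * h) * (scaledWeight Q h (m / h * k) (gapIndex Q (m / h) k) : ℂ) := by
  have e : ∀ n ∈ upTo x, f n * (pairWeight Q m n : ℂ)
      = ∑ h ∈ (Nat.gcd m n).divisors,
        f n * (scaledWeight Q h (m / h * (n / h)) (gapIndex Q (m / h) (n / h)) : ℂ) := by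
    intro n _
    rw [pairWeight_eq hQ hm, Complex.ofReal_sum, Finset.mul_sum]
  rw [Finset.sum_congr rfl e, Finset.sum_comm' (t' := m.divisors)
    (s' := fun h => (upTo x).filter (h ∣ ·))]
  · refine Finset.sum_congr rfl fun h hh => ?_
    have h0 := Nat.pos_of_mem_divisors hh
    rw [sum_filter_dvd_upTo x h0]
    refine Finset.sum_congr rfl fun k _ => ?_
    rw [Nat.mul_div_cancel _ h0]
  · intro n h
    simp only [Nat.mem_divisors, Finset.mem_filter, Nat.dvd_gcd_iff]
    constructor
    · rintro ⟨hn, ⟨h1, h2⟩, _⟩; exact ⟨⟨hn, h2⟩, h1, hm.ne'⟩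
    · rintro ⟨⟨hn, h2⟩, h1, _⟩
      exact ⟨hn, ⟨h1, h2⟩, (Nat.gcd_pos_of_pos_left n hm).ne'⟩

/-! ### Passing to smooth parts; decay of the weights -/

theorem sum_biUnion_le_sum {ι α : Type*} [DecidableEq α] (T : Finset ι) (s : ι → Finset α)
    {f : α → ℝ} (hf : ∀ r, 0 ≤ f r) : ∑ r ∈ T.biUnion s, f r ≤ ∑ p ∈ T, ∑ r ∈ s p, f r := by
  classical
  induction T using Finset.induction_on with
  | empty => simp
  | insert p T hp ih =>
    rw [Finset.biUnion_insert, Finset.sum_insert hp]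
    have h1 := Finset.sum_union_inter (s₁ := s p) (s₂ := T.biUnion s) (f := f)
    have h2 : 0 ≤ ∑ r ∈ s p ∩ T.biUnion s, f r := Finset.sum_nonneg fun _ _ => hf _
    linarith

theorem card_large_primes_le {P : ℝ} (hP : 1 < P) {k : ℕ} (hk : k ≠ 0) :
    ((k.primeFactors.filter (fun p : ℕ => P < (p : ℝ))).card : ℝ) * Real.log P ≤ Real.log k := by
  set T := k.primeFactors.filter (fun p : ℕ => P < (p : ℝ))
  have h1 : ∏ p ∈ T, p ∣ k :=
    (Finset.prod_dvd_prod_of_subset _ _ _ (Finset.filter_subset _ _)).trans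
      (Nat.prod_primeFactors_dvd k)
  have h2 : ((∏ p ∈ T, p : ℕ) : ℝ) ≤ k := by
    exact_mod_cast Nat.le_of_dvd (Nat.pos_of_ne_zero hk) h1
  have h3 : ∀ p ∈ T, (0 : ℝ) < p := fun p hp => by
    linarith [(Finset.mem_filter.1 hp).2]
  have h4 : Real.log ((∏ p ∈ T, p : ℕ) : ℝ) ≤ Real.log k := by
    refine Real.log_le_log ?_ h2
    push_cast
    exact Finset.prod_pos h3
  rw [Nat.cast_prod, Real.log_prod fun p hp => (h3 p hp).ne'] at h4
  refine le_trans ?_ h4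
  rw [← nsmul_eq_mul, ← Finset.sum_const]
  exact Finset.sum_le_sum fun p hp =>
    Real.log_le_log (by linarith) (Finset.mem_filter.1 hp).2.le

/-- An `r` in the difference shares a prime `p > P` with `k`. There are at most `log k / log P` such
primes, and the multiples of each contribute `O(1/p)`. -/
theorem exists_dyadicTotientSum_smoothPart_sub_le :
    ∃ C : ℝ, 0 < C ∧ ∀ (P : ℝ) (j k : ℕ), 3 ≤ P → k ≠ 0 →
      |dyadicTotientSum j k - dyadicTotientSum j (smoothPart (⌊P⌋₊ + 1) k)|
        ≤ C * Real.log k / (P * Real.log P) := by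
  obtain ⟨C, hC, h⟩ := exists_sum_dyadic_dvd_inv_totient_le
  refine ⟨2 * C, by positivity, fun P j k hP hk => ?_⟩
  set k' := smoothPart (⌊P⌋₊ + 1) k
  have hlP : 0 < Real.log P := Real.log_pos (by linarith)
  set T := k.primeFactors.filter (fun p : ℕ => P < (p : ℝ))
  have hsub : (dyadic j).filter (fun r => Nat.Coprime r k)
      ⊆ (dyadic j).filter (fun r => Nat.Coprime r k') := by
    intro r hr
    rw [Finset.mem_filter] at hr ⊢
    exact ⟨hr.1, hr.2.coprime_dvd_right (smoothPart_dvd _ hk)⟩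
  rw [abs_sub_comm]
  unfold dyadicTotientSum
  rw [← Finset.sum_sdiff_eq_sub hsub, abs_of_nonneg (Finset.sum_nonneg fun _ _ => by positivity)]
  calc _ ≤ ∑ r ∈ T.biUnion fun p => (dyadic j).filter (p ∣ ·), 1 / (r.totient : ℝ) := by
        refine Finset.sum_le_sum_of_subset_of_nonneg ?_ fun _ _ _ => by positivity
        intro r hr
        simp only [Finset.mem_sdiff, Finset.mem_filter, not_and] at hr
        obtain ⟨⟨hr1, hr2⟩, hr3⟩ := hr
        obtain ⟨p, hp, hpr, hpk⟩ := Nat.Prime.not_coprime_iff_dvd.1 (hr3 hr1)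
        rw [Finset.mem_biUnion]
        refine ⟨p, Finset.mem_filter.2 ⟨Nat.mem_primeFactors.2 ⟨hp, hpk, hk⟩, ?_⟩,
          Finset.mem_filter.2 ⟨hr1, hpr⟩⟩
        by_contra hcon
        push Not at hcon
        have hlt : p < ⌊P⌋₊ + 1 := Nat.lt_succ_of_le (Nat.le_floor hcon)
        exact Nat.Prime.not_coprime_iff_dvd.2
          ⟨p, hp, hpr, (prime_dvd_smoothPart_iff hk hp).2 ⟨hpk, hlt⟩⟩ hr2
    _ ≤ ∑ p ∈ T, ∑ r ∈ (dyadic j).filter (p ∣ ·), 1 / (r.totient : ℝ) :=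
        sum_biUnion_le_sum _ _ fun _ => by positivity
    _ ≤ ∑ p ∈ T, 2 * C / P := by
        refine Finset.sum_le_sum fun p hp => ?_
        obtain ⟨hp1, hp2⟩ := Finset.mem_filter.1 hp
        have hpp := Nat.prime_of_mem_primeFactors hp1
        refine (h j p hpp.pos).trans ?_
        rw [Nat.totient_prime hpp, Nat.cast_sub hpp.one_le, Nat.cast_one,
          div_le_div_iff₀ (by linarith) (by linarith)]
        nlinarith
    _ = (T.card * Real.log P) * (2 * C / (P * Real.log P)) := by
        rw [Finset.sum_const, nsmul_eq_mul]; field_simp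
    _ ≤ Real.log k * (2 * C / (P * Real.log P)) := by
        gcongr
        exact card_large_primes_le (by linarith) hk
    _ = _ := by ring

/-- Coprimality may be tested on smooth parts only. -/
theorem exists_scaledWeight_smoothPart_sub_le :
    ∃ C : ℝ, 0 < C ∧ ∀ (P x Q : ℝ) (h m k j : ℕ), 3 ≤ P → m ∈ upTo x → k ∈ upTo x →
      |scaledWeight Q h (m * k) j - scaledWeight Q h
          (smoothPart (⌊P⌋₊ + 1) m * smoothPart (⌊P⌋₊ + 1) k) j|
        ≤ C * (Real.log x / (P * Real.log P)) := by
  obtain ⟨C, hC, hD⟩ := exists_dyadicTotientSum_smoothPart_sub_le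
  refine ⟨4 * C, by positivity, fun P x Q h m k j hP hm hk => ?_⟩
  rw [mem_upTo] at hm hk
  have hm0 : m ≠ 0 := by omega
  have hk0 : k ≠ 0 := by omega
  have hlP : 0 < Real.log P := Real.log_pos (by linarith)
  rw [← smoothPart_mul _ hm0 hk0]
  have h1 := hD P j (m * k) hP (mul_ne_zero hm0 hk0)
  have h2 := hD P (⌊Q / h⌋₊ + 1) (m * k) hP (mul_ne_zero hm0 hk0)
  have hlog : Real.log ((m * k : ℕ) : ℝ) ≤ 2 * Real.log x := by
    push_cast
    have hmR : (1 : ℝ) ≤ m := by exact_mod_cast hm.1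
    have hkR : (1 : ℝ) ≤ k := by exact_mod_cast hk.1
    rw [Real.log_mul (by linarith) (by linarith)]
    have := Real.log_le_log (by linarith) hm.2
    have := Real.log_le_log (by linarith) hk.2
    linarith
  have h3 : C * Real.log ((m * k : ℕ) : ℝ) / (P * Real.log P)
      ≤ 2 * C * (Real.log x / (P * Real.log P)) := by
    rw [← mul_div_assoc]
    refine div_le_div_of_nonneg_right ?_ (by positivity)
    nlinarith
  unfold scaledWeight
  set A := dyadicTotientSum j (m * k)
  set B := dyadicTotientSum (⌊Q / h⌋₊ + 1) (m * k)
  set A' := dyadicTotientSum j (smoothPart (⌊P⌋₊ + 1) (m * k))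
  set B' := dyadicTotientSum (⌊Q / h⌋₊ + 1) (smoothPart (⌊P⌋₊ + 1) (m * k))
  calc |A - B - (A' - B')| = |(A - A') - (B - B')| := by ring_nf
    _ ≤ |A - A'| + |B - B'| := abs_sub _ _
    _ ≤ _ := by linarith

theorem dyadicTotientSum_eq_zero {j : ℕ} (hj : j ≤ 1) (k : ℕ) : dyadicTotientSum j k = 0 := by
  unfold dyadicTotientSum
  refine Finset.sum_eq_zero fun r hr => ?_
  have := mem_dyadic.1 (Finset.mem_filter.1 hr).1
  omega

theorem exists_abs_scaledWeight_le :
    ∃ C : ℝ, 0 < C ∧ ∀ (Q : ℝ) (h k j : ℕ), |scaledWeight Q h k j| ≤ C := by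
  obtain ⟨C, hC, h⟩ := exists_dyadicTotientSum_le
  refine ⟨C, hC, fun Q h' k j => ?_⟩
  unfold scaledWeight
  rw [abs_le]
  have h1 := h j k
  have h2 := h (⌊Q / h'⌋₊ + 1) k
  have h3 := dyadicTotientSum_nonneg j k
  have h4 := dyadicTotientSum_nonneg (⌊Q / h'⌋₊ + 1) k
  constructor <;> linarith

/-- For `j ≥ 1` this is the stability of `dyadicTotientSum`; the hypothesis on `j` puts the two
indices in the right order. The maximum with 1 admits `j = 0`, where only the absolute bound is
available. -/
theorem exists_abs_scaledWeight_le_div :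
    ∃ C : ℝ, 0 < C ∧ ∀ (Q : ℝ) (h u s j : ℕ), u ≠ 0 → s ≠ 0 → j ≤ ⌊Q / h⌋₊ + 1 →
      |scaledWeight Q h (u * s) j| ≤ C * tau u * tau s * ((1 + Real.log j) / max 1 (j : ℝ)) := by
  obtain ⟨C, hC, h⟩ := exists_abs_scaledWeight_le
  obtain ⟨C', hC', h'⟩ := exists_abs_dyadicTotientSum_sub_le
  refine ⟨C + C', by positivity, fun Q h'' u s j hu hs hj => ?_⟩
  have hτu : (1 : ℝ) ≤ tau u := by exact_mod_cast one_le_tau hu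
  have hτs : (1 : ℝ) ≤ tau s := by exact_mod_cast one_le_tau hs
  have hl := Real.log_natCast_nonneg j
  rcases Nat.eq_zero_or_pos j with rfl | hj0
  · simp only [Nat.cast_zero, Real.log_zero, add_zero, zero_le_one, sup_of_le_left, div_one,
      mul_one]
    refine (h _ _ _ _).trans ?_
    have : 1 ≤ (tau u : ℝ) * tau s := one_le_mul_of_one_le_of_one_le hτu hτs
    nlinarith
  · have hjR : (1 : ℝ) ≤ j := by exact_mod_cast hj0
    rw [max_eq_right hjR]
    refine (h' j _ _ hj0 hj (mul_ne_zero hu hs)).trans ?_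
    refine mul_le_mul_of_nonneg_right ?_ (by positivity)
    have h1 : (tau (u * s) : ℝ) ≤ tau u * tau s := by exact_mod_cast tau_mul_le u s
    have h2 : 0 ≤ C * ((tau u : ℝ) * tau s) := by positivity
    nlinarith

/-! ### Consequences of the standing hypotheses -/

/-- The standing hypotheses on the parameters. -/
structure Admissible (a : ℕ → ℂ) (x Q P R K₁ K₂ K₃ : ℝ) : Prop where
  three_le : 3 ≤ P
  le_R : P ≤ R
  R_le : R ≤ x ^ (1 / 10 : ℝ)
  Q_pos : 0 < Q
  lt_sq : 2 * x < Q * Q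
  Q_le : Q ≤ x
  K₁_pos : 0 < K₁
  K₂_pos : 0 < K₂
  one_le_K₃ : 1 ≤ K₃
  resemblesI : ResemblesIntegersI a x P K₁ K₂
  resemblesII : ResemblesIntegersII a x K₂ K₃

namespace Admissible

variable {a : ℕ → ℂ} {x Q P R K₁ K₂ K₃ : ℝ}

theorem x_pos (H : Admissible a x Q P R K₁ K₂ K₃) : 0 < x := H.Q_pos.trans_le H.Q_le

theorem large (H : Admissible a x Q P R K₁ K₂ K₃) : 9 ≤ x := by
  have hx := H.x_pos
  have h1 : 3 ≤ x ^ (1 / 10 : ℝ) := H.three_le.trans (H.le_R.trans H.R_le)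
  have h2 : (3 : ℝ) ^ 10 ≤ (x ^ (1 / 10 : ℝ)) ^ 10 := by gcongr
  rw [← Real.rpow_natCast (x ^ (1 / 10 : ℝ)), ← Real.rpow_mul hx.le] at h2
  norm_num at h2
  linarith

theorem R_mul_P_le (H : Admissible a x Q P R K₁ K₂ K₃) : R * P ≤ x ^ (1 / 5 : ℝ) := by
  have hx := H.x_pos
  have hP := H.three_le
  have hR := H.le_R
  calc R * P ≤ x ^ (1 / 10 : ℝ) * x ^ (1 / 10 : ℝ) :=
        mul_le_mul H.R_le (hR.trans H.R_le) (by linarith) (by positivity)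
    _ = _ := by rw [← Real.rpow_add hx]; norm_num

theorem R_mul_P_le_x (H : Admissible a x Q P R K₁ K₂ K₃) : R * P ≤ x := by
  refine H.R_mul_P_le.trans ?_
  calc x ^ (1 / 5 : ℝ) ≤ x ^ (1 : ℝ) :=
        Real.rpow_le_rpow_of_exponent_le (by linarith [H.large]) (by norm_num)
    _ = x := Real.rpow_one x

theorem one_le_log_P (H : Admissible a x Q P R K₁ K₂ K₃) : 1 ≤ Real.log P := by
  have hP := H.three_le
  rw [Real.le_log_iff_exp_le (by linarith)]
  have := Real.exp_one_lt_d9; linarith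

theorem P_le (H : Admissible a x Q P R K₁ K₂ K₃) : P ≤ P * x / Q := by
  have hP := H.three_le
  have := H.Q_pos
  rw [le_div_iff₀ H.Q_pos]
  nlinarith [H.Q_le]

theorem log_P_le (H : Admissible a x Q P R K₁ K₂ K₃) : Real.log P ≤ Real.log (P * x / Q) :=
  Real.log_le_log (by linarith [H.three_le]) H.P_le

theorem one_le_log (H : Admissible a x Q P R K₁ K₂ K₃) : 1 ≤ Real.log (P * x / Q) :=
  H.one_le_log_P.trans H.log_P_le

theorem P_le_x (H : Admissible a x Q P R K₁ K₂ K₃) : P ≤ x := by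
  have := H.R_mul_P_le_x
  have := H.three_le
  have := H.le_R
  nlinarith

theorem log_P_le_log_x (H : Admissible a x Q P R K₁ K₂ K₃) : Real.log P ≤ Real.log x :=
  Real.log_le_log (by linarith [H.three_le]) H.P_le_x

theorem one_le_log_x (H : Admissible a x Q P R K₁ K₂ K₃) : 1 ≤ Real.log x :=
  H.one_le_log_P.trans H.log_P_le_log_x

theorem gap_div_lt (H : Admissible a x Q P R K₁ K₂ K₃) {h m k : ℕ}
    (hm : m ∈ upTo (x / h)) (hk : k ∈ upTo (x / h)) :
    2 * (gap m k : ℝ) / Q < 2 * (x / h) / Q := by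
  have h1 := gap_lt hm hk
  have := H.Q_pos
  gcongr

/-- Here `Q > √(2x)` enters: `2x / (hQ) ≤ Q / h`, so the complementary range never lies above the
original one. -/
theorem gapIndex_le_floor (H : Admissible a x Q P R K₁ K₂ K₃) {h m k : ℕ} (hh : 0 < h)
    (hm : m ∈ upTo (x / h)) (hk : k ∈ upTo (x / h)) :
    gapIndex Q m k ≤ ⌊Q / h⌋₊ + 1 := by
  have h1 := H.gap_div_lt hm hk
  have hhR : (0 : ℝ) < h := by exact_mod_cast hh
  have hQ := H.Q_pos
  have h2 : 2 * (x / h) / Q ≤ Q / h := by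
    rw [div_le_div_iff₀ hQ hhR]
    have : 2 * (x / h) * h = 2 * x := by field_simp
    rw [this]; exact H.lt_sq.le
  rw [gapIndex, Nat.ceil_le]
  have h3 := Nat.lt_floor_add_one (Q / (h : ℝ))
  push_cast
  linarith

theorem gapIndex_le (H : Admissible a x Q P R K₁ K₂ K₃) {h m k : ℕ} (hh : 0 < h)
    (hm : m ∈ upTo (x / h)) (hk : k ∈ upTo (x / h)) :
    (gapIndex Q m k : ℝ) ≤ P * x / Q := by
  have h1 := H.gap_div_lt hm hk
  have hhR : (1 : ℝ) ≤ h := by exact_mod_cast hh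
  have hQ := H.Q_pos
  have hx := H.x_pos
  have h2 : 2 * (x / h) / Q ≤ 2 * (x / Q) := by
    rw [mul_div_assoc]
    gcongr
    exact div_le_self hx.le hhR
  have h3 : (gapIndex Q m k : ℝ) < 2 * (gap m k : ℝ) / Q + 1 := Nat.ceil_lt_add_one (by positivity)
  have h4 : 1 ≤ x / Q := (one_le_div hQ).2 H.Q_le
  have h5 : P * x / Q = P * (x / Q) := mul_div_assoc _ _ _
  have := H.three_le
  rw [h5]
  nlinarith

/-- When `h ≥ 2x / Q`, all of `upTo (x / h)` lies within distance `Q / 2`. The dyadic range of index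
at most 1 is empty, which is what separates large `h` from small. -/
theorem gapIndex_le_one (H : Admissible a x Q P R K₁ K₂ K₃) {h m k : ℕ} (hh : 2 * x / Q ≤ h)
    (hm : m ∈ upTo (x / h)) (hk : k ∈ upTo (x / h)) :
    gapIndex Q m k ≤ 1 := by
  have h1 := H.gap_div_lt hm hk
  have hQ := H.Q_pos
  have hx := H.x_pos
  have hhR : (0 : ℝ) < h := lt_of_lt_of_le (by positivity) hh
  rw [gapIndex, Nat.ceil_le]
  push_cast
  refine h1.le.trans ?_
  rw [div_le_iff₀ hQ] at hh ⊢
  rw [mul_div_assoc', div_le_iff₀ hhR]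
  linarith

theorem scaledWeight_eq_zero (H : Admissible a x Q P R K₁ K₂ K₃) {h m k : ℕ} (hh : Q < h)
    (hm : m ∈ upTo (x / h)) (hk : k ∈ upTo (x / h)) (u : ℕ) :
    scaledWeight Q h u (gapIndex Q m k) = 0 := by
  have hQ := H.Q_pos
  have h2 : 2 * x / Q ≤ h := by
    rw [div_le_iff₀ hQ]
    nlinarith [H.lt_sq]
  have h3 : ⌊Q / (h : ℝ)⌋₊ = 0 := by
    rw [Nat.floor_eq_zero, div_lt_one (by linarith)]; exact hh
  unfold scaledWeight
  rw [dyadicTotientSum_eq_zero (H.gapIndex_le_one h2 hm hk),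
    dyadicTotientSum_eq_zero (by omega), sub_zero]

end Admissible

/-! ### Replacing the sequence by its mean across all index distances -/

/-- The integers of `upTo y` at index distance `j` from `m`, to its right. -/
def rightBlock (Q y : ℝ) (m j : ℕ) : Finset ℕ :=
  ((upTo y).filter (fun k => gapIndex Q m k = j)).filter (fun k => m ≤ k)

/-- The integers of `upTo y` at index distance `j` from `m`, to its left. -/
def leftBlock (Q y : ℝ) (m j : ℕ) : Finset ℕ :=
  ((upTo y).filter (fun k => gapIndex Q m k = j)).filter (fun k => ¬ m ≤ k)

theorem gapIndex_eq_bounds {Q : ℝ} (hQ : 0 < Q) {m k j : ℕ} (h : gapIndex Q m k = j) :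
    ((j : ℝ) - 1) * Q < 2 * gap m k ∧ 2 * (gap m k : ℝ) ≤ j * Q := by
  have h1 : (gapIndex Q m k : ℝ) < 2 * (gap m k : ℝ) / Q + 1 := Nat.ceil_lt_add_one (by positivity)
  have h2 : 2 * (gap m k : ℝ) / Q ≤ gapIndex Q m k := Nat.le_ceil _
  rw [h] at h1 h2
  rw [div_le_iff₀ hQ] at h2
  refine ⟨?_, h2⟩
  rw [← lt_div_iff₀ hQ]; linarith

theorem gapIndex_mono {Q : ℝ} (hQ : 0 < Q) {m k k' : ℕ} (h : gap m k ≤ gap m k') :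
    gapIndex Q m k ≤ gapIndex Q m k' := by
  unfold gapIndex
  gcongr

/-- The index is monotone in the distance from `m`, so its level sets to the right of `m` are
convex; equal indices confine the distance to an interval of length `Q / 2`. -/
theorem isBlock_rightBlock {Q : ℝ} (hQ : 0 < Q) (y : ℝ) (m j : ℕ) :
    IsBlock (rightBlock Q y m j) Q := by
  have hmem : ∀ k, k ∈ rightBlock Q y m j ↔ (k ∈ upTo y ∧ gapIndex Q m k = j) ∧ m ≤ k := by
    intro k; unfold rightBlock; rw [Finset.mem_filter, Finset.mem_filter]
  refine ⟨⟨fun u hu v hv w hw => ?_⟩, fun h => ?_, fun u hu v hv => ?_⟩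
  · rw [Finset.mem_coe, hmem] at hu hv ⊢
    have hmw : m ≤ w := hu.2.trans hw.1
    have g1 : gap m u ≤ gap m w := by have := hw.1; have := hu.2; unfold gap; omega
    have g2 : gap m w ≤ gap m v := by have := hw.2; have := hv.2; unfold gap; omega
    refine ⟨⟨?_, ?_⟩, hmw⟩
    · rw [mem_upTo] at hu hv ⊢
      exact ⟨hu.1.1.1.trans hw.1, (Nat.cast_le.2 hw.2).trans hv.1.1.2⟩
    · exact le_antisymm ((gapIndex_mono hQ g2).trans hv.1.2.le)
        (hu.1.2.ge.trans (gapIndex_mono hQ g1))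
  · rw [hmem, mem_upTo] at h
    omega
  · rw [hmem] at hu hv
    have b1 := gapIndex_eq_bounds hQ hu.1.2
    have b2 := gapIndex_eq_bounds hQ hv.1.2
    rw [gap_cast_of_le hu.2] at b1
    rw [gap_cast_of_le hv.2] at b2
    linarith [b1.1, b2.2]

theorem isBlock_leftBlock {Q : ℝ} (hQ : 0 < Q) (y : ℝ) (m j : ℕ) :
    IsBlock (leftBlock Q y m j) Q := by
  have hmem : ∀ k, k ∈ leftBlock Q y m j ↔ (k ∈ upTo y ∧ gapIndex Q m k = j) ∧ k < m := by
    intro k; unfold leftBlock; rw [Finset.mem_filter, Finset.mem_filter, not_le]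
  refine ⟨⟨fun u hu v hv w hw => ?_⟩, fun h => ?_, fun u hu v hv => ?_⟩
  · rw [Finset.mem_coe, hmem] at hu hv ⊢
    have hmw : w < m := hw.2.trans_lt hv.2
    have g1 : gap m w ≤ gap m u := by have := hw.1; have := hu.2; unfold gap; omega
    have g2 : gap m v ≤ gap m w := by have := hw.2; have := hv.2; unfold gap; omega
    refine ⟨⟨?_, ?_⟩, hmw⟩
    · rw [mem_upTo] at hu hv ⊢
      exact ⟨hu.1.1.1.trans hw.1, (Nat.cast_le.2 hw.2).trans hv.1.1.2⟩
    · exact le_antisymm ((gapIndex_mono hQ g1).trans hu.1.2.le)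
        (hv.1.2.ge.trans (gapIndex_mono hQ g2))
  · rw [hmem, mem_upTo] at h
    omega
  · rw [hmem] at hu hv
    have b1 := gapIndex_eq_bounds hQ hu.1.2
    have b2 := gapIndex_eq_bounds hQ hv.1.2
    rw [gap_cast_of_ge hu.2.le] at b1
    rw [gap_cast_of_ge hv.2.le] at b2
    linarith [b1.2, b2.1]

theorem sum_upTo_eq_sum_blocks {M : Type*} [AddCommMonoid M] (Q y : ℝ) (m J : ℕ)
    (hJ : ∀ k ∈ upTo y, gapIndex Q m k ≤ J) (f : ℕ → M) :
    ∑ k ∈ upTo y, f k = ∑ j ∈ Finset.range (J + 1),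
      (∑ k ∈ rightBlock Q y m j, f k + ∑ k ∈ leftBlock Q y m j, f k) := by
  rw [← Finset.sum_fiberwise_of_maps_to (t := Finset.range (J + 1)) (g := gapIndex Q m)
    fun k hk => Finset.mem_range.2 (Nat.lt_succ_of_le (hJ k hk))]
  refine Finset.sum_congr rfl fun j _ => ?_
  exact (Finset.sum_filter_add_sum_filter_not _ _ _).symm

theorem sum_range_inv_max_le {J : ℕ} {L : ℝ} (hL : 1 ≤ L) (hJ : Real.log J ≤ L) :
    ∑ j ∈ Finset.range (J + 1), 1 / max 1 (j : ℝ) ≤ 3 * L := by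
  rw [Finset.sum_range_succ']
  simp only [Nat.cast_zero, zero_le_one, sup_of_le_left, div_one]
  rcases Nat.eq_zero_or_pos J with rfl | hJ0
  · simp; linarith
  have h := sum_Icc_inv_le J
  have e : ∑ j ∈ Finset.range J, 1 / max 1 ((j + 1 : ℕ) : ℝ)
      = ∑ d ∈ Finset.Icc 1 J, 1 / (d : ℝ) := by
    have e' : Finset.Icc 1 J = Finset.Ico (0 + 1) (J + 1) := by
      ext d; simp only [Finset.mem_Icc, Finset.mem_Ico]; omega
    rw [Finset.range_eq_Ico, Finset.sum_Ico_add' (fun j : ℕ => 1 / max 1 (j : ℝ)) 0 J 1, e']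
    refine Finset.sum_congr rfl fun d hd => ?_
    have : (1 : ℝ) ≤ d := by exact_mod_cast (Finset.mem_Ico.1 hd).1
    rw [max_eq_right this]
  rw [e]; linarith

theorem inv_le_rpow_neg_one_add {s : ℕ} (hs : 1 ≤ s) {t : ℝ} (ht : 0 ≤ t) :
    1 / (s : ℝ) ≤ (s : ℝ) ^ (-1 + t) := by
  have hsR : (1 : ℝ) ≤ s := by exact_mod_cast hs
  rw [one_div, ← Real.rpow_neg_one]
  exact Real.rpow_le_rpow_of_exponent_le hsR (by linarith)

theorem exists_sum_smoothUpTo_le :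
    ∃ C : ℝ, 0 < C ∧ ∀ P R : ℝ, 3 ≤ P →
      ∑ s ∈ smoothUpTo P R, 1 / (s : ℝ) ≤ C * Real.log P ∧
      ∑ s ∈ smoothUpTo P R, (tau s : ℝ) / s ≤ C * Real.log P ^ 2 := by
  obtain ⟨C, hC, h⟩ := exists_sum_smooth_le
  obtain ⟨C', hC', h'⟩ := exists_sum_smooth_tau_le
  refine ⟨C + C', by positivity, fun P R hP => ?_⟩
  have hl : 0 < Real.log P := Real.log_pos (by linarith)
  have hsm : ∀ n ∈ smoothUpTo P R, n ∈ Nat.smoothNumbers (⌊P⌋₊ + 1) := fun n hn =>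
    (Finset.mem_filter.1 hn).2
  have h1 : ∀ n ∈ smoothUpTo P R, 1 / (n : ℝ) ≤ (n : ℝ) ^ (-1 + 1 / Real.log P) := fun n hn =>
    inv_le_rpow_neg_one_add (mem_upTo.1 (Finset.mem_filter.1 hn).1).1 (by positivity)
  constructor
  · refine (Finset.sum_le_sum h1).trans ((h P hP _ hsm).trans ?_)
    nlinarith
  · calc _ ≤ ∑ s ∈ smoothUpTo P R, (tau s : ℝ) * (s : ℝ) ^ (-1 + 1 / Real.log P) := by
          refine Finset.sum_le_sum fun s hs => ?_
          rw [div_eq_mul_one_div]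
          exact mul_le_mul_of_nonneg_left (h1 s hs) (by positivity)
      _ ≤ _ := h' P hP _ hsm
      _ ≤ _ := by nlinarith [sq_nonneg (Real.log P)]

namespace Admissible

variable {a : ℕ → ℂ} {x Q P R K₁ K₂ K₃ : ℝ}

theorem tailBound_nonneg (H : Admissible a x Q P R K₁ K₂ K₃) {ℓ : ℝ} (hℓ : 0 ≤ ℓ) :
    0 ≤ tailBound (absTotal a x) x P R K₂ K₃ ℓ := by
  have := absTotal_nonneg a x
  have := H.one_le_log_x
  have := H.x_pos
  have := H.K₂_pos
  have := H.one_le_K₃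
  have := H.three_le
  have := H.le_R
  have : 0 ≤ R := by linarith
  unfold tailBound
  positivity

theorem tailBound_mono (H : Admissible a x Q P R K₁ K₂ K₃) {ℓ ℓ' : ℝ} (h : ℓ ≤ ℓ') :
    tailBound (absTotal a x) x P R K₂ K₃ ℓ ≤ tailBound (absTotal a x) x P R K₂ K₃ ℓ' := by
  have := absTotal_nonneg a x
  have := H.one_le_log_x
  have := H.x_pos
  have := H.one_le_K₃
  have := H.three_le
  have := H.le_R
  have : 0 ≤ R := by linarith
  unfold tailBound
  gcongr

end Admissible

/-- Sums against weights depending on the index distance and on the smooth part only. -/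
theorem exists_norm_sum_gapIndex_le :
    ∃ C : ℝ, 0 < C ∧ ∀ (a : ℕ → ℂ) (x Q P R K₁ K₂ K₃ : ℝ), Admissible a x Q P R K₁ K₂ K₃ →
      ∀ (h m : ℕ), 1 ≤ h → m ∈ upTo (x / h) →
      ∀ (c : ℕ → ℕ → ℝ) (B : ℝ), 0 ≤ B →
        (∀ j s : ℕ, s ≠ 0 → j ≤ ⌊Q / h⌋₊ + 1 → (j : ℝ) ≤ P * x / Q →
          |c j s| ≤ B / max 1 (j : ℝ) * tau s) →
        ‖∑ k ∈ upTo (x / h), (a (k * h) - total a x / x)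
            * (c (gapIndex Q m k) (smoothPart (⌊P⌋₊ + 1) k) : ℂ)‖
          ≤ C * B * (Real.log (P * x / Q) ^ 3 * (Q * absTotal a x / (x * K₁))
            + Real.log (P * x / Q) * tailBound (absTotal a x) x P R K₂ K₃ Q) := by
  obtain ⟨C, hC, hblock⟩ := exists_norm_block_sum_le
  obtain ⟨C', hC', hsm⟩ := exists_sum_smoothUpTo_le
  -- The 6 comes from two blocks for each `j` and the bound `3L` for the sum of `1 / max 1 j`.
  refine ⟨6 * (C + C'), by positivity, fun a x Q P R K₁ K₂ K₃ H h m hh hm c B hB hc => ?_⟩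
  set L := Real.log (P * x / Q) with hL
  set N := absTotal a x with hN
  have hL1 : 1 ≤ L := H.one_le_log
  have hN0 : 0 ≤ N := absTotal_nonneg a x
  have hx := H.x_pos
  have hQ := H.Q_pos
  have hK₁ := H.K₁_pos
  set T := tailBound N x P R K₂ K₃ Q with hT
  have hT0 : 0 ≤ T := H.tailBound_nonneg hQ.le
  set G := Q * N / (x * K₁) with hG
  have hG0 : 0 ≤ G := by positivity
  -- The largest index that occurs. It inherits both bounds needed by `hc`, and its logarithm is at
  -- most `L`.
  set J := (upTo (x / h)).sup (gapIndex Q m) with hJ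
  have hJ1 : J ≤ ⌊Q / h⌋₊ + 1 := Finset.sup_le fun k hk => H.gapIndex_le_floor hh hm hk
  have hy : 0 ≤ P * x / Q := by linarith [H.P_le, H.three_le]
  have hJ2 : (J : ℝ) ≤ P * x / Q := by
    rw [← Nat.le_floor_iff hy]
    exact Finset.sup_le fun k hk => Nat.le_floor (H.gapIndex_le hh hm hk)
  have hJ3 : Real.log J ≤ L := by
    rcases Nat.eq_zero_or_pos J with h0 | h0
    · rw [h0]; simp; linarith
    · exact Real.log_le_log (by exact_mod_cast h0) hJ2
  rw [sum_upTo_eq_sum_blocks Q (x / h) m J fun k hk => Finset.le_sup hk]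
  have key : ∀ j ∈ Finset.range (J + 1), ∀ D : Finset ℕ, IsBlock D Q →
      (∀ n ∈ D, n ∈ upTo (x / h) ∧ gapIndex Q m n = j) →
      ‖∑ k ∈ D, (a (k * h) - total a x / x)
            * (c (gapIndex Q m k) (smoothPart (⌊P⌋₊ + 1) k) : ℂ)‖
        ≤ (C + C') * B * (L ^ 2 * G + T) * (1 / max 1 (j : ℝ)) := by
    intro j hj D hD hDm
    have hjJ : j ≤ J := Nat.lt_succ_iff.1 (Finset.mem_range.1 hj)
    have hcj : ∀ s : ℕ, s ≠ 0 → |c j s| ≤ B / max 1 (j : ℝ) * tau s := fun s hs =>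
      hc j s hs (hjJ.trans hJ1) ((Nat.cast_le.2 hjJ).trans hJ2)
    have hmax : 0 < max 1 (j : ℝ) := by positivity
    have e1 : ∑ k ∈ D, (a (k * h) - total a x / x)
            * (c (gapIndex Q m k) (smoothPart (⌊P⌋₊ + 1) k) : ℂ)
        = ∑ k ∈ D, (a (k * h) - total a x / x) * (c j (smoothPart (⌊P⌋₊ + 1) k) : ℂ) :=
      Finset.sum_congr rfl fun k hk => by rw [(hDm k hk).2]
    rw [e1]
    refine (hblock a x P R K₁ K₂ K₃ H.three_le H.le_R H.R_mul_P_le_x hK₁ H.K₂_pos H.one_le_K₃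
      H.resemblesI H.resemblesII h D Q hh hD hQ.le (fun n hn => (mem_upTo.1 (hDm n hn).1).2)
      (c j) (B / max 1 (j : ℝ)) (by positivity) hcj).trans ?_
    have e2 : ∑ s ∈ smoothUpTo P R, |c j s| / s ≤ B / max 1 (j : ℝ) * (C' * L ^ 2) := by
      calc _ ≤ ∑ s ∈ smoothUpTo P R, B / max 1 (j : ℝ) * ((tau s : ℝ) / s) := by
            refine Finset.sum_le_sum fun s hs => ?_
            have hs0 : s ≠ 0 := by
              have := (mem_upTo.1 (Finset.mem_filter.1 hs).1).1; omega
            rw [← mul_div_assoc]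
            exact div_le_div_of_nonneg_right (hcj s hs0) (by positivity)
        _ ≤ B / max 1 (j : ℝ) * (C' * Real.log P ^ 2) := by
            rw [← Finset.mul_sum]
            exact mul_le_mul_of_nonneg_left (hsm P R H.three_le).2 (by positivity)
        _ ≤ _ := by
            have h1 := H.one_le_log_P
            have h2 := H.log_P_le
            gcongr
    calc _ ≤ G * (B / max 1 (j : ℝ) * (C' * L ^ 2)) + C * (B / max 1 (j : ℝ)) * T := by
          gcongr
      _ = (C' * (L ^ 2 * G) + C * T) * B * (1 / max 1 (j : ℝ)) := by ring
      _ ≤ _ := by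
          refine mul_le_mul_of_nonneg_right ?_ (by positivity)
          have : 0 ≤ (C * (L ^ 2 * G) + C' * T) * B := by positivity
          nlinarith
  calc _ ≤ ∑ j ∈ Finset.range (J + 1),
        2 * ((C + C') * B * (L ^ 2 * G + T)) * (1 / max 1 (j : ℝ)) := by
        refine norm_sum_le_of_le _ fun j hj => (norm_add_le _ _).trans ?_
        have h1 := key j hj _ (isBlock_rightBlock hQ (x / h) m j) fun n hn =>
          Finset.mem_filter.1 (Finset.mem_filter.1 hn).1
        have h2 := key j hj _ (isBlock_leftBlock hQ (x / h) m j) fun n hn =>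
          Finset.mem_filter.1 (Finset.mem_filter.1 hn).1
        linarith
    _ ≤ 2 * ((C + C') * B * (L ^ 2 * G + T)) * (3 * L) := by
        rw [← Finset.mul_sum]
        exact mul_le_mul_of_nonneg_left (sum_range_inv_max_le hL1 hJ3) (by positivity)
    _ = _ := by ring

/-- The weight `scaledWeight` with its second argument replaced by a smooth part. -/
def smoothWeight (P Q : ℝ) (h m k : ℕ) : ℝ :=
  scaledWeight Q h (smoothPart (⌊P⌋₊ + 1) m * smoothPart (⌊P⌋₊ + 1) k) (gapIndex Q m k)

/-- The weight depends on `k` only through its index and smooth part and decays like `(1 + log j) /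
j`; the numerator is absorbed in one more factor `log (P * x / Q)`. -/
theorem exists_norm_sum_smoothWeight_le :
    ∃ C : ℝ, 0 < C ∧ ∀ (a : ℕ → ℂ) (x Q P R K₁ K₂ K₃ : ℝ), Admissible a x Q P R K₁ K₂ K₃ →
      ∀ (h m : ℕ), 1 ≤ h → m ∈ upTo (x / h) →
        ‖∑ k ∈ upTo (x / h), (a (k * h) - total a x / x) * (smoothWeight P Q h m k : ℂ)‖
          ≤ C * tau (smoothPart (⌊P⌋₊ + 1) m)
            * (Real.log (P * x / Q) ^ 4 * (Q * absTotal a x / (x * K₁))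
            + Real.log (P * x / Q) ^ 2 * tailBound (absTotal a x) x P R K₂ K₃ Q) := by
  obtain ⟨C, hC, hsum⟩ := exists_norm_sum_gapIndex_le
  obtain ⟨C', hC', hw⟩ := exists_abs_scaledWeight_le_div
  refine ⟨2 * C * C', by positivity, fun a x Q P R K₁ K₂ K₃ H h m hh hm => ?_⟩
  set L := Real.log (P * x / Q) with hL
  have hL1 : 1 ≤ L := H.one_le_log
  have hm0 : m ≠ 0 := by have := (mem_upTo.1 hm).1; omega
  set u := smoothPart (⌊P⌋₊ + 1) m with hu
  have hu0 : u ≠ 0 := smoothPart_ne_zero _ _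
  refine (hsum a x Q P R K₁ K₂ K₃ H h m hh hm (fun j s => scaledWeight Q h (u * s) j)
    (2 * C' * tau u * L) (by positivity) ?_).trans (le_of_eq (by ring))
  intro j s hs hj1 hj2
  refine (hw Q h u s j hu0 hs hj1).trans ?_
  have hlog : Real.log j ≤ L := by
    rcases Nat.eq_zero_or_pos j with h0 | h0
    · rw [h0]; simp; linarith
    · exact Real.log_le_log (by exact_mod_cast h0) hj2
  calc C' * tau u * tau s * ((1 + Real.log j) / max 1 (j : ℝ))
      ≤ C' * tau u * tau s * ((2 * L) / max 1 (j : ℝ)) := by gcongr; linarith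
    _ = _ := by ring

/-- For `h ≥ 2x / Q` the sum with the index is empty, so all of `upTo (x / h)` is a single block of
length `x / h` with a weight bounded absolutely. Hence the gain `1 / h`, with only one `log P` and
no divisor function. -/
theorem exists_norm_sum_smoothWeight_le_of_large :
    ∃ C : ℝ, 0 < C ∧ ∀ (a : ℕ → ℂ) (x Q P R K₁ K₂ K₃ : ℝ), Admissible a x Q P R K₁ K₂ K₃ →
      ∀ (h m : ℕ), 2 * x / Q ≤ h → m ∈ upTo (x / h) →
        ‖∑ k ∈ upTo (x / h), (a (k * h) - total a x / x) * (smoothWeight P Q h m k : ℂ)‖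
          ≤ C * (Real.log P * absTotal a x / K₁ * (1 / h)
            + tailBound (absTotal a x) x P R K₂ K₃ Q) := by
  obtain ⟨C, hC, hblock⟩ := exists_norm_block_sum_le
  obtain ⟨C', hC', hsm⟩ := exists_sum_smoothUpTo_le
  obtain ⟨C'', hC'', hF⟩ := exists_dyadicTotientSum_le
  refine ⟨C'' * C' + C * C'', by positivity, fun a x Q P R K₁ K₂ K₃ H h m hh hm => ?_⟩
  have hx := H.x_pos
  have hQ := H.Q_pos
  have hK₁ := H.K₁_pos
  have hhR : (0 : ℝ) < h := lt_of_lt_of_le (by positivity) hh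
  have hh0 : 0 < h := by exact_mod_cast hhR
  have hN0 : 0 ≤ absTotal a x := absTotal_nonneg a x
  set u := smoothPart (⌊P⌋₊ + 1) m with hu
  set c : ℕ → ℝ := fun s => - dyadicTotientSum (⌊Q / h⌋₊ + 1) (u * s) with hc
  have hcs : ∀ s, |c s| ≤ C'' := fun s => by
    rw [hc, abs_neg, abs_of_nonneg (dyadicTotientSum_nonneg _ _)]
    exact hF _ _
  have e1 : ∑ k ∈ upTo (x / h), (a (k * h) - total a x / x) * (smoothWeight P Q h m k : ℂ)
      = ∑ k ∈ upTo (x / h), (a (k * h) - total a x / x) * (c (smoothPart (⌊P⌋₊ + 1) k) : ℂ) := by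
    refine Finset.sum_congr rfl fun k hk => ?_
    rw [smoothWeight, scaledWeight, dyadicTotientSum_eq_zero (H.gapIndex_le_one hh hm hk), zero_sub]
  have hD : IsBlock (upTo (x / h)) (x / h) := by
    refine ⟨?_, ?_, ?_⟩
    · unfold upTo; rw [Finset.coe_Icc]; exact Set.ordConnected_Icc
    · rw [mem_upTo]; omega
    · intro i hi k hk
      have := (mem_upTo.1 hk).2
      have : (0 : ℝ) ≤ i := by positivity
      linarith
  have hxh : x / h ≤ Q := by
    rw [div_le_iff₀ hQ] at hh
    rw [div_le_iff₀ hhR]; nlinarith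
  rw [e1]
  refine (hblock a x P R K₁ K₂ K₃ H.three_le H.le_R H.R_mul_P_le_x hK₁ H.K₂_pos H.one_le_K₃
      H.resemblesI H.resemblesII h _ (x / h) hh0 hD (by positivity)
      (fun n hn => (mem_upTo.1 hn).2) c C'' hC''.le fun s hs => ?_).trans ?_
  · have : (1 : ℝ) ≤ tau s := by exact_mod_cast one_le_tau hs
    have := hcs s
    nlinarith
  have e2 : ∑ s ∈ smoothUpTo P R, |c s| / s ≤ C'' * (C' * Real.log P) := by
    calc _ ≤ ∑ s ∈ smoothUpTo P R, C'' * (1 / (s : ℝ)) := by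
          refine Finset.sum_le_sum fun s hs => ?_
          rw [mul_one_div]
          exact div_le_div_of_nonneg_right (hcs s) (by positivity)
      _ ≤ _ := by
          rw [← Finset.mul_sum]
          exact mul_le_mul_of_nonneg_left (hsm P R H.three_le).1 (by positivity)
  have hT0 := H.tailBound_nonneg hQ.le
  have hl := H.one_le_log_P
  calc _ ≤ x / h * absTotal a x / (x * K₁) * (C'' * (C' * Real.log P))
        + C * C'' * tailBound (absTotal a x) x P R K₂ K₃ Q := by
        gcongr
        exact H.tailBound_mono hxh
    _ = C'' * C' * (Real.log P * absTotal a x / K₁ * (1 / h))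
        + C * C'' * tailBound (absTotal a x) x P R K₂ K₃ Q := by
        field_simp
    _ ≤ _ := by
        have : 0 ≤ C * C'' * (Real.log P * absTotal a x / K₁ * (1 / h)) := by positivity
        have : 0 ≤ C'' * C' * tailBound (absTotal a x) x P R K₂ K₃ Q := by positivity
        nlinarith

/-! ### Summation over common divisors and non-concentration -/

/-- `∑_{n ≤ x, h ∣ n} |a n|`. -/
def multTotal (a : ℕ → ℂ) (x : ℝ) (h : ℕ) : ℝ := ∑ n ∈ (upTo x).filter (fun n : ℕ => h ∣ n), ‖a n‖

theorem multTotal_one (a : ℕ → ℂ) (x : ℝ) : multTotal a x 1 = absTotal a x := by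
  unfold multTotal absTotal
  rw [Finset.filter_true_of_mem fun _ _ => one_dvd _]

theorem sum_norm_mul_sum_divisors (a : ℕ → ℂ) (x : ℝ) (S : Finset ℕ) (g : ℕ → ℝ) :
    ∑ m ∈ upTo x, ‖a m‖ * ∑ h ∈ m.divisors.filter (· ∈ S), g h
      = ∑ h ∈ S, multTotal a x h * g h := by
  have h1 : ∀ m ∈ upTo x, ‖a m‖ * ∑ h ∈ m.divisors.filter (· ∈ S), g h
      = ∑ h ∈ S, if h ∣ m then ‖a m‖ * g h else 0 := fun m hm => by
    have hm0 : m ≠ 0 := by have := (mem_upTo.1 hm).1; omega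
    rw [← Finset.sum_filter, Finset.mul_sum]
    refine Finset.sum_congr ?_ fun _ _ => rfl
    ext h
    simp only [Finset.mem_filter, Nat.mem_divisors]
    tauto
  rw [Finset.sum_congr rfl h1, Finset.sum_comm]
  refine Finset.sum_congr rfl fun h _ => ?_
  rw [← Finset.sum_filter, multTotal, Finset.sum_mul]

/-- Cauchy-Schwarz, with `∑_{h ≥ H} 1 / h² ≤ 2 / H`. -/
theorem sum_multTotal_div_le {a : ℕ → ℂ} {x Q H K : ℝ} (hH : 0 < H)
    (h : ∑ h ∈ (upTo Q).filter (fun h : ℕ => H ≤ (h : ℝ)), multTotal a x h ^ 2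
      ≤ absTotal a x ^ 2 / K) :
    ∑ h ∈ (upTo Q).filter (fun h : ℕ => H ≤ (h : ℝ)), multTotal a x h * (1 / h)
      ≤ absTotal a x * Real.sqrt (2 / (H * K)) := by
  set S := (upTo Q).filter (fun h : ℕ => H ≤ (h : ℝ))
  have hS : ∑ h ∈ S, (1 / (h : ℝ)) ^ 2 ≤ 2 / H := by
    have hc : 0 < ⌈H⌉₊ := Nat.ceil_pos.2 hH
    calc ∑ h ∈ S, (1 / (h : ℝ)) ^ 2 = ∑ h ∈ S, ((h : ℝ) ^ 2)⁻¹ :=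
          Finset.sum_congr rfl fun _ _ => by rw [one_div, inv_pow]
      _ ≤ ∑ h ∈ Finset.Ioo (⌈H⌉₊ - 1) (⌊Q⌋₊ + 1), ((h : ℝ) ^ 2)⁻¹ := by
          refine Finset.sum_le_sum_of_subset_of_nonneg (fun h hh => ?_) fun _ _ _ => by positivity
          obtain ⟨h1, h2⟩ := Finset.mem_filter.1 hh
          have h3 := Finset.mem_Icc.1 h1
          have h4 := Nat.ceil_le.2 h2
          rw [Finset.mem_Ioo]; omega
      _ ≤ 2 / (((⌈H⌉₊ - 1 : ℕ) : ℝ) + 1) := sum_Ioo_inv_sq_le _ _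
      _ ≤ 2 / H := by
          rw [Nat.cast_sub hc, Nat.cast_one, sub_add_cancel]
          exact div_le_div_of_nonneg_left (by norm_num) hH (Nat.le_ceil H)
  have hN := absTotal_nonneg a x
  have h0 : 0 ≤ absTotal a x ^ 2 / K := (Finset.sum_nonneg fun _ _ => sq_nonneg _).trans h
  calc _ ≤ Real.sqrt (∑ h ∈ S, multTotal a x h ^ 2) * Real.sqrt (∑ h ∈ S, (1 / (h : ℝ)) ^ 2) :=
        Real.sum_mul_le_sqrt_mul_sqrt _ _ _
    _ ≤ Real.sqrt (absTotal a x ^ 2 / K) * Real.sqrt (2 / H) := by gcongr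
    _ = _ := by
        rw [← Real.sqrt_mul h0, show absTotal a x ^ 2 / K * (2 / H)
          = absTotal a x ^ 2 * (2 / (H * K)) by field_simp, Real.sqrt_mul (sq_nonneg _),
          Real.sqrt_sq hN]

theorem div_mem_upTo {x : ℝ} {m h : ℕ} (hm : m ∈ upTo x) (hh : h ∈ m.divisors) :
    m / h ∈ upTo (x / h) := by
  obtain ⟨hm1, hm2⟩ := mem_upTo.1 hm
  have h1 := Nat.pos_of_mem_divisors hh
  have h2 := Nat.dvd_of_mem_divisors hh
  rw [mem_upTo, Nat.cast_div_charZero h2]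
  refine ⟨Nat.div_pos (Nat.le_of_dvd hm1 h2) h1, ?_⟩
  gcongr

/-- The sequence may be replaced by its density in the sums over multiples. -/
theorem exists_sum_norm_mul_smoothWeight_le :
    ∃ C : ℝ, 0 < C ∧ ∀ (a : ℕ → ℂ) (x Q P R K₁ K₂ K₃ K : ℝ), Admissible a x Q P R K₁ K₂ K₃ →
      ∑ h ∈ (upTo Q).filter (fun h : ℕ => 2 * x / Q ≤ (h : ℝ)), multTotal a x h ^ 2
        ≤ absTotal a x ^ 2 / K →
      ∑ m ∈ upTo x, ‖a m‖ * ∑ h ∈ m.divisors.filter (· ∈ upTo Q),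
        ‖∑ k ∈ upTo (x / h), (a (k * h) - total a x / x) * (smoothWeight P Q h (m / h) k : ℂ)‖
      ≤ C * (absTotal a x * Real.log (P * x / Q) ^ 4 * (Q / (x * K₁) *
            ∑ n ∈ upTo x, ‖a n‖ * (tau3Smooth (P * x / Q) n : ℝ))
          + Real.log (P * x / Q) ^ 2 * tailBound (absTotal a x) x P R K₂ K₃ Q *
            ∑ n ∈ upTo x, ‖a n‖ * (tau3 n : ℝ)
          + absTotal a x ^ 2 * (Real.log P / K₁ * Real.sqrt (Q / (x * K)))) := by
  obtain ⟨C, hC, hnear⟩ := exists_norm_sum_smoothWeight_le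
  obtain ⟨C', hC', hfar⟩ := exists_norm_sum_smoothWeight_le_of_large
  refine ⟨C + C', by positivity, fun a x Q P R K₁ K₂ K₃ K H hK => ?_⟩
  set L := Real.log (P * x / Q) with hL
  set N := absTotal a x with hN
  set T := tailBound N x P R K₂ K₃ Q with hT
  have hL1 : 1 ≤ L := H.one_le_log
  have hx := H.x_pos
  have hQ := H.Q_pos
  have hP := H.three_le
  have hK₁ := H.K₁_pos
  have hN0 : 0 ≤ N := absTotal_nonneg a x
  have hT0 : 0 ≤ T := H.tailBound_nonneg hQ.le
  have hl := H.one_le_log_P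
  set G := Q * N / (x * K₁) with hG
  have hG0 : 0 ≤ G := by positivity
  set S := (upTo Q).filter (fun h : ℕ => 2 * x / Q ≤ (h : ℝ)) with hS
  have hy : 0 ≤ P * x / Q := by positivity
  set E : ℕ → ℕ → ℝ := fun m h =>
    ‖∑ k ∈ upTo (x / h), (a (k * h) - total a x / x) * (smoothWeight P Q h (m / h) k : ℂ)‖ with hE
  have hmem : ∀ m ∈ upTo x, ∀ h ∈ m.divisors, m / h ∈ upTo (x / h) :=
    fun _ hm _ hh => div_mem_upTo hm hh
  have key : ∀ m ∈ upTo x, ∑ h ∈ m.divisors.filter (· ∈ upTo Q), E m h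
      ≤ C * (L ^ 4 * G * tau3Smooth (P * x / Q) m + L ^ 2 * T * tau3 m)
        + C' * (Real.log P * N / K₁ * ∑ h ∈ m.divisors.filter (· ∈ S), 1 / (h : ℝ)
          + T * tau3 m) := by
    intro m hm
    have hm0 : m ≠ 0 := by have := (mem_upTo.1 hm).1; omega
    -- Since `2x / Q ≤ P * x / Q`, these `h` are smooth to the level `P * x / Q`, which yields
    -- `tau3Smooth` for the `K₁` term. The tail term needs only `tau3`.
    have hnear' : ∀ D : Finset ℕ, D ⊆ m.divisors → (∀ h ∈ D, (h : ℝ) < 2 * x / Q) →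
        ∑ h ∈ D, E m h ≤ C * (L ^ 4 * G * tau3Smooth (P * x / Q) m + L ^ 2 * T * tau3 m) := by
      intro D hD hD2
      have s1 : (∑ h ∈ D, (tau (smoothPart (⌊P⌋₊ + 1) (m / h)) : ℝ))
          ≤ tau3Smooth (P * x / Q) m := by
        have h1 := sum_tau_smoothPart_div_le hy (M := ⌊P⌋₊ + 1)
          (Nat.add_le_add_right (Nat.floor_le_floor H.P_le) 1) hm0 hD (fun h hh => by
            refine (hD2 h hh).le.trans ?_
            gcongr
            linarith)
        exact_mod_cast h1
      have s2 : (∑ h ∈ D, (tau (smoothPart (⌊P⌋₊ + 1) (m / h)) : ℝ)) ≤ tau3 m := by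
        have h1 : ∑ h ∈ D, tau (smoothPart (⌊P⌋₊ + 1) (m / h)) ≤ ∑ h ∈ D, tau (m / h) := by
          refine Finset.sum_le_sum fun h hh => ?_
          have h2 : m / h ≠ 0 := by
            have := (mem_upTo.1 (hmem m hm h (hD hh))).1; omega
          exact tau_le_of_dvd h2 (smoothPart_dvd _ h2)
        exact_mod_cast h1.trans (sum_tau_div_le_tau3 hm0 hD)
      calc ∑ h ∈ D, E m h ≤ ∑ h ∈ D, C * tau (smoothPart (⌊P⌋₊ + 1) (m / h))
              * (L ^ 4 * G + L ^ 2 * T) := by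
            refine Finset.sum_le_sum fun h hh => ?_
            exact hnear a x Q P R K₁ K₂ K₃ H h (m / h) (Nat.pos_of_mem_divisors (hD hh))
              (hmem m hm h (hD hh))
        _ = C * (L ^ 4 * G * (∑ h ∈ D, (tau (smoothPart (⌊P⌋₊ + 1) (m / h)) : ℝ))
            + L ^ 2 * T * (∑ h ∈ D, (tau (smoothPart (⌊P⌋₊ + 1) (m / h)) : ℝ))) := by
            rw [← Finset.sum_mul, ← Finset.mul_sum]; ring
        _ ≤ _ := by gcongr
    have hfar' : ∑ h ∈ m.divisors.filter (· ∈ S), E m h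
        ≤ C' * (Real.log P * N / K₁ * ∑ h ∈ m.divisors.filter (· ∈ S), 1 / (h : ℝ)
          + T * tau3 m) := by
      calc _ ≤ ∑ h ∈ m.divisors.filter (· ∈ S), C' * (Real.log P * N / K₁ * (1 / h) + T) := by
            refine Finset.sum_le_sum fun h hh => ?_
            obtain ⟨h1, h2⟩ := Finset.mem_filter.1 hh
            exact hfar a x Q P R K₁ K₂ K₃ H h (m / h) (Finset.mem_filter.1 h2).2
              (hmem m hm h h1)
        _ = C' * (Real.log P * N / K₁ * ∑ h ∈ m.divisors.filter (· ∈ S), 1 / (h : ℝ)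
          + T * (m.divisors.filter (· ∈ S)).card) := by
            rw [← Finset.mul_sum, Finset.sum_add_distrib, ← Finset.mul_sum, Finset.sum_const,
              nsmul_eq_mul]
            ring
        _ ≤ _ := by
            gcongr
            exact (Finset.card_filter_le _ _).trans (tau_le_tau3 hm0)
    rw [← Finset.sum_filter_add_sum_filter_not _ (fun h : ℕ => (h : ℝ) < 2 * x / Q)]
    refine add_le_add (hnear' _ ?_ ?_) ?_
    · exact (Finset.filter_subset _ _).trans (Finset.filter_subset _ _)
    · exact fun h hh => (Finset.mem_filter.1 hh).2
    · refine (Finset.sum_congr ?_ fun _ _ => rfl).trans_le hfar'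
      rw [Finset.filter_filter, hS]
      refine Finset.filter_congr fun h _ => ?_
      rw [Finset.mem_filter, not_lt]
  -- Taking `H = 2x / Q` in the Cauchy-Schwarz bound cancels the 2 and gives the square root in the
  -- statement.
  have hcs : ∑ h ∈ S, multTotal a x h * (1 / h) ≤ N * Real.sqrt (Q / (x * K)) := by
    refine (sum_multTotal_div_le (by positivity) hK).trans (le_of_eq ?_)
    congr 2
    rw [div_mul_eq_mul_div, div_div_eq_mul_div, mul_assoc, mul_div_mul_left _ _ two_ne_zero]
  have hswap := sum_norm_mul_sum_divisors a x S (fun h => 1 / (h : ℝ))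
  set U := ∑ n ∈ upTo x, ‖a n‖ * (tau3Smooth (P * x / Q) n : ℝ) with hU
  set W := ∑ n ∈ upTo x, ‖a n‖ * (tau3 n : ℝ) with hW
  have hU0 : 0 ≤ U := Finset.sum_nonneg fun _ _ => by positivity
  have hW0 : 0 ≤ W := Finset.sum_nonneg fun _ _ => by positivity
  calc ∑ m ∈ upTo x, ‖a m‖ * ∑ h ∈ m.divisors.filter (· ∈ upTo Q), E m h
      ≤ ∑ m ∈ upTo x, ‖a m‖ * (C * (L ^ 4 * G * tau3Smooth (P * x / Q) m + L ^ 2 * T * tau3 m)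
        + C' * (Real.log P * N / K₁ * ∑ h ∈ m.divisors.filter (· ∈ S), 1 / (h : ℝ)
          + T * tau3 m)) :=
        Finset.sum_le_sum fun m hm => mul_le_mul_of_nonneg_left (key m hm) (norm_nonneg _)
    _ = C * L ^ 4 * G * U + C * L ^ 2 * T * W + C' * (Real.log P * N / K₁) *
          (∑ m ∈ upTo x, ‖a m‖ * ∑ h ∈ m.divisors.filter (· ∈ S), 1 / (h : ℝ))
        + C' * T * W := by
        rw [hU, hW, Finset.mul_sum, Finset.mul_sum, Finset.mul_sum, Finset.mul_sum,
          ← Finset.sum_add_distrib, ← Finset.sum_add_distrib, ← Finset.sum_add_distrib]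
        exact Finset.sum_congr rfl fun m _ => by ring
    _ ≤ C * L ^ 4 * G * U + C * L ^ 2 * T * W
        + C' * (Real.log P * N / K₁) * (N * Real.sqrt (Q / (x * K))) + C' * L ^ 2 * T * W := by
        rw [hswap]
        have h1 : T * W ≤ L ^ 2 * (T * W) :=
          le_mul_of_one_le_left (by positivity) (one_le_pow₀ hL1)
        have h2 : C' * T * W ≤ C' * L ^ 2 * T * W := by
          have := mul_le_mul_of_nonneg_left h1 hC'.le
          linarith
        have h3 := mul_le_mul_of_nonneg_left hcs
          (by positivity : 0 ≤ C' * (Real.log P * N / K₁))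
        linarith
    _ ≤ _ := by
        have e1 : N * L ^ 4 * (Q / (x * K₁) * U) = L ^ 4 * G * U := by rw [hG]; ring
        have e2 : N ^ 2 * (Real.log P / K₁ * Real.sqrt (Q / (x * K)))
          = (Real.log P * N / K₁) * (N * Real.sqrt (Q / (x * K))) := by ring
        rw [e1, e2]
        have p1 : 0 ≤ C' * (L ^ 4 * G * U) := by positivity
        have p2 : 0 ≤ C * ((Real.log P * N / K₁) * (N * Real.sqrt (Q / (x * K)))) := by positivity
        nlinarith

theorem card_upTo_le {y : ℝ} (hy : 0 ≤ y) : ((upTo y).card : ℝ) ≤ y := by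
  unfold upTo
  rw [Nat.card_Icc, Nat.add_sub_cancel]
  exact Nat.floor_le hy

/-- Divisors `h > Q` have weight 0. For the others the change to smooth parts costs the same small
amount for every `k`, so only the total mass on multiples of `h` and the number of such multiples
enter. -/
theorem exists_norm_sum_mul_pairWeight_le :
    ∃ C : ℝ, 0 < C ∧ ∀ (a : ℕ → ℂ) (x Q P R K₁ K₂ K₃ : ℝ), Admissible a x Q P R K₁ K₂ K₃ →
      ∀ m ∈ upTo x, ‖∑ n ∈ upTo x, (a n - total a x / x) * (pairWeight Q m n : ℂ)‖
        ≤ ∑ h ∈ m.divisors.filter (· ∈ upTo Q),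
          (‖∑ k ∈ upTo (x / h), (a (k * h) - total a x / x) * (smoothWeight P Q h (m / h) k : ℂ)‖
            + C * (Real.log x / (P * Real.log P)) * (multTotal a x h + absTotal a x * (1 / h))) := by
  obtain ⟨C, hC, hsm⟩ := exists_scaledWeight_smoothPart_sub_le
  refine ⟨C, hC, fun a x Q P R K₁ K₂ K₃ H m hm => ?_⟩
  have hx := H.x_pos
  have hQ := H.Q_pos
  have hl := H.one_le_log_P
  have hlx := H.one_le_log_x
  have hP := H.three_le
  have hm1 := (mem_upTo.1 hm).1
  rw [sum_mul_pairWeight hQ x hm1, ← Finset.sum_filter_add_sum_filter_not _ (· ∈ upTo Q)]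
  have hzero : ∑ h ∈ m.divisors.filter (fun h => ¬ h ∈ upTo Q), ∑ k ∈ upTo (x / h),
      (a (k * h) - total a x / x) * (scaledWeight Q h (m / h * k) (gapIndex Q (m / h) k) : ℂ)
      = 0 := by
    refine Finset.sum_eq_zero fun h hh => Finset.sum_eq_zero fun k hk => ?_
    obtain ⟨h1, h2⟩ := Finset.mem_filter.1 hh
    have h3 : Q < h := by
      by_contra hcon
      exact h2 (mem_upTo.2 ⟨Nat.pos_of_mem_divisors h1, not_lt.1 hcon⟩)
    rw [H.scaledWeight_eq_zero h3 (div_mem_upTo hm h1) hk]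
    simp
  rw [hzero, add_zero]
  refine norm_sum_le_of_le _ fun h hh => ?_
  obtain ⟨h1, h2⟩ := Finset.mem_filter.1 hh
  have hh0 : 0 < h := Nat.pos_of_mem_divisors h1
  have hhR : (1 : ℝ) ≤ h := by exact_mod_cast hh0
  have hsub : ∀ k ∈ upTo (x / h), k ∈ upTo x := fun k hk => by
    rw [mem_upTo] at hk ⊢
    exact ⟨hk.1, hk.2.trans (div_le_self hx.le hhR)⟩
  set δ := C * (Real.log x / (P * Real.log P)) with hδ
  have hδ0 : 0 ≤ δ := by positivity
  have e1 : ∑ k ∈ upTo (x / h), (a (k * h) - total a x / x)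
        * (scaledWeight Q h (m / h * k) (gapIndex Q (m / h) k) : ℂ)
      = ∑ k ∈ upTo (x / h), (a (k * h) - total a x / x) * (smoothWeight P Q h (m / h) k : ℂ)
        + ∑ k ∈ upTo (x / h), (a (k * h) - total a x / x)
          * ((scaledWeight Q h (m / h * k) (gapIndex Q (m / h) k)
            - smoothWeight P Q h (m / h) k : ℝ) : ℂ) := by
    rw [← Finset.sum_add_distrib]
    exact Finset.sum_congr rfl fun k _ => by push_cast; ring
  rw [e1]
  refine (norm_add_le _ _).trans (add_le_add le_rfl ?_)
  have hμ : ‖total a x / (x : ℂ)‖ ≤ absTotal a x / x := by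
    rw [norm_div, Complex.norm_real, Real.norm_of_nonneg hx.le]
    exact div_le_div_of_nonneg_right (norm_total_le a x) hx.le
  calc _ ≤ ∑ k ∈ upTo (x / h), (‖a (k * h)‖ + absTotal a x / x) * δ := by
        refine norm_sum_le_of_le _ fun k hk => ?_
        rw [norm_mul, Complex.norm_real, Real.norm_eq_abs]
        refine mul_le_mul ((norm_sub_le _ _).trans (add_le_add le_rfl hμ)) ?_ (abs_nonneg _)
          (add_nonneg (norm_nonneg _) (div_nonneg (absTotal_nonneg a x) hx.le))
        exact hsm P x Q h (m / h) k _ hP (hsub _ (div_mem_upTo hm h1)) (hsub k hk)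
    _ = δ * (multTotal a x h + (upTo (x / h)).card * (absTotal a x / x)) := by
        rw [← Finset.sum_mul, Finset.sum_add_distrib, Finset.sum_const, nsmul_eq_mul, multTotal,
          sum_filter_dvd_upTo x hh0]
        ring
    _ ≤ _ := by
        have h4 : ((upTo (x / h)).card : ℝ) * (absTotal a x / x) ≤ absTotal a x * (1 / h) := by
          have h5 : absTotal a x * (1 / h) = x / h * (absTotal a x / x) := by field_simp
          rw [h5]
          exact mul_le_mul_of_nonneg_right (card_upTo_le (by positivity))
            (div_nonneg (absTotal_nonneg a x) hx.le)
        gcongr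

/-- By the arithmetic-geometric inequality and `∑ 1/h² ≤ 2`, the density part costs `2 * absTotal²`,
and `absTotal²` is the term `h = 1` on the right. -/
theorem sum_multTotal_mul_le {a : ℕ → ℂ} {x Q : ℝ} (hQ : 1 ≤ Q) :
    ∑ h ∈ upTo Q, multTotal a x h * (multTotal a x h + absTotal a x * (1 / h))
      ≤ 4 * ∑ h ∈ upTo Q, multTotal a x h ^ 2 := by
  have h1 : ∑ h ∈ upTo Q, (1 / (h : ℝ)) ^ 2 ≤ 2 := by
    calc ∑ h ∈ upTo Q, (1 / (h : ℝ)) ^ 2 = ∑ h ∈ Finset.Ioo 0 (⌊Q⌋₊ + 1), ((h : ℝ) ^ 2)⁻¹ := by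
          refine Finset.sum_congr ?_ fun _ _ => by rw [one_div, inv_pow]
          ext h; simp only [upTo, Finset.mem_Icc, Finset.mem_Ioo]; omega
      _ ≤ 2 / (((0 : ℕ) : ℝ) + 1) := sum_Ioo_inv_sq_le _ _
      _ = 2 := by norm_num
  have h2 : absTotal a x ^ 2 ≤ ∑ h ∈ upTo Q, multTotal a x h ^ 2 := by
    rw [← multTotal_one]
    exact Finset.single_le_sum (f := fun h => multTotal a x h ^ 2) (fun _ _ => sq_nonneg _)
      (mem_upTo.2 ⟨le_rfl, by simpa using hQ⟩)
  calc _ ≤ ∑ h ∈ upTo Q, (2 * multTotal a x h ^ 2 + absTotal a x ^ 2 * (1 / (h : ℝ)) ^ 2) :=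
        Finset.sum_le_sum fun h _ => by
          nlinarith [sq_nonneg (multTotal a x h - absTotal a x * (1 / h)),
            sq_nonneg (multTotal a x h)]
    _ ≤ _ := by
        rw [Finset.sum_add_distrib, ← Finset.mul_sum, ← Finset.mul_sum]
        nlinarith [sq_nonneg (absTotal a x)]

/-- In the bilinear form, the sequence in one variable may be replaced by its density. -/
theorem exists_sum_norm_mul_pairWeight_le :
    ∃ C : ℝ, 0 < C ∧ ∀ (a : ℕ → ℂ) (x Q P R K₁ K₂ K₃ : ℝ) (K : ℝ → ℝ),
      Admissible a x Q P R K₁ K₂ K₃ → NonConcentration a x Q K →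
      ∑ m ∈ upTo x, ‖a m‖ * ‖∑ n ∈ upTo x, (a n - total a x / x) * (pairWeight Q m n : ℂ)‖
      ≤ C * (absTotal a x * Real.log (P * x / Q) ^ 4 * (Q / (x * K₁) *
            ∑ n ∈ upTo x, ‖a n‖ * (tau3Smooth (P * x / Q) n : ℝ))
          + Real.log (P * x / Q) ^ 2 * tailBound (absTotal a x) x P R K₂ K₃ Q *
            ∑ n ∈ upTo x, ‖a n‖ * (tau3 n : ℝ)
          + absTotal a x ^ 2 * (Real.log x / (P * Real.log P * K 1)
            + Real.log P / K₁ * Real.sqrt (Q / (x * K (2 * x / Q))))) := by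
  obtain ⟨C, hC, h⟩ := exists_norm_sum_mul_pairWeight_le
  obtain ⟨C', hC', h'⟩ := exists_sum_norm_mul_smoothWeight_le
  refine ⟨C' + 4 * C, by positivity, fun a x Q P R K₁ K₂ K₃ K H hK => ?_⟩
  have hx := H.x_pos
  have hQ := H.Q_pos
  have hl := H.one_le_log_P
  have hlx := H.one_le_log_x
  have hP := H.three_le
  have hL := H.one_le_log
  have hK₁ := H.K₁_pos
  have hN := absTotal_nonneg a x
  have hT := H.tailBound_nonneg hQ.le
  have hQ1 : 1 ≤ Q := by nlinarith [H.lt_sq, H.large]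
  have hH : 2 * x / Q ≤ Q := by
    rw [div_le_iff₀ hQ]; exact H.lt_sq.le
  have hbig := h' a x Q P R K₁ K₂ K₃ (K (2 * x / Q)) H (hK _ hH)
  have hone : ∑ h ∈ upTo Q, multTotal a x h ^ 2 ≤ absTotal a x ^ 2 / K 1 := by
    have h1 := hK 1 hQ1
    rwa [Finset.filter_true_of_mem] at h1
    intro h hh
    exact_mod_cast (mem_upTo.1 hh).1
  set X₁ := absTotal a x * Real.log (P * x / Q) ^ 4 * (Q / (x * K₁) *
            ∑ n ∈ upTo x, ‖a n‖ * (tau3Smooth (P * x / Q) n : ℝ))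
  set X₂ := Real.log (P * x / Q) ^ 2 * tailBound (absTotal a x) x P R K₂ K₃ Q *
            ∑ n ∈ upTo x, ‖a n‖ * (tau3 n : ℝ)
  set X₃ := Real.log P / K₁ * Real.sqrt (Q / (x * K (2 * x / Q)))
  have hX₁ : 0 ≤ X₁ := by positivity
  have hX₂ : 0 ≤ X₂ := by positivity
  have hX₃ : 0 ≤ X₃ := by positivity
  set δ := Real.log x / (P * Real.log P) with hδ
  have hδ0 : 0 ≤ δ := by positivity
  set E : ℕ → ℕ → ℝ := fun m h =>
    ‖∑ k ∈ upTo (x / h), (a (k * h) - total a x / x) * (smoothWeight P Q h (m / h) k : ℂ)‖ with hE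
  calc _ ≤ ∑ m ∈ upTo x, ‖a m‖ * ∑ h ∈ m.divisors.filter (· ∈ upTo Q),
          (E m h + C * δ * (multTotal a x h + absTotal a x * (1 / h))) :=
        Finset.sum_le_sum fun m hm =>
          mul_le_mul_of_nonneg_left (h a x Q P R K₁ K₂ K₃ H m hm) (norm_nonneg _)
    _ = ∑ m ∈ upTo x, ‖a m‖ * ∑ h ∈ m.divisors.filter (· ∈ upTo Q), E m h
        + C * δ * ∑ h ∈ upTo Q, multTotal a x h * (multTotal a x h + absTotal a x * (1 / h)) := by
        rw [← sum_norm_mul_sum_divisors, Finset.mul_sum, ← Finset.sum_add_distrib]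
        refine Finset.sum_congr rfl fun m _ => ?_
        rw [Finset.sum_add_distrib, ← Finset.mul_sum]
        ring
    _ ≤ C' * (X₁ + X₂ + absTotal a x ^ 2 * X₃) + C * δ * (4 * (absTotal a x ^ 2 / K 1)) := by
        refine add_le_add hbig (mul_le_mul_of_nonneg_left ?_ (by positivity))
        exact (sum_multTotal_mul_le hQ1).trans (by linarith)
    _ ≤ _ := by
        have e1 : Real.log x / (P * Real.log P * K 1) = δ / K 1 := by rw [hδ, div_div]
        have h0 : 0 ≤ absTotal a x ^ 2 / K 1 := (Finset.sum_nonneg fun _ _ => sq_nonneg _).trans hone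
        have e2 : absTotal a x ^ 2 * (δ / K 1 + X₃)
          = δ * (absTotal a x ^ 2 / K 1) + absTotal a x ^ 2 * X₃ := by ring
        rw [e1, e2]
        have p1 : 0 ≤ C' * (δ * (absTotal a x ^ 2 / K 1)) := by positivity
        have p2 : 0 ≤ C * (X₁ + X₂ + absTotal a x ^ 2 * X₃) := by positivity
        nlinarith

/-! ### Row sums of the pair weight over the integers -/

theorem card_quot {D : Finset ℕ} {g : ℕ} (hg : 0 < g) (p : ℕ → Prop) [DecidablePred p] :
    ((quot D g).filter p).card = (D.filter (fun n => g ∣ n ∧ p (n / g))).card := by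
  refine Finset.card_nbij' (fun k => g * k) (fun n => n / g) ?_ ?_ ?_ ?_
  · intro k hk
    simp only [Finset.coe_filter, Set.mem_ofPred_eq, mem_quot hg] at hk ⊢
    exact ⟨hk.1, dvd_mul_right g k, by rw [Nat.mul_div_cancel_left k hg]; exact hk.2⟩
  · intro n hn
    simp only [Finset.coe_filter, Set.mem_ofPred_eq, mem_quot hg] at hn ⊢
    rw [Nat.mul_div_cancel' hn.2.1]
    exact ⟨hn.1, hn.2.2⟩
  · intro k _; exact Nat.mul_div_cancel_left k hg
  · intro n hn
    simp only [Finset.coe_filter, Set.mem_ofPred_eq] at hn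
    exact Nat.mul_div_cancel' hn.2.1

/-- With `g = gcd m r` and `s = r / g`, the sum counts multiples of `g` whose cofactor is coprime to
`s`, weighted by `1 / φ(s)`. The density is `(1/g)(φ(s)/s)/φ(s) = 1/r`; the two counting errors give
`τ(s)/φ(s)` and `1/s`. -/
theorem abs_sum_gcdWeight_sub_le {D : Finset ℕ} (hD : (D : Set ℕ).OrdConnected) (h0 : 0 ∉ D)
    {r : ℕ} (hr : 0 < r) (m : ℕ) :
    |∑ n ∈ D, gcdWeight r m n - D.card * (1 / (r : ℝ))|
      ≤ 2 * ((tau (r / Nat.gcd m r) : ℝ) / (r / Nat.gcd m r).totient) := by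
  set g := Nat.gcd m r with hg
  have hg0 : 0 < g := Nat.gcd_pos_of_pos_right m hr
  have hgr : g ∣ r := Nat.gcd_dvd_right m r
  set s := r / g with hs
  have hs0 : 0 < s := Nat.div_pos (Nat.le_of_dvd hr hgr) hg0
  have hrs : r = g * s := (Nat.mul_div_cancel' hgr).symm
  have hφ : (0 : ℝ) < s.totient := by exact_mod_cast Nat.totient_pos.2 hs0
  have hsR : (0 : ℝ) < s := by exact_mod_cast hs0
  have hgR : (0 : ℝ) < g := by exact_mod_cast hg0
  have hq : ((quot D g : Finset ℕ) : Set ℕ).OrdConnected := by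
    refine ⟨fun a ha b hb k hk => ?_⟩
    rw [Finset.mem_coe, mem_quot hg0] at *
    exact hD.out ha hb ⟨Nat.mul_le_mul_left g hk.1, Nat.mul_le_mul_left g hk.2⟩
  have hq0 : 0 ∉ quot D g := fun h => by
    rw [mem_quot hg0] at h
    exact h0 (by simpa using h)
  have e1 : ∑ n ∈ D, gcdWeight r m n
      = ((quot D g).filter (fun k => Nat.Coprime k s)).card / (s.totient : ℝ) := by
    unfold gcdWeight
    rw [← Finset.sum_filter, Finset.sum_const, nsmul_eq_mul, card_quot hg0, mul_one_div]
    congr 3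
    refine Finset.filter_congr fun n _ => ?_
    constructor
    · intro h
      have h1 : g ∣ n := by rw [hg, h]; exact Nat.gcd_dvd_left n r
      refine ⟨h1, ?_⟩
      rw [hs, Nat.Coprime, Nat.gcd_div h1 hgr, ← h]
      exact Nat.div_self hg0
    · rintro ⟨h1, h2⟩
      have h3 : Nat.gcd n r / g = 1 := by rw [← Nat.gcd_div h1 hgr]; exact h2
      rw [← hg, ← Nat.div_mul_cancel (Nat.dvd_gcd h1 hgr), h3, one_mul]
  have e2 : ((quot D g).card : ℝ) = (D.filter (g ∣ ·)).card := by
    have := card_quot (D := D) hg0 (fun _ => True)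
    simp only [Finset.filter_true, and_true] at this
    exact_mod_cast this
  have h1 := abs_card_filter_coprime_sub_le hq hq0 hs0.ne'
  have h2 := abs_card_filter_dvd_sub_le hD h0 hg0
  rw [e2] at h1
  set A : ℝ := (((quot D g).filter (fun k => Nat.Coprime k s)).card : ℝ)
  set B : ℝ := ((D.filter (g ∣ ·)).card : ℝ)
  rw [e1]
  have e3 : A / (s.totient : ℝ) - D.card * (1 / (r : ℝ))
      = (A - s.totient / s * B) / s.totient + (B - D.card / g) / s := by
    have : (r : ℝ) = g * s := by exact_mod_cast hrs
    rw [this]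
    field_simp
    ring
  rw [e3]
  have h4 : (1 : ℝ) / s ≤ tau s / s.totient := by
    rw [div_le_div_iff₀ hsR hφ]
    have h5 : (1 : ℝ) ≤ tau s := by exact_mod_cast one_le_tau hs0.ne'
    have h6 : (s.totient : ℝ) ≤ s := by exact_mod_cast Nat.totient_le s
    nlinarith
  calc _ ≤ |(A - s.totient / s * B) / s.totient| + |(B - D.card / g) / s| := abs_add_le _ _
    _ ≤ tau s / s.totient + 1 / s := by
        rw [abs_div, abs_div, abs_of_pos hφ, abs_of_pos hsR]
        gcongr
    _ ≤ _ := by linarith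

/-- The gcd is replaced by an arbitrary divisor `g` of `m`, at the price of `τ(m)`; for fixed `g`
the quotients again run through a dyadic range. -/
theorem exists_sum_dyadic_tau_div_gcd_le :
    ∃ C : ℝ, 0 < C ∧ ∀ m j : ℕ, m ≠ 0 →
      ∑ r ∈ dyadic j, (tau (r / Nat.gcd m r) : ℝ) / (r / Nat.gcd m r).totient
        ≤ C * tau m * (1 + Real.log j) := by
  obtain ⟨C, hC, h⟩ := exists_sum_dyadic_tau_div_totient_le
  refine ⟨C, hC, fun m j hm => ?_⟩
  set f : ℕ → ℝ := fun s => (tau s : ℝ) / s.totient with hf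
  have hf0 : ∀ s, 0 ≤ f s := fun s => by positivity
  calc ∑ r ∈ dyadic j, f (r / Nat.gcd m r)
      ≤ ∑ r ∈ dyadic j, ∑ g ∈ m.divisors, if g ∣ r then f (r / g) else 0 := by
        refine Finset.sum_le_sum fun r _ => ?_
        have h1 := Finset.single_le_sum (f := fun g => if g ∣ r then f (r / g) else 0)
          (s := m.divisors) (fun g _ => by split_ifs; exacts [hf0 _, le_rfl])
          (Nat.mem_divisors.2 ⟨Nat.gcd_dvd_left m r, hm⟩)
        simpa only [if_pos (Nat.gcd_dvd_right m r)] using h1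
    _ = ∑ g ∈ m.divisors, ∑ k ∈ dyadic (j ⌈/⌉ g), f k := by
        rw [Finset.sum_comm]
        refine Finset.sum_congr rfl fun g hg => ?_
        have hg0 := Nat.pos_of_mem_divisors hg
        rw [← Finset.sum_filter, sum_dyadic_dvd j hg0]
        exact Finset.sum_congr rfl fun k _ => by rw [Nat.mul_div_cancel_left k hg0]
    _ ≤ ∑ g ∈ m.divisors, C * (1 + Real.log j) := by
        refine Finset.sum_le_sum fun g hg => ?_
        have hg0 := Nat.pos_of_mem_divisors hg
        rcases Nat.eq_zero_or_pos j with rfl | hj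
        · have h1 : dyadic (0 ⌈/⌉ g) = ∅ := by
            rw [Finset.eq_empty_iff_forall_notMem]
            intro k hk
            rw [mem_dyadic, zero_ceilDiv] at hk
            omega
          rw [h1]; simp; exact hC.le
        · have h2 : j ⌈/⌉ g ≤ j := by
            rw [ceilDiv_le_iff_le_mul hg0]; exact Nat.le_mul_of_pos_left j hg0
          have h3 : 1 ≤ j ⌈/⌉ g := by
            by_contra hcon
            have h4 : j ⌈/⌉ g ≤ 0 := by omega
            rw [ceilDiv_le_iff_le_mul hg0] at h4
            omega
          refine (h _ h3).trans ?_
          have h4 : Real.log ((j ⌈/⌉ g : ℕ) : ℝ) ≤ Real.log j :=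
            Real.log_le_log (by exact_mod_cast h3) (by exact_mod_cast h2)
          gcongr
    _ = _ := by rw [Finset.sum_const, nsmul_eq_mul, tau]; ring

/-- The difference of a dyadic harmonic sum and its limit. -/
def dyadicDefect (j : ℕ) : ℝ := ∑ r ∈ dyadic j, 1 / (r : ℝ) - Real.log 2

theorem abs_dyadicDefect_le (j : ℕ) : |dyadicDefect j| ≤ 1 / max 1 (j : ℝ) := by
  rcases Nat.eq_zero_or_pos j with rfl | hj
  · have h1 : dyadic 0 = ∅ := by
      rw [Finset.eq_empty_iff_forall_notMem]
      intro k hk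
      rw [mem_dyadic] at hk
      omega
    have h2 := Real.log_two_lt_d9
    have h3 : 0 ≤ Real.log 2 := Real.log_nonneg (by norm_num)
    simp only [dyadicDefect, h1, Finset.sum_empty, zero_sub, abs_neg, abs_of_nonneg h3,
      Nat.cast_zero, zero_le_one, sup_of_le_left]
    linarith
  · have : (1 : ℝ) ≤ j := by exact_mod_cast hj
    rw [max_eq_right this]
    exact abs_sum_dyadic_inv_sub_log_two hj

/-- On each block `gcdWeight r m n` averages to `1 / r`. The number of blocks is `O(P x / Q)`, which
gives the error. -/
theorem exists_abs_sum_pairWeight_sub_le :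
    ∃ C : ℝ, 0 < C ∧ ∀ (a : ℕ → ℂ) (x Q P R K₁ K₂ K₃ : ℝ), Admissible a x Q P R K₁ K₂ K₃ →
      ∀ m ∈ upTo x, |∑ n ∈ upTo x, pairWeight Q m n
          - ∑ n ∈ upTo x, dyadicDefect (gapIndex Q m n)|
        ≤ C * tau m * (P * x / Q * Real.log x) := by
  obtain ⟨C, hC, h⟩ := exists_sum_dyadic_tau_div_gcd_le
  refine ⟨30 * C + 1, by positivity, fun a x Q P R K₁ K₂ K₃ H m hm => ?_⟩
  have hx := H.x_pos
  have hQ := H.Q_pos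
  have hlx := H.one_le_log_x
  have hm0 : m ≠ 0 := by have := (mem_upTo.1 hm).1; omega
  have hτ : (1 : ℝ) ≤ tau m := by exact_mod_cast one_le_tau hm0
  have hx9 := H.large
  have hy : 3 ≤ P * x / Q := H.three_le.trans H.P_le
  have hQ1 : 1 ≤ Q := by nlinarith [H.lt_sq, H.large]
  set e : ℕ → ℕ → ℝ := fun j n => ∑ r ∈ dyadic j, (gcdWeight r m n - 1 / (r : ℝ)) with he
  have key : ∀ (D : Finset ℕ) (j : ℕ), (D : Set ℕ).OrdConnected → 0 ∉ D →
      |∑ n ∈ D, e j n| ≤ 2 * C * tau m * (1 + Real.log j) := by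
    intro D j hD h0
    have e1 : ∑ n ∈ D, e j n
        = ∑ r ∈ dyadic j, (∑ n ∈ D, gcdWeight r m n - D.card * (1 / (r : ℝ))) := by
      rw [he, Finset.sum_comm]
      refine Finset.sum_congr rfl fun r _ => ?_
      rw [Finset.sum_sub_distrib, Finset.sum_const, nsmul_eq_mul]
    rw [e1]
    calc _ ≤ ∑ r ∈ dyadic j, 2 * ((tau (r / Nat.gcd m r) : ℝ) / (r / Nat.gcd m r).totient) :=
          (Finset.abs_sum_le_sum_abs _ _).trans (Finset.sum_le_sum fun r hr =>
            abs_sum_gcdWeight_sub_le hD h0 (pos_of_mem_dyadic hr) m)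
      _ ≤ _ := by
          rw [← Finset.mul_sum]
          linarith [h m j hm0]
  set M := ⌊Q⌋₊ + 1 with hM
  set J := (upTo x).sup (gapIndex Q m) with hJ
  have hm1 : m ∈ upTo (x / (1 : ℕ)) := by simpa using hm
  have hJM : J ≤ M := Finset.sup_le fun k hk => by
    have := H.gapIndex_le_floor one_pos hm1 (by simpa using hk : k ∈ upTo (x / (1 : ℕ)))
    simpa using this
  have hJ2 : (J : ℝ) ≤ P * x / Q := by
    rw [← Nat.le_floor_iff (by linarith)]
    exact Finset.sup_le fun k hk => Nat.le_floor
      (H.gapIndex_le one_pos hm1 (by simpa using hk : k ∈ upTo (x / (1 : ℕ))))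
  have hlogM : 1 + Real.log M ≤ 3 * Real.log x := by
    have h1 : (M : ℝ) ≤ x * x := by
      have := Nat.floor_le hQ.le
      have := H.Q_le
      rw [hM]; push_cast
      nlinarith
    have h2 := Real.log_le_log (by rw [hM]; positivity) h1
    rw [Real.log_mul hx.ne' hx.ne'] at h2
    linarith
  have hlog : ∀ j ≤ M, 1 + Real.log j ≤ 3 * Real.log x := by
    intro j hj
    refine le_trans ?_ hlogM
    rcases Nat.eq_zero_or_pos j with h0 | h0
    · rw [h0]; simp; exact Real.log_natCast_nonneg _
    · have := Real.log_le_log (by exact_mod_cast h0) (Nat.cast_le (α := ℝ).2 hj)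
      linarith
  -- The two copies of `log 2` cancel. What is left of the sum over `q` is the defect of index `⌊Q⌋₊
  -- + 1`, at most `1 / Q` for each `n`.
  have e1 : ∑ n ∈ upTo x, pairWeight Q m n - ∑ n ∈ upTo x, dyadicDefect (gapIndex Q m n)
      = ∑ n ∈ upTo x, e (gapIndex Q m n) n - ∑ n ∈ upTo x, e M n
        - (upTo x).card * dyadicDefect M := by
    rw [← nsmul_eq_mul, ← Finset.sum_const, ← Finset.sum_sub_distrib, ← Finset.sum_sub_distrib,
      ← Finset.sum_sub_distrib]
    refine Finset.sum_congr rfl fun n _ => ?_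
    simp only [he, pairWeight, dyadicDefect, Finset.sum_sub_distrib]
    ring
  have b1 : |∑ n ∈ upTo x, e (gapIndex Q m n) n|
      ≤ (J + 1) * (12 * C * tau m * Real.log x) := by
    rw [sum_upTo_eq_sum_blocks Q x m J fun k hk => Finset.le_sup hk]
    have h3 : ∀ j ∈ Finset.range (J + 1), ∀ D : Finset ℕ, IsBlock D Q →
        (∀ n ∈ D, gapIndex Q m n = j) →
        |∑ n ∈ D, e (gapIndex Q m n) n| ≤ 6 * C * tau m * Real.log x := by
      intro j hj D hD hDj
      rw [Finset.sum_congr rfl fun n hn => by rw [hDj n hn]]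
      refine (key D j hD.ordConnected hD.zero_notMem).trans ?_
      have h4 := hlog j ((Nat.lt_succ_iff.1 (Finset.mem_range.1 hj)).trans hJM)
      have h5 : 0 ≤ 2 * C * tau m := by positivity
      nlinarith
    calc _ ≤ ∑ j ∈ Finset.range (J + 1), (12 * C * tau m * Real.log x) := by
          refine (Finset.abs_sum_le_sum_abs _ _).trans (Finset.sum_le_sum fun j hj => ?_)
          refine (abs_add_le _ _).trans ?_
          have h4 := h3 j hj _ (isBlock_rightBlock hQ x m j) fun n hn =>
            (Finset.mem_filter.1 (Finset.mem_filter.1 hn).1).2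
          have h5 := h3 j hj _ (isBlock_leftBlock hQ x m j) fun n hn =>
            (Finset.mem_filter.1 (Finset.mem_filter.1 hn).1).2
          linarith
      _ = _ := by
          rw [Finset.sum_const, Finset.card_range, nsmul_eq_mul]; push_cast; ring
  have b2 : |∑ n ∈ upTo x, e M n| ≤ 6 * C * tau m * Real.log x := by
    refine (key (upTo x) M ?_ ?_).trans ?_
    · unfold upTo; rw [Finset.coe_Icc]; exact Set.ordConnected_Icc
    · rw [mem_upTo]; omega
    · have h5 : 0 ≤ 2 * C * tau m := by positivity
      nlinarith
  have b3 : |((upTo x).card : ℝ) * dyadicDefect M| ≤ P * x / Q := by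
    rw [abs_mul, abs_of_nonneg (Nat.cast_nonneg _)]
    have h4 : |dyadicDefect M| ≤ 1 / Q := by
      refine (abs_dyadicDefect_le M).trans (one_div_le_one_div_of_le hQ ?_)
      refine le_max_of_le_right ?_
      rw [hM]; push_cast; exact (Nat.lt_floor_add_one Q).le
    calc _ ≤ x * (1 / Q) := by
          gcongr
          exact card_upTo_le hx.le
      _ ≤ 3 * (x * (1 / Q)) := by
          have : 0 ≤ x * (1 / Q) := by positivity
          linarith
      _ ≤ P * (x * (1 / Q)) := by
          gcongr; exact H.three_le
      _ = _ := by ring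
  rw [e1]
  set y := P * x / Q
  set τ : ℝ := (tau m : ℝ)
  set l := Real.log x
  calc _ ≤ |∑ n ∈ upTo x, e (gapIndex Q m n) n| + |∑ n ∈ upTo x, e M n|
        + |((upTo x).card : ℝ) * dyadicDefect M| :=
        (abs_sub _ _).trans (add_le_add (abs_sub _ _) le_rfl)
    _ ≤ (J + 1) * (12 * C * τ * l) + 6 * C * τ * l + y := by linarith
    _ ≤ (2 * y) * (12 * C * τ * l) + y * (6 * C * τ * l) + τ * (y * l) := by
        have h1 : 0 ≤ C * τ * l := by positivity
        have h2 : y * 1 ≤ y * l := by gcongr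
        have h3 : 0 ≤ y * l := by positivity
        have h4 : 1 * (y * l) ≤ τ * (y * l) := by gcongr
        have h5 : (J + 1) * (12 * C * τ * l) ≤ (2 * y) * (12 * C * τ * l) := by
          gcongr; linarith
        nlinarith
    _ = _ := by ring

/-- The case `h = 1` of the general estimate, with a weight that ignores the smooth part. -/
theorem exists_norm_sum_dyadicDefect_le :
    ∃ C : ℝ, 0 < C ∧ ∀ (a : ℕ → ℂ) (x Q P R K₁ K₂ K₃ : ℝ), Admissible a x Q P R K₁ K₂ K₃ →
      ∀ n ∈ upTo x, ‖∑ m ∈ upTo x, (a m - total a x / x) * (dyadicDefect (gapIndex Q n m) : ℂ)‖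
          ≤ C * (Real.log (P * x / Q) ^ 3 * (Q * absTotal a x / (x * K₁))
            + Real.log (P * x / Q) * tailBound (absTotal a x) x P R K₂ K₃ Q) := by
  obtain ⟨C, hC, h⟩ := exists_norm_sum_gapIndex_le
  refine ⟨C, hC, fun a x Q P R K₁ K₂ K₃ H n hn => ?_⟩
  have h1 := h a x Q P R K₁ K₂ K₃ H 1 n le_rfl (by simpa using hn)
    (fun j _ => dyadicDefect j) 1 zero_le_one fun j s hs _ _ => by
      have : (1 : ℝ) ≤ tau s := by exact_mod_cast one_le_tau hs
      exact (abs_dyadicDefect_le j).trans (le_mul_of_one_le_right (by positivity) this)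
  simpa using h1

set_option maxHeartbeats 800000 in
/-- The bilinear form of the pair weights is close to its value for the constant sequence. -/
theorem exists_norm_bilinear_sub_le :
    ∃ C : ℝ, 0 < C ∧ ∀ (a : ℕ → ℂ) (x Q P R K₁ K₂ K₃ : ℝ) (K : ℝ → ℝ),
      Admissible a x Q P R K₁ K₂ K₃ → NonConcentration a x Q K →
      ‖∑ m ∈ upTo x, ∑ n ∈ upTo x, a m * conj (a n) * (pairWeight Q m n : ℂ)
        - ((‖total a x‖ ^ 2 / x ^ 2
          * ∑ m ∈ upTo x, ∑ n ∈ upTo x, dyadicDefect (gapIndex Q m n) : ℝ) : ℂ)‖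
      ≤ C * (absTotal a x * Real.log (P * x / Q) ^ 4 * (Q / (x * K₁) *
            ∑ n ∈ upTo x, ‖a n‖ * (tau3Smooth (P * x / Q) n : ℝ))
          + Real.log (P * x / Q) ^ 2 * tailBound (absTotal a x) x P R K₂ K₃ Q *
            ∑ n ∈ upTo x, ‖a n‖ * (tau3 n : ℝ)
          + absTotal a x ^ 2 * (Real.log x / (P * Real.log P * K 1)
            + Real.log P / K₁ * Real.sqrt (Q / (x * K (2 * x / Q))))
          + absTotal a x * (P * Real.log x / Q) * ∑ n ∈ upTo x, ‖a n‖ * (tau n : ℝ)) := by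
  obtain ⟨C₁, hC₁, h₁⟩ := exists_sum_norm_mul_pairWeight_le
  obtain ⟨C₂, hC₂, h₂⟩ := exists_abs_sum_pairWeight_sub_le
  obtain ⟨C₃, hC₃, h₃⟩ := exists_norm_sum_dyadicDefect_le
  refine ⟨C₁ + C₂ + C₃, by positivity, fun a x Q P R K₁ K₂ K₃ K H hK => ?_⟩
  have hx := H.x_pos
  have hQ := H.Q_pos
  have hP := H.three_le
  have hK₁ := H.K₁_pos
  have hlx := H.one_le_log_x
  have hL := H.one_le_log
  have hN := absTotal_nonneg a x
  have hT := H.tailBound_nonneg hQ.le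
  have hy : 0 ≤ P * x / Q := by positivity
  have hb₁ := h₁ a x Q P R K₁ K₂ K₃ K H hK
  set L := Real.log (P * x / Q)
  set N := absTotal a x with hNdef
  set T := tailBound N x P R K₂ K₃ Q
  set U := ∑ n ∈ upTo x, ‖a n‖ * (tau3Smooth (P * x / Q) n : ℝ) with hU
  set W := ∑ n ∈ upTo x, ‖a n‖ * (tau3 n : ℝ) with hW
  set Y := ∑ n ∈ upTo x, ‖a n‖ * (tau n : ℝ) with hY
  set Z := N ^ 2 * (Real.log x / (P * Real.log P * K 1)
            + Real.log P / K₁ * Real.sqrt (Q / (x * K (2 * x / Q)))) with hZ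
  have hne : ∀ n ∈ upTo x, n ≠ 0 := fun n hn => by have := (mem_upTo.1 hn).1; omega
  have hNU : N ≤ U := Finset.sum_le_sum fun n hn => by
    have : (1 : ℝ) ≤ tau3Smooth (P * x / Q) n := by exact_mod_cast one_le_tau3Smooth hy _
    exact le_mul_of_one_le_right (norm_nonneg _) this
  have hNW : N ≤ W := Finset.sum_le_sum fun n hn => by
    have : (1 : ℝ) ≤ tau3 n := by exact_mod_cast one_le_tau3 (hne n hn)
    exact le_mul_of_one_le_right (norm_nonneg _) this
  have hY0 : 0 ≤ Y := Finset.sum_nonneg fun _ _ => by positivity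
  set μ := total a x / (x : ℂ) with hμdef
  have hμ : ‖μ‖ ≤ N / x := by
    rw [norm_div, Complex.norm_real, Real.norm_of_nonneg hx.le]
    exact div_le_div_of_nonneg_right (norm_total_le a x) hx.le
  set g : ℕ → ℕ → ℝ := fun m n => dyadicDefect (gapIndex Q m n) with hg
  have hgc : ∀ m n, g m n = g n m := fun m n => by simp only [hg]; rw [gapIndex_comm]
  -- Three successive replacements: `a n` by the mean `μ`, the row sums of `pairWeight` by those of
  -- the defect, then `a m` by `μ`. Symmetry of the defect in its two variables allows the last one.
  have e1 : ∑ m ∈ upTo x, ∑ n ∈ upTo x, a m * conj (a n) * (pairWeight Q m n : ℂ)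
        - ((‖total a x‖ ^ 2 / x ^ 2 * ∑ m ∈ upTo x, ∑ n ∈ upTo x, g m n : ℝ) : ℂ)
      = ∑ m ∈ upTo x, a m * conj (∑ n ∈ upTo x, (a n - μ) * (pairWeight Q m n : ℂ))
        + conj μ * ∑ m ∈ upTo x, a m * ((∑ n ∈ upTo x, pairWeight Q m n
          - ∑ n ∈ upTo x, g m n : ℝ) : ℂ)
        + conj μ * ∑ n ∈ upTo x, ∑ m ∈ upTo x, (a m - μ) * (g n m : ℂ) := by
    have c1 : ((‖total a x‖ ^ 2 / x ^ 2 * ∑ m ∈ upTo x, ∑ n ∈ upTo x, g m n : ℝ) : ℂ)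
        = conj μ * ∑ n ∈ upTo x, ∑ m ∈ upTo x, μ * (g m n : ℂ) := by
      rw [Finset.sum_comm (s := upTo x)]
      simp only [← Finset.mul_sum]
      rw [← mul_assoc, mul_comm (conj μ) μ, Complex.mul_conj, Complex.normSq_eq_norm_sq, hμdef,
        norm_div, Complex.norm_real, Real.norm_of_nonneg hx.le, div_pow]
      push_cast
      rfl
    have c2 : ∑ m ∈ upTo x, a m * conj (∑ n ∈ upTo x, (a n - μ) * (pairWeight Q m n : ℂ))
        = ∑ m ∈ upTo x, ∑ n ∈ upTo x, a m * conj (a n) * (pairWeight Q m n : ℂ)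
          - conj μ * ∑ m ∈ upTo x, a m * ∑ n ∈ upTo x, (pairWeight Q m n : ℂ) := by
      rw [Finset.mul_sum, ← Finset.sum_sub_distrib]
      refine Finset.sum_congr rfl fun m _ => ?_
      simp only [map_sum, map_mul, map_sub, Complex.conj_ofReal]
      rw [Finset.mul_sum, Finset.mul_sum, Finset.mul_sum, ← Finset.sum_sub_distrib]
      exact Finset.sum_congr rfl fun n _ => by ring
    have c3 : ∑ n ∈ upTo x, ∑ m ∈ upTo x, (a m - μ) * (g n m : ℂ)
        = ∑ m ∈ upTo x, a m * ∑ n ∈ upTo x, (g m n : ℂ)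
          - ∑ n ∈ upTo x, ∑ m ∈ upTo x, μ * (g m n : ℂ) := by
      simp only [sub_mul, Finset.sum_sub_distrib]
      congr 1
      · rw [Finset.sum_comm]
        refine Finset.sum_congr rfl fun m _ => ?_
        rw [Finset.mul_sum]
        exact Finset.sum_congr rfl fun n _ => by rw [hgc]
      · exact Finset.sum_congr rfl fun n _ => Finset.sum_congr rfl fun m _ => by rw [hgc]
    rw [c1, c2, c3]
    push_cast
    simp only [mul_sub, Finset.sum_sub_distrib]
    ring
  rw [e1]
  have b₁ : ‖∑ m ∈ upTo x, a m * conj (∑ n ∈ upTo x, (a n - μ) * (pairWeight Q m n : ℂ))‖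
      ≤ C₁ * (N * L ^ 4 * (Q / (x * K₁) * U) + L ^ 2 * T * W + Z) := by
    refine (norm_sum_le_of_le _ fun m _ => ?_).trans hb₁
    rw [norm_mul, RCLike.norm_conj]
  have b₂ : ‖conj μ * ∑ m ∈ upTo x, a m * ((∑ n ∈ upTo x, pairWeight Q m n
          - ∑ n ∈ upTo x, g m n : ℝ) : ℂ)‖ ≤ C₂ * (N * (P * Real.log x / Q) * Y) := by
    rw [norm_mul, RCLike.norm_conj]
    calc _ ≤ N / x * ∑ m ∈ upTo x, ‖a m‖ * (C₂ * tau m * (P * x / Q * Real.log x)) := by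
          refine mul_le_mul hμ (norm_sum_le_of_le _ fun m hm => ?_) (norm_nonneg _) (by positivity)
          rw [norm_mul, Complex.norm_real]
          exact mul_le_mul_of_nonneg_left (h₂ a x Q P R K₁ K₂ K₃ H m hm) (norm_nonneg _)
      _ = N / x * ((∑ m ∈ upTo x, ‖a m‖ * tau m) * (C₂ * (P * x / Q * Real.log x))) := by
          rw [Finset.sum_mul]
          congr 1
          exact Finset.sum_congr rfl fun m _ => by ring
      _ = _ := by rw [← hY]; field_simp
  have b₃ : ‖conj μ * ∑ n ∈ upTo x, ∑ m ∈ upTo x, (a m - μ) * (g n m : ℂ)‖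
      ≤ C₃ * (N * L ^ 4 * (Q / (x * K₁) * U) + L ^ 2 * T * W) := by
    rw [norm_mul, RCLike.norm_conj]
    calc _ ≤ N / x * (x * (C₃ * (L ^ 3 * (Q * N / (x * K₁)) + L * T))) := by
          refine mul_le_mul hμ ?_ (norm_nonneg _) (by positivity)
          refine (norm_sum_le_of_le _ fun n hn => h₃ a x Q P R K₁ K₂ K₃ H n hn).trans ?_
          rw [Finset.sum_const, nsmul_eq_mul]
          refine mul_le_mul_of_nonneg_right (card_upTo_le hx.le) (by positivity)
      _ = C₃ * (N * L ^ 3 * (Q / (x * K₁) * N) + L * T * N) := by field_simp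
      _ ≤ _ := by
          have q1 : L ^ 3 ≤ L ^ 4 := pow_le_pow_right₀ hL (by norm_num)
          have q2 : L ≤ L ^ 2 := le_self_pow₀ hL (by norm_num)
          gcongr
  have hX₁ : 0 ≤ N * L ^ 4 * (Q / (x * K₁) * U) := by
    have : 0 ≤ U := hN.trans hNU
    positivity
  have hX₂ : 0 ≤ L ^ 2 * T * W := by
    have : 0 ≤ W := hN.trans hNW
    positivity
  have hX₄ : 0 ≤ N * (P * Real.log x / Q) * Y := by positivity
  have hZ0 : 0 ≤ Z := by
    have h1 : 0 ≤ N ^ 2 / K 1 := by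
      have hQ1 : 1 ≤ Q := by nlinarith [H.lt_sq, H.large]
      exact (Finset.sum_nonneg fun _ _ => sq_nonneg _).trans (hK 1 hQ1)
    have hl := H.one_le_log_P
    have h2 : Z = Real.log x / (P * Real.log P) * (N ^ 2 / K 1)
        + N ^ 2 * (Real.log P / K₁ * Real.sqrt (Q / (x * K (2 * x / Q)))) := by
      rw [hZ, mul_add, ← div_div]; ring
    rw [h2]
    positivity
  refine (norm_add₃_le ..).trans ?_
  have p1 := mul_nonneg hC₂.le hX₁
  have p2 := mul_nonneg hC₂.le hX₂
  have p3 := mul_nonneg hC₂.le hZ0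
  have p4 := mul_nonneg hC₃.le hZ0
  have p5 := mul_nonneg hC₃.le hX₄
  have p6 := mul_nonneg hC₁.le hX₄
  generalize N * L ^ 4 * (Q / (x * K₁) * U) = X₁ at *
  generalize L ^ 2 * T * W = X₂ at *
  generalize N * (P * Real.log x / Q) * Y = X₄ at *
  linarith

/-! ### The integral of `{v}(1 - {v}) / v³` -/

theorem hasDerivAt_max_zero_sq (u : ℝ) :
    HasDerivAt (fun u : ℝ => max 0 u ^ 2) (2 * max 0 u) u := by
  rcases lt_trichotomy u 0 with h | rfl | h
  · rw [max_eq_left h.le, mul_zero]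
    refine (hasDerivAt_const u (0 : ℝ)).congr_of_eventuallyEq ?_
    filter_upwards [gt_mem_nhds h] with v hv
    rw [max_eq_left hv.le]; norm_num
  · rw [max_self, mul_zero, hasDerivAt_iff_isLittleO]
    simp only [max_self, smul_zero, sub_zero, ne_eq, OfNat.ofNat_ne_zero, not_false_eq_true,
      zero_pow]
    refine Asymptotics.IsBigO.trans_isLittleO (g := fun v : ℝ => v ^ 2) ?_ ?_
    · refine Asymptotics.IsBigO.of_norm_le fun v => ?_
      rw [norm_pow, Real.norm_eq_abs, ← sq_abs v]
      have h1 : |max 0 v| ≤ |v| := by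
        rw [abs_of_nonneg (le_max_left _ _)]
        exact max_le (abs_nonneg v) (le_abs_self v)
      gcongr
    · simpa using Asymptotics.isLittleO_pow_pow (𝕜 := ℝ) (m := 1) (n := 2) (by norm_num)
  · rw [max_eq_right h.le]
    have h1 : HasDerivAt (fun v : ℝ => v ^ 2) (2 * u) u := by simpa using hasDerivAt_pow 2 u
    refine h1.congr_of_eventuallyEq ?_
    filter_upwards [lt_mem_nhds h] with v hv
    rw [max_eq_right hv.le]

/-- `∑_{r ≤ M} (1/r) max(0, 1 - r/v)²`. -/
def truncSqSum (M : ℕ) (v : ℝ) : ℝ := ∑ r ∈ Finset.Icc 1 M, 1 / (r : ℝ) * max 0 (1 - r / v) ^ 2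

theorem hasDerivAt_truncSqSum (M : ℕ) {v : ℝ} (hv : 0 < v) :
    HasDerivAt (truncSqSum M) (∑ r ∈ Finset.Icc 1 M, 2 * max 0 (1 - (r : ℝ) / v) / v ^ 2) v := by
  unfold truncSqSum
  refine HasDerivAt.fun_sum fun r hr => ?_
  have hr0 : (r : ℝ) ≠ 0 := by
    have := (Finset.mem_Icc.1 hr).1
    positivity
  have h1 : HasDerivAt (fun v : ℝ => 1 - (r : ℝ) / v) (r / v ^ 2) v := by
    have h2 := ((hasDerivAt_inv hv.ne').const_mul (r : ℝ)).const_sub 1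
    simp only [div_eq_mul_inv]
    exact h2.congr_deriv (by ring)
  have h3 := ((hasDerivAt_max_zero_sq (1 - (r : ℝ) / v)).comp v h1).const_mul (1 / (r : ℝ))
  refine h3.congr_deriv ?_
  field_simp

/-- Terms with `r > v` vanish, and the rest sum in closed form to a quadratic in `⌊v⌋`. The number
of terms may thus be fixed over the whole range of integration. -/
theorem fract_mul_one_sub_fract_div {v : ℝ} (hv : 0 < v) {M : ℕ} (hM : ⌊v⌋₊ ≤ M) :
    Int.fract v * (1 - Int.fract v) / v ^ 3
      = ∑ r ∈ Finset.Icc 1 M, 2 * max 0 (1 - (r : ℝ) / v) / v ^ 2 - 1 / v + 1 / v ^ 2 := by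
  have e1 : ∑ r ∈ Finset.Icc 1 M, 2 * max 0 (1 - (r : ℝ) / v) / v ^ 2
      = ∑ r ∈ Finset.Icc 1 ⌊v⌋₊, 2 * (1 - (r : ℝ) / v) / v ^ 2 := by
    rw [← Finset.sum_subset (Finset.Icc_subset_Icc_right hM)]
    · refine Finset.sum_congr rfl fun r hr => ?_
      rw [max_eq_right]
      rw [sub_nonneg, div_le_one hv]
      exact (Nat.le_floor_iff hv.le).1 (Finset.mem_Icc.1 hr).2
    · intro r hr hr2
      rw [Finset.mem_Icc] at hr hr2
      have h1 : v < r := (Nat.floor_lt hv.le).1 (by omega)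
      rw [max_eq_left, mul_zero, zero_div]
      rw [sub_nonpos, one_le_div hv]
      exact h1.le
  have e2 : ∀ n : ℕ, ∑ r ∈ Finset.Icc 1 n, 2 * (1 - (r : ℝ) / v) / v ^ 2
      = 2 * n / v ^ 2 - n * (n + 1) / v ^ 3 := by
    intro n
    induction n with
    | zero => simp
    | succ n ih =>
      rw [Finset.sum_Icc_succ_top (by omega), ih]
      push_cast
      field_simp
      ring
  have e3 : Int.fract v = v - (⌊v⌋₊ : ℝ) := by
    rw [Int.fract, ← natCast_floor_eq_intCast_floor hv.le]
  rw [e1, e2, e3]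
  field_simp
  ring

/-- The antiderivative is `truncSqSum M v - log v - 1/v`. Since `max(0, u)²` is continuously
differentiable, no splitting at integers is needed. -/
theorem integral_fract_eq {X : ℝ} (hX : 0 < X) :
    ∫ v in X..(2 * X), Int.fract v * (1 - Int.fract v) / v ^ 3
      = truncSqSum ⌊2 * X⌋₊ (2 * X) - truncSqSum ⌊2 * X⌋₊ X - Real.log 2 + 1 / (2 * X) := by
  set M := ⌊2 * X⌋₊
  have hle : X ≤ 2 * X := by linarith
  have hpos : ∀ v ∈ Set.uIcc X (2 * X), 0 < v := fun v hv => by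
    rw [Set.uIcc_of_le hle] at hv
    linarith [hv.1]
  have e1 : ∫ v in X..(2 * X), Int.fract v * (1 - Int.fract v) / v ^ 3
      = ∫ v in X..(2 * X), (∑ r ∈ Finset.Icc 1 M, 2 * max 0 (1 - (r : ℝ) / v) / v ^ 2
        - 1 / v + 1 / v ^ 2) := by
    refine intervalIntegral.integral_congr fun v hv => ?_
    have hv0 := hpos v hv
    rw [Set.uIcc_of_le hle] at hv
    exact fract_mul_one_sub_fract_div hv0 (Nat.floor_le_floor hv.2)
  have hderiv : ∀ v ∈ Set.uIcc X (2 * X),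
      HasDerivAt (fun v => truncSqSum M v - Real.log v - 1 / v)
        (∑ r ∈ Finset.Icc 1 M, 2 * max 0 (1 - (r : ℝ) / v) / v ^ 2 - 1 / v + 1 / v ^ 2) v := by
    intro v hv
    have hv0 := hpos v hv
    have h1 := ((hasDerivAt_truncSqSum M hv0).sub (Real.hasDerivAt_log hv0.ne')).sub
      (hasDerivAt_inv hv0.ne')
    simp only [one_div]
    exact h1.congr_deriv (by ring)
  have hcont : ContinuousOn (fun v : ℝ => ∑ r ∈ Finset.Icc 1 M, 2 * max 0 (1 - (r : ℝ) / v) / v ^ 2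
        - 1 / v + 1 / v ^ 2) (Set.uIcc X (2 * X)) := by
    have hne : ∀ v ∈ Set.uIcc X (2 * X), v ≠ 0 := fun v hv => (hpos v hv).ne'
    have hne2 : ∀ v ∈ Set.uIcc X (2 * X), v ^ 2 ≠ 0 := fun v hv => pow_ne_zero 2 (hne v hv)
    refine ContinuousOn.add (ContinuousOn.sub ?_ ?_) ?_
    · refine continuousOn_finsetSum _ fun r _ => ContinuousOn.div ?_ (by fun_prop) hne2
      refine continuousOn_const.mul (continuousOn_const.sup ?_)
      exact continuousOn_const.sub (continuousOn_const.div continuousOn_id hne)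
    · exact continuousOn_const.div continuousOn_id hne
    · exact continuousOn_const.div (by fun_prop) hne2
  rw [e1, intervalIntegral.integral_eq_sub_of_hasDerivAt hderiv hcont.intervalIntegrable,
    Real.log_mul two_ne_zero hX.ne']
  field_simp
  ring

/-! ### Counting pairs by distance -/

/-- Passing from `N` to `N + 1` adds `N - B` pairs in each order; truncated subtraction gives the
correct 0 when `N ≤ B`. -/
theorem sum_Icc_gap_count (N B : ℕ) :
    ∑ m ∈ Finset.Icc 1 N, ∑ n ∈ Finset.Icc 1 N, (if B < gap m n then 1 else 0)
      = (N - B) * (N - B - 1) := by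
  induction N with
  | zero => simp
  | succ N ih =>
    have h1 : ∑ n ∈ Finset.Icc 1 N, (if B < gap (N + 1) n then 1 else 0) = N - B := by
      rw [← Finset.card_filter]
      have : (Finset.Icc 1 N).filter (fun n => B < gap (N + 1) n) = Finset.Icc 1 (N - B) := by
        ext n
        rw [Finset.mem_filter, Finset.mem_Icc, Finset.mem_Icc]
        unfold gap
        omega
      rw [this, Nat.card_Icc, Nat.add_sub_cancel]
    have h2 : ∑ m ∈ Finset.Icc 1 N, (if B < gap m (N + 1) then 1 else 0) = N - B := by
      rw [← h1]; exact Finset.sum_congr rfl fun m _ => by rw [gap_comm]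
    rw [Finset.sum_Icc_succ_top (by omega), Finset.sum_Icc_succ_top (by omega), h1, gap_self]
    simp only [Finset.sum_Icc_succ_top (show 1 ≤ N + 1 by omega), Finset.sum_add_distrib, ih, h2]
    rcases lt_or_ge N B with h | h
    · have : N + 1 - B = 0 := by omega
      have : N - B = 0 := by omega
      simp_all
    · obtain ⟨k, rfl⟩ := Nat.exists_eq_add_of_le h
      have e1 : B + k - B = k := by omega
      have e2 : B + k + 1 - B = k + 1 := by omega
      rw [e1, e2]
      rcases k with _ | k
      · simp
      · simp; ring

/-- The number of pairs in `upTo x` at distance larger than `b`. -/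
def farPairs (x b : ℝ) : ℝ :=
  ∑ m ∈ upTo x, ∑ n ∈ upTo x, if b < (gap m n : ℝ) then 1 else 0

theorem abs_farPairs_sub_le {x b : ℝ} (hx : 1 ≤ x) (hb : 0 ≤ b) :
    |farPairs x b - max 0 (x - b) ^ 2| ≤ 3 * x := by
  have h1 : farPairs x b = (((⌊x⌋₊ - ⌊b⌋₊) * (⌊x⌋₊ - ⌊b⌋₊ - 1) : ℕ) : ℝ) := by
    rw [← sum_Icc_gap_count, farPairs, upTo]
    push_cast
    refine Finset.sum_congr rfl fun m _ => Finset.sum_congr rfl fun n _ => ?_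
    simp only [Nat.floor_lt hb]
  rw [h1]
  have f1 := Nat.floor_le (show 0 ≤ x by linarith)
  have f2 := Nat.lt_floor_add_one x
  have f3 := Nat.floor_le hb
  have f4 := Nat.lt_floor_add_one b
  rcases le_or_gt ⌊x⌋₊ ⌊b⌋₊ with h | h
  · have e1 : ⌊x⌋₊ - ⌊b⌋₊ = 0 := by omega
    rw [e1]
    have hR : (⌊x⌋₊ : ℝ) ≤ ⌊b⌋₊ := by exact_mod_cast h
    have h2 : max 0 (x - b) ≤ 1 := max_le zero_le_one (by linarith)
    have h3 : 0 ≤ max 0 (x - b) := le_max_left _ _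
    simp only [zero_mul, Nat.cast_zero, zero_sub, abs_neg]
    rw [abs_of_nonneg (sq_nonneg _)]
    nlinarith
  · have hR : (⌊b⌋₊ : ℝ) + 1 ≤ ⌊x⌋₊ := by exact_mod_cast h
    rw [Nat.cast_mul, Nat.cast_sub (by omega : 1 ≤ ⌊x⌋₊ - ⌊b⌋₊), Nat.cast_sub h.le, Nat.cast_one]
    set A : ℝ := (⌊x⌋₊ : ℝ) - ⌊b⌋₊
    have hbx : b ≤ x := by linarith
    rw [max_eq_right (by linarith : 0 ≤ x - b)]
    have hB : (0 : ℝ) ≤ ⌊b⌋₊ := by positivity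
    have hA1 : A < x - b + 1 := by simp only [A]; linarith
    have hA2 : x - b < A + 1 := by simp only [A]; linarith
    have hA3 : 1 ≤ A := by simp only [A]; linarith
    have hA4 : A ≤ x := by simp only [A]; linarith
    rw [abs_le]
    constructor <;> nlinarith

theorem sum_sum_dyadic_inv_eq {x Q : ℝ} (hQ : 0 < Q) :
    ∑ m ∈ upTo x, ∑ n ∈ upTo x, ∑ r ∈ dyadic (gapIndex Q m n), 1 / (r : ℝ)
      = ∑ r ∈ Finset.Icc 1 ⌊2 * x / Q⌋₊,
          1 / (r : ℝ) * (farPairs x (r * Q / 2) - farPairs x (r * Q)) := by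
  have h1 : ∀ m ∈ upTo x, ∀ n ∈ upTo x, ∑ r ∈ dyadic (gapIndex Q m n), 1 / (r : ℝ)
      = ∑ r ∈ Finset.Icc 1 ⌊2 * x / Q⌋₊, 1 / (r : ℝ) *
        ((if r * Q / 2 < (gap m n : ℝ) then 1 else 0) - if r * Q < (gap m n : ℝ) then 1 else 0) := by
    intro m hm n hn
    have h2 : dyadic (gapIndex Q m n) = (Finset.Icc 1 ⌊2 * x / Q⌋₊).filter
        (fun r : ℕ => r * Q / 2 < (gap m n : ℝ) ∧ ¬ r * Q < (gap m n : ℝ)) := by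
      ext r
      have hiff := mem_dyadic_ceil hQ (t := gap m n) (r := r)
      rw [Finset.mem_filter, Finset.mem_Icc, gapIndex, hiff, not_lt]
      have e : (r : ℝ) * Q / 2 < gap m n ↔ r * (Q / 2) < (gap m n : ℝ) := by rw [mul_div_assoc]
      have hgl := gap_lt hm hn
      constructor
      · intro h
        have h3 : (r : ℝ) * Q / 2 < gap m n := h.1
        refine ⟨⟨pos_of_mem_dyadic (hiff.2 h), Nat.le_floor ?_⟩, h3, by linarith [h.2]⟩
        rw [le_div_iff₀ hQ]; linarith
      · rintro ⟨-, h3, h4⟩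
        constructor <;> linarith
    rw [h2, Finset.sum_filter]
    refine Finset.sum_congr rfl fun r _ => ?_
    by_cases c1 : (r : ℝ) * Q < gap m n
    · have c2 : (r : ℝ) * Q / 2 < gap m n := by
        have : (0 : ℝ) ≤ r * Q := by positivity
        linarith
      simp [c1, c2]
    · by_cases c2 : (r : ℝ) * Q / 2 < gap m n <;> simp [c1, c2]
  rw [Finset.sum_congr rfl fun m hm => Finset.sum_congr rfl fun n hn => h1 m hm n hn]
  simp only [farPairs, mul_sub, Finset.mul_sum, Finset.sum_sub_distrib]
  congr 1
  · rw [Finset.sum_congr rfl fun m _ => Finset.sum_comm, Finset.sum_comm]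
  · rw [Finset.sum_congr rfl fun m _ => Finset.sum_comm, Finset.sum_comm]

/-- Interchange so that `r` is outermost: pairs at distance in `(rQ/2, rQ]` number `max(0, x -
rQ/2)² - max(0, x - rQ)²` up to `O(x)`. This is `x²` times the difference of `truncSqSum` terms at
`2x/Q` and `x/Q`, so the integral formula applies. The errors are summed against `1 / r`. -/
theorem abs_sum_sum_dyadicDefect_sub_le {x Q : ℝ} (hQ : 0 < Q) (hQx : Q ≤ x) (hx : 1 ≤ x) :
    |∑ m ∈ upTo x, ∑ n ∈ upTo x, dyadicDefect (gapIndex Q m n)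
        - x ^ 2 * ((∫ v in (x / Q)..(2 * x / Q), Int.fract v * (1 - Int.fract v) / v ^ 3)
          - Q / (2 * x))|
      ≤ 8 * x * (1 + Real.log (2 * x / Q)) := by
  have hx0 : 0 < x := by linarith
  have hX : 0 < x / Q := by positivity
  have h2X : 2 * x / Q = 2 * (x / Q) := mul_div_assoc _ _ _
  set M := ⌊2 * x / Q⌋₊ with hM
  have hone : 1 ≤ x / Q := (one_le_div hQ).2 hQx
  have hM1 : 1 ≤ M := Nat.le_floor (by rw [h2X]; push_cast; linarith)
  have hlogM : Real.log M ≤ Real.log (2 * x / Q) :=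
    Real.log_le_log (by exact_mod_cast hM1) (Nat.floor_le (by positivity))
  have hlog0 : 0 ≤ Real.log M := Real.log_natCast_nonneg _
  have e1 : ∑ m ∈ upTo x, ∑ n ∈ upTo x, dyadicDefect (gapIndex Q m n)
      = ∑ r ∈ Finset.Icc 1 M, 1 / (r : ℝ) * (farPairs x (r * Q / 2) - farPairs x (r * Q))
        - (⌊x⌋₊ : ℝ) ^ 2 * Real.log 2 := by
    rw [hM, ← sum_sum_dyadic_inv_eq hQ]
    simp only [dyadicDefect, Finset.sum_sub_distrib, Finset.sum_const, nsmul_eq_mul, upTo,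
      Nat.card_Icc, Nat.add_sub_cancel]
    ring
  have e2 : x ^ 2 * ((∫ v in (x / Q)..(2 * x / Q), Int.fract v * (1 - Int.fract v) / v ^ 3)
          - Q / (2 * x))
      = ∑ r ∈ Finset.Icc 1 M, 1 / (r : ℝ) * (max 0 (x - r * Q / 2) ^ 2 - max 0 (x - r * Q) ^ 2)
        - x ^ 2 * Real.log 2 := by
    have p : ∀ t : ℝ, max 0 (x - x * t) ^ 2 = x ^ 2 * max 0 (1 - t) ^ 2 := by
      intro t
      rw [show x - x * t = x * (1 - t) by ring, ← mul_zero x, ← mul_max_of_nonneg _ _ hx0.le,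
        mul_zero, mul_pow]
    have e3 : ∑ r ∈ Finset.Icc 1 M, 1 / (r : ℝ)
          * (max 0 (x - r * Q / 2) ^ 2 - max 0 (x - r * Q) ^ 2)
        = x ^ 2 * (truncSqSum M (2 * (x / Q)) - truncSqSum M (x / Q)) := by
      unfold truncSqSum
      rw [← Finset.sum_sub_distrib, Finset.mul_sum]
      refine Finset.sum_congr rfl fun r _ => ?_
      have q1 := p (r / (2 * (x / Q)))
      have q2 := p (r / (x / Q))
      have r1 : x * ((r : ℝ) / (2 * (x / Q))) = r * Q / 2 := by field_simp
      have r2 : x * ((r : ℝ) / (x / Q)) = r * Q := by field_simp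
      rw [r1] at q1
      rw [r2] at q2
      rw [q1, q2]; ring
    rw [e3, h2X, integral_fract_eq hX, hM, h2X]
    field_simp
    ring
  have f1 := Nat.floor_le hx0.le
  have f2 := Nat.lt_floor_add_one x
  have hl2 := Real.log_two_lt_d9
  have hl2' : 0 ≤ Real.log 2 := Real.log_nonneg (by norm_num)
  have e4 : ∑ m ∈ upTo x, ∑ n ∈ upTo x, dyadicDefect (gapIndex Q m n)
        - x ^ 2 * ((∫ v in (x / Q)..(2 * x / Q), Int.fract v * (1 - Int.fract v) / v ^ 3)
          - Q / (2 * x))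
      = ∑ r ∈ Finset.Icc 1 M, 1 / (r : ℝ) *
          ((farPairs x (r * Q / 2) - max 0 (x - r * Q / 2) ^ 2)
            - (farPairs x (r * Q) - max 0 (x - r * Q) ^ 2))
        + (x ^ 2 - (⌊x⌋₊ : ℝ) ^ 2) * Real.log 2 := by
    rw [e1, e2]
    have : ∀ r : ℕ, 1 / (r : ℝ) *
          ((farPairs x (r * Q / 2) - max 0 (x - r * Q / 2) ^ 2)
            - (farPairs x (r * Q) - max 0 (x - r * Q) ^ 2))
        = 1 / (r : ℝ) * (farPairs x (r * Q / 2) - farPairs x (r * Q))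
          - 1 / (r : ℝ) * (max 0 (x - r * Q / 2) ^ 2 - max 0 (x - r * Q) ^ 2) := fun r => by ring
    simp only [this, Finset.sum_sub_distrib]
    ring
  rw [e4]
  have b1 : |∑ r ∈ Finset.Icc 1 M, 1 / (r : ℝ) *
          ((farPairs x (r * Q / 2) - max 0 (x - r * Q / 2) ^ 2)
            - (farPairs x (r * Q) - max 0 (x - r * Q) ^ 2))| ≤ (1 + Real.log M) * (6 * x) := by
    calc _ ≤ ∑ r ∈ Finset.Icc 1 M, 1 / (r : ℝ) * (6 * x) := by
          refine (Finset.abs_sum_le_sum_abs _ _).trans (Finset.sum_le_sum fun r _ => ?_)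
          rw [abs_mul, abs_of_nonneg (by positivity : 0 ≤ 1 / (r : ℝ))]
          refine mul_le_mul_of_nonneg_left ?_ (by positivity)
          have q1 := abs_farPairs_sub_le hx (by positivity : 0 ≤ (r : ℝ) * Q / 2)
          have q2 := abs_farPairs_sub_le hx (by positivity : 0 ≤ (r : ℝ) * Q)
          exact (abs_sub _ _).trans (by linarith)
      _ ≤ _ := by
          rw [← Finset.sum_mul]
          exact mul_le_mul_of_nonneg_right (sum_Icc_inv_le M) (by positivity)
  have b2 : |(x ^ 2 - (⌊x⌋₊ : ℝ) ^ 2) * Real.log 2| ≤ 2 * x := by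
    have f0 : (0 : ℝ) ≤ ⌊x⌋₊ := by positivity
    have q1 : 0 ≤ x ^ 2 - (⌊x⌋₊ : ℝ) ^ 2 := by nlinarith
    have q2 : x ^ 2 - (⌊x⌋₊ : ℝ) ^ 2 ≤ 2 * x := by nlinarith
    rw [abs_of_nonneg (by positivity)]
    nlinarith
  calc _ ≤ (1 + Real.log M) * (6 * x) + 2 * x := (abs_add_le _ _).trans (add_le_add b1 b2)
    _ ≤ _ := by nlinarith

/-! ### Power-saving errors and the conclusion -/

theorem abs_card_dyadic_sub_le {Q : ℝ} (hQ : 0 ≤ Q) :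
    |((dyadic (⌊Q⌋₊ + 1)).card : ℝ) - Q / 2| ≤ 1 := by
  have h1 : dyadic (⌊Q⌋₊ + 1) = Finset.Ico ((⌊Q⌋₊ + 2) / 2) (⌊Q⌋₊ + 1) := by
    ext r; rw [mem_dyadic, Finset.mem_Ico]; omega
  rw [h1, Nat.card_Ico]
  have f1 := Nat.floor_le hQ
  have f2 := Nat.lt_floor_add_one Q
  obtain ⟨k, hk⟩ : ∃ k, ⌊Q⌋₊ + 1 - (⌊Q⌋₊ + 2) / 2 = k := ⟨_, rfl⟩
  rw [hk]
  have g1 : 2 * k ≤ ⌊Q⌋₊ + 1 := by omega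
  have g2 : ⌊Q⌋₊ ≤ 2 * k := by omega
  have g1' : 2 * (k : ℝ) ≤ ⌊Q⌋₊ + 1 := by exact_mod_cast g1
  have g2' : (⌊Q⌋₊ : ℝ) ≤ 2 * k := by exact_mod_cast g2
  rw [abs_le]
  constructor <;> linarith

theorem log_le_forty_mul_rpow {x : ℝ} (hx : 0 ≤ x) : Real.log x ≤ 40 * x ^ (1 / 40 : ℝ) := by
  have := Real.log_le_rpow_div hx (show (0 : ℝ) < 1 / 40 by norm_num)
  linarith

theorem sum_norm_mul_le {a : ℕ → ℂ} {x B : ℝ} {f : ℕ → ℕ} (hf : ∀ n ∈ upTo x, (f n : ℝ) ≤ B) :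
    ∑ n ∈ upTo x, ‖a n‖ * (f n : ℝ) ≤ absTotal a x * B := by
  unfold absTotal
  rw [Finset.sum_mul]
  exact Finset.sum_le_sum fun n hn => mul_le_mul_of_nonneg_left (hf n hn) (norm_nonneg _)

namespace Admissible

variable {a : ℕ → ℂ} {x Q P R K₁ K₂ K₃ : ℝ}

theorem sqrt_le (H : Admissible a x Q P R K₁ K₂ K₃) : x ^ (1 / 2 : ℝ) ≤ Q := by
  rw [← Real.sqrt_eq_rpow]
  exact Real.sqrt_le_iff.2 ⟨H.Q_pos.le, by nlinarith [H.lt_sq, H.x_pos]⟩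

theorem log_le (H : Admissible a x Q P R K₁ K₂ K₃) :
    Real.log (P * x / Q) ≤ 2 * Real.log x := by
  have hx := H.x_pos
  have h1 : P * x / Q ≤ x * x := by
    rw [div_le_iff₀ H.Q_pos]
    have hQ1 : 1 ≤ Q := by nlinarith [H.lt_sq, H.large, H.Q_pos]
    have h2 : P * x ≤ x * x := mul_le_mul_of_nonneg_right H.P_le_x hx.le
    nlinarith [mul_pos hx hx]
  have h3 := Real.log_le_log (by linarith [H.P_le, H.three_le]) h1
  rw [Real.log_mul hx.ne' hx.ne'] at h3
  linarith

/-- Power savings are absorbed by the non-concentration term. -/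
theorem sq_mul_rpow_le (H : Admissible a x Q P R K₁ K₂ K₃) {K : ℝ → ℝ}
    (hK : NonConcentration a x Q K) :
    absTotal a x ^ 2 * x ^ (-(1 / 10) : ℝ)
      ≤ absTotal a x ^ 2 * (Real.log x / (P * Real.log P * K 1)) := by
  have hx := H.x_pos
  have hP := H.three_le
  have hl := H.one_le_log_P
  have hlx := H.one_le_log_x
  have hQ1 : 1 ≤ Q := by nlinarith [H.lt_sq, H.large, H.Q_pos]
  -- The term `h = 1` of Non-concentration, so that `1 / K 1` costs nothing as a factor.
  have h1 : absTotal a x ^ 2 ≤ absTotal a x ^ 2 / K 1 := by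
    refine le_trans ?_ (hK 1 hQ1)
    have h2 : absTotal a x ^ 2 = multTotal a x 1 ^ 2 := by rw [multTotal_one]
    rw [h2]
    exact Finset.single_le_sum (f := fun h => multTotal a x h ^ 2) (fun _ _ => sq_nonneg _)
      (Finset.mem_filter.2 ⟨mem_upTo.2 ⟨le_rfl, by simpa using hQ1⟩, by simp⟩)
  have h2 : x ^ (-(1 / 10) : ℝ) ≤ Real.log x / (P * Real.log P) := by
    rw [Real.rpow_neg hx.le, le_div_iff₀ (by positivity), inv_mul_le_iff₀ (by positivity)]
    exact mul_le_mul (H.le_R.trans H.R_le) H.log_P_le_log_x (by linarith) (by positivity)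
  calc _ ≤ absTotal a x ^ 2 / K 1 * (Real.log x / (P * Real.log P)) :=
        mul_le_mul h1 h2 (by positivity) ((sq_nonneg _).trans h1)
    _ = _ := by rw [← div_div]; ring

end Admissible

/-- All errors that do not match a stated term save a fixed power of `x`, because `R * P ≤ x^(1/5)`,
`Q ≥ x^(1/2)` and divisor functions are small powers. -/
theorem exists_error_terms_le :
    ∃ C : ℝ, 0 < C ∧ ∀ (a : ℕ → ℂ) (x Q P R K₁ K₂ K₃ : ℝ), Admissible a x Q P R K₁ K₂ K₃ →
      absTotal a x * Real.log (P * x / Q) ^ 2 * Real.log x * (R * P / Real.sqrt x)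
          * ∑ n ∈ upTo x, ‖a n‖ * (tau3 n : ℝ)
        + absTotal a x * (P * Real.log x / Q) * ∑ n ∈ upTo x, ‖a n‖ * (tau n : ℝ)
        + absTotal a x ^ 2 * ((1 + Real.log (2 * x / Q)) / x)
      ≤ C * (absTotal a x ^ 2 * x ^ (-(1 / 10) : ℝ)) := by
  obtain ⟨C, hC, hτ⟩ := exists_tau_le_rpow
  have hC0 : 0 < C := by linarith
  -- `256000 = 80² * 40` from three logarithms, each bounded through `log x ≤ 40 * x ^ (1/40)`.
  refine ⟨256000 * C ^ 2 + 40 * C + 80, by positivity, fun a x Q P R K₁ K₂ K₃ H => ?_⟩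
  have hx := H.x_pos
  have hx1 : 1 ≤ x := by linarith [H.large]
  have hQ := H.Q_pos
  have hP := H.three_le
  have hR := H.le_R
  have hlx := H.one_le_log_x
  have hL := H.one_le_log
  have hLx := H.log_le
  have hN := absTotal_nonneg a x
  have hlog := log_le_forty_mul_rpow hx.le
  have hτx : ∀ n ∈ upTo x, (tau n : ℝ) ≤ C * x ^ (1 / 16 : ℝ) := fun n hn => by
    obtain ⟨h1, h2⟩ := mem_upTo.1 hn
    refine (hτ n (by omega)).trans ?_
    gcongr
  have hτ3x : ∀ n ∈ upTo x, (tau3 n : ℝ) ≤ C ^ 2 * x ^ (1 / 8 : ℝ) := fun n hn => by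
    have h1 : (tau3 n : ℝ) ≤ (tau n : ℝ) ^ 2 := by exact_mod_cast tau3_le_tau_sq (by
      have := (mem_upTo.1 hn).1; omega : n ≠ 0)
    calc _ ≤ (C * x ^ (1 / 16 : ℝ)) ^ 2 := h1.trans (by gcongr; exact hτx n hn)
      _ = _ := by
          rw [mul_pow, ← Real.rpow_natCast (x ^ (1 / 16 : ℝ)), ← Real.rpow_mul hx.le]
          norm_num
  have hW := sum_norm_mul_le (a := a) hτ3x
  have hY := sum_norm_mul_le (a := a) hτx
  set N := absTotal a x
  have pw : ∀ {s t : ℝ}, s ≤ t → x ^ s ≤ x ^ t := fun h => Real.rpow_le_rpow_of_exponent_le hx1 h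
  have hPx : P ≤ x ^ (1 / 10 : ℝ) := hR.trans H.R_le
  have b1 : N * Real.log (P * x / Q) ^ 2 * Real.log x * (R * P / Real.sqrt x)
          * ∑ n ∈ upTo x, ‖a n‖ * (tau3 n : ℝ)
        ≤ 256000 * C ^ 2 * (N ^ 2 * x ^ (-(1 / 10) : ℝ)) := by
    have hR0 : 0 ≤ R * P := mul_nonneg (by linarith) (by linarith)
    calc _ ≤ N * (2 * (40 * x ^ (1 / 40 : ℝ))) ^ 2 * (40 * x ^ (1 / 40 : ℝ))
          * (x ^ (1 / 5 : ℝ) / x ^ (1 / 2 : ℝ)) * (N * (C ^ 2 * x ^ (1 / 8 : ℝ))) := by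
          rw [Real.sqrt_eq_rpow]
          have hRP := H.R_mul_P_le
          gcongr
          linarith
      _ = 256000 * C ^ 2 * (N ^ 2 * (x ^ (1 / 40 : ℝ) * x ^ (1 / 40 : ℝ) * x ^ (1 / 40 : ℝ)
          * x ^ (1 / 5 : ℝ) * x ^ (-(1 / 2) : ℝ) * x ^ (1 / 8 : ℝ))) := by
          rw [Real.rpow_neg hx.le]; ring
      -- The exponents `3/40 + 1/5 - 1/2 + 1/8` add up to exactly `-1/10`.
      _ = _ := by
          rw [← Real.rpow_add hx, ← Real.rpow_add hx, ← Real.rpow_add hx, ← Real.rpow_add hx,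
            ← Real.rpow_add hx]
          norm_num
  have b2 : N * (P * Real.log x / Q) * ∑ n ∈ upTo x, ‖a n‖ * (tau n : ℝ)
        ≤ 40 * C * (N ^ 2 * x ^ (-(1 / 10) : ℝ)) := by
    calc _ ≤ N * (x ^ (1 / 10 : ℝ) * (40 * x ^ (1 / 40 : ℝ)) / x ^ (1 / 2 : ℝ))
          * (N * (C * x ^ (1 / 16 : ℝ))) := by
          have := H.sqrt_le
          gcongr
      _ = 40 * C * (N ^ 2 * (x ^ (1 / 10 : ℝ) * x ^ (1 / 40 : ℝ) * x ^ (-(1 / 2) : ℝ)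
          * x ^ (1 / 16 : ℝ))) := by
          rw [Real.rpow_neg hx.le]; ring
      _ ≤ _ := by
          rw [← Real.rpow_add hx, ← Real.rpow_add hx, ← Real.rpow_add hx]
          gcongr
          norm_num
  have b3 : N ^ 2 * ((1 + Real.log (2 * x / Q)) / x) ≤ 80 * (N ^ 2 * x ^ (-(1 / 10) : ℝ)) := by
    have h1 : Real.log (2 * x / Q) ≤ Real.log x := by
      refine Real.log_le_log (by positivity) ?_
      rw [div_le_iff₀ hQ]
      have : 2 ≤ Q := by nlinarith [H.lt_sq, H.large]
      nlinarith
    calc _ ≤ N ^ 2 * (2 * (40 * x ^ (1 / 40 : ℝ)) / x ^ (1 : ℝ)) := by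
          rw [Real.rpow_one]
          gcongr
          linarith
      _ = 80 * (N ^ 2 * (x ^ (1 / 40 : ℝ) * x ^ (-1 : ℝ))) := by
          rw [Real.rpow_neg hx.le]; ring
      _ ≤ _ := by
          rw [← Real.rpow_add hx]
          gcongr
          norm_num
  linarith

set_option maxHeartbeats 1600000 in
theorem exists_abs_variance_sub_le :
    ∃ C : ℝ, 0 < C ∧ ∀ (a : ℕ → ℂ) (x Q P R K₁ K₂ K₃ Kprog : ℝ) (K : ℝ → ℝ),
      Admissible a x Q P R K₁ K₂ K₃ → 0 < Kprog → ProgressionsCondition a x Q Kprog →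
      NonConcentration a x Q K →
      |variance a x Q - (Q / 2 * ∑ n ∈ upTo x, ‖a n‖ ^ 2 - Q / 2 * (‖total a x‖ ^ 2 / x)
          + ‖total a x‖ ^ 2 *
            ∫ v in (x / Q)..(2 * x / Q), Int.fract v * (1 - Int.fract v) / v ^ 3)|
      ≤ C * (∑ n ∈ upTo x, ‖a n‖ ^ 2 * (tau n : ℝ)
          + absTotal a x ^ 2 * (1 / Kprog + Real.log x / (P * Real.log P * K 1)
            + Real.log P / K₁ * Real.sqrt (Q / (x * K (2 * x / Q))))
          + absTotal a x * Real.log (P * x / Q) ^ 6 *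
            (Q / (x * K₁) * ∑ n ∈ upTo x, ‖a n‖ * (tau3Smooth (P * x / Q) n : ℝ)
              + Real.log x ^ 3 * (R * P / K₂ + Q * K₃ / (x * R ^ (1 / Real.log P))) *
                ∑ n ∈ upTo x, ‖a n‖ * (tau3 n : ℝ))) := by
  obtain ⟨C₁, hC₁, h₁⟩ := exists_norm_bilinear_sub_le
  obtain ⟨C₂, hC₂, h₂⟩ := exists_error_terms_le
  refine ⟨1 + 4 + C₁ + (C₁ + 8) * C₂, by positivity,
    fun a x Q P R K₁ K₂ K₃ Kprog K H hKp hprog hK => ?_⟩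
  have hx := H.x_pos
  have hx1 : 1 ≤ x := by linarith [H.large]
  have hQ := H.Q_pos
  have hP := H.three_le
  have hR : 0 < R := by linarith [H.le_R]
  have hK₁ := H.K₁_pos
  have hK₂ := H.K₂_pos
  have hK₃ := H.one_le_K₃
  have hlP := H.one_le_log_P
  have hlPL := H.log_P_le
  have hlx := H.one_le_log_x
  have hL := H.one_le_log
  have hN := absTotal_nonneg a x
  have b₁ := h₁ a x Q P R K₁ K₂ K₃ K H hK
  have b₂ := h₂ a x Q P R K₁ K₂ K₃ H
  have b₃ := H.sq_mul_rpow_le hK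
  have b₄ := norm_sum_progression_error_le hQ hprog
  have b₅ := abs_sum_sum_dyadicDefect_sub_le hQ H.Q_le hx1
  have b₆ := abs_card_dyadic_sub_le hQ.le
  have hV := variance_eq a x hQ
  set I := ∫ v in (x / Q)..(2 * x / Q), Int.fract v * (1 - Int.fract v) / v ^ 3
  set L := Real.log (P * x / Q)
  set N := absTotal a x
  set U := ∑ n ∈ upTo x, ‖a n‖ * (tau3Smooth (P * x / Q) n : ℝ)
  set W := ∑ n ∈ upTo x, ‖a n‖ * (tau3 n : ℝ)
  set Y := ∑ n ∈ upTo x, ‖a n‖ * (tau n : ℝ)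
  set A := ∑ n ∈ upTo x, ‖a n‖ ^ 2 with hA
  set D := ∑ n ∈ upTo x, ‖a n‖ ^ 2 * (tau n : ℝ)
  set G := ∑ m ∈ upTo x, ∑ n ∈ upTo x, dyadicDefect (gapIndex Q m n)
  set s := ‖total a x‖ ^ 2 with hs
  set B := ∑ m ∈ upTo x, ∑ n ∈ upTo x, a m * conj (a n) * (pairWeight Q m n : ℂ)
  set E := ∑ m ∈ upTo x, a m * ∑ n ∈ upTo x, conj (a n) * ∑ r ∈ dyadic (gapIndex Q m n),
          ((if n ≡ m [MOD r] then (1 : ℂ) else 0) - (gcdWeight r m n : ℂ))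
  set q : ℝ := ((dyadic (⌊Q⌋₊ + 1)).card : ℝ)
  have hU : 0 ≤ U := Finset.sum_nonneg fun _ _ => by positivity
  have hW : 0 ≤ W := Finset.sum_nonneg fun _ _ => by positivity
  have hY : 0 ≤ Y := Finset.sum_nonneg fun _ _ => by positivity
  have hA0 : 0 ≤ A := Finset.sum_nonneg fun _ _ => by positivity
  have hAD : A ≤ D := Finset.sum_le_sum fun n hn => by
    have h1 : (1 : ℝ) ≤ tau n := by
      exact_mod_cast one_le_tau (by have := (mem_upTo.1 hn).1; omega : n ≠ 0)
    exact le_mul_of_one_le_right (by positivity) h1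
  have hsN : s ≤ N ^ 2 := pow_le_pow_left₀ (norm_nonneg _) (norm_total_le a x) 2
  have hs0 : 0 ≤ s := sq_nonneg _
  -- Four errors: the count of moduli against `Q / 2`, the bilinear form against its value for a
  -- constant sequence, that value against the integral, and the progressions.
  have hid : ((variance a x Q - (Q / 2 * A - Q / 2 * (s / x) + s * I) : ℝ) : ℂ)
      = (((q - Q / 2) * A : ℝ) : ℂ) + (B - ((s / x ^ 2 * G : ℝ) : ℂ))
        + ((s / x ^ 2 * (G - x ^ 2 * (I - Q / (2 * x))) : ℝ) : ℂ) + E := by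
    have e1 : s / x ^ 2 * (G - x ^ 2 * (I - Q / (2 * x)))
        = s / x ^ 2 * G - (s * I - Q / 2 * (s / x)) := by field_simp
    rw [e1]
    push_cast
    have hq : (q : ℂ) = ((dyadic (⌊Q⌋₊ + 1)).card : ℂ) := Complex.ofReal_natCast _
    rw [hV, hA, hq]
    push_cast
    ring
  have hnorm : |variance a x Q - (Q / 2 * A - Q / 2 * (s / x) + s * I)|
      ≤ |(q - Q / 2) * A| + ‖B - ((s / x ^ 2 * G : ℝ) : ℂ)‖
        + |s / x ^ 2 * (G - x ^ 2 * (I - Q / (2 * x)))| + ‖E‖ := by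
    rw [← Real.norm_eq_abs, ← Complex.norm_real, hid]
    refine (norm_add_le _ _).trans (add_le_add ((norm_add₃_le ..).trans (le_of_eq ?_)) le_rfl)
    rw [Complex.norm_real, Complex.norm_real, Real.norm_eq_abs, Real.norm_eq_abs]
  have c1 : |(q - Q / 2) * A| ≤ D := by
    rw [abs_mul, abs_of_nonneg hA0]
    nlinarith
  have c3 : |s / x ^ 2 * (G - x ^ 2 * (I - Q / (2 * x)))|
      ≤ 8 * (N ^ 2 * ((1 + Real.log (2 * x / Q)) / x)) := by
    rw [abs_mul, abs_of_nonneg (by positivity)]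
    calc _ ≤ N ^ 2 / x ^ 2 * (8 * x * (1 + Real.log (2 * x / Q))) :=
          mul_le_mul (div_le_div_of_nonneg_right hsN (by positivity)) b₅ (abs_nonneg _)
            (by positivity)
      _ = _ := by field_simp
  have c4 : N * L ^ 4 * (Q / (x * K₁) * U) ≤ N * L ^ 6 * (Q / (x * K₁) * U) := by
    have : L ^ 4 ≤ L ^ 6 := pow_le_pow_right₀ hL (by norm_num)
    gcongr
  -- Two terms of `tailBound` have the stated shape once `log P ≤ L` is used; the `1 / √x` term is
  -- set aside for the power saving.
  have c5 : L ^ 2 * tailBound N x P R K₂ K₃ Q * W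
      ≤ N * L ^ 6 * (Real.log x ^ 3 * (R * P / K₂ + Q * K₃ / (x * R ^ (1 / Real.log P))) * W)
        + N * L ^ 2 * Real.log x * (R * P / Real.sqrt x) * W := by
    set M₁ := R * P / K₂
    set M₂ := Q * K₃ / (x * R ^ (1 / Real.log P))
    have hM₁ : 0 ≤ M₁ := by positivity
    have hM₂ : 0 ≤ M₂ := by positivity
    have e1 : L ^ 2 * tailBound N x P R K₂ K₃ Q * W
        = N * W * Real.log x * (L ^ 2 * M₁ + L ^ 2 * Real.log P ^ 2 * M₂)
          + N * L ^ 2 * Real.log x * (R * P / Real.sqrt x) * W := by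
      simp only [tailBound, M₁, M₂]; ring
    rw [e1]
    refine add_le_add ?_ le_rfl
    have q1 : L ^ 2 ≤ L ^ 6 := pow_le_pow_right₀ hL (by norm_num)
    have q2 : L ^ 2 * Real.log P ^ 2 ≤ L ^ 6 := by
      calc _ ≤ L ^ 2 * L ^ 2 := by gcongr
        _ = L ^ 4 := by ring
        _ ≤ _ := pow_le_pow_right₀ hL (by norm_num)
    have q3 : Real.log x ≤ Real.log x ^ 3 := le_self_pow₀ hlx (by norm_num)
    calc _ ≤ N * W * Real.log x ^ 3 * (L ^ 6 * M₁ + L ^ 6 * M₂) := by gcongr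
      _ = _ := by ring
  set X₁ := N * L ^ 6 * (Q / (x * K₁) * U) with hX₁
  set X₂ := N * L ^ 6 * (Real.log x ^ 3 * (R * P / K₂ + Q * K₃ / (x * R ^ (1 / Real.log P))) * W)
    with hX₂
  set Z₁ := N ^ 2 * (Real.log x / (P * Real.log P * K 1)) with hZ₁
  set Z₂ := N ^ 2 * (Real.log P / K₁ * Real.sqrt (Q / (x * K (2 * x / Q)))) with hZ₂
  set Y₁ := N * L ^ 2 * Real.log x * (R * P / Real.sqrt x) * W
  set Y₂ := N * (P * Real.log x / Q) * Y
  set Y₃ := N ^ 2 * ((1 + Real.log (2 * x / Q)) / x)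
  have e2 : N ^ 2 * (Real.log x / (P * Real.log P * K 1)
            + Real.log P / K₁ * Real.sqrt (Q / (x * K (2 * x / Q)))) = Z₁ + Z₂ := mul_add _ _ _
  have e3 : D + N ^ 2 * (1 / Kprog + Real.log x / (P * Real.log P * K 1)
            + Real.log P / K₁ * Real.sqrt (Q / (x * K (2 * x / Q))))
          + N * L ^ 6 * (Q / (x * K₁) * U
              + Real.log x ^ 3 * (R * P / K₂ + Q * K₃ / (x * R ^ (1 / Real.log P))) * W)
      = D + (N ^ 2 / Kprog + Z₁ + Z₂) + (X₁ + X₂) := by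
    rw [hX₁, hX₂, hZ₁, hZ₂]; ring
  rw [e3]
  rw [e2] at b₁
  have hD0 : 0 ≤ D := hA0.trans hAD
  have hX₁0 : 0 ≤ X₁ := by positivity
  have hX₂0 : 0 ≤ X₂ := by positivity
  have hZ₁0 : 0 ≤ Z₁ := le_trans (by positivity) b₃
  have hZ₂0 : 0 ≤ Z₂ := by positivity
  have hY₁0 : 0 ≤ Y₁ := by positivity
  have hY₂0 : 0 ≤ Y₂ := by positivity
  have hY₃0 : 0 ≤ Y₃ := by
    have : 0 ≤ Real.log (2 * x / Q) := by
      refine Real.log_nonneg ?_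
      rw [one_le_div hQ]; linarith [H.Q_le]
    positivity
  have hprog0 : 0 ≤ N ^ 2 / Kprog := by positivity
  have d1 : Y₁ + Y₂ + Y₃ ≤ C₂ * Z₁ := b₂.trans (mul_le_mul_of_nonneg_left b₃ hC₂.le)
  have d2 : ‖B - ((s / x ^ 2 * G : ℝ) : ℂ)‖ ≤ C₁ * (X₁ + X₂ + Z₁ + Z₂) + C₁ * (Y₁ + Y₂) := by
    refine b₁.trans ?_
    rw [← mul_add C₁]
    exact mul_le_mul_of_nonneg_left (by linarith) hC₁.le
  have d3 : C₁ * (Y₁ + Y₂) + 8 * Y₃ ≤ (C₁ + 8) * C₂ * Z₁ := by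
    calc _ ≤ (C₁ + 8) * (Y₁ + Y₂ + Y₃) := by
          have := mul_nonneg hC₁.le hY₃0
          linarith
      _ ≤ (C₁ + 8) * (C₂ * Z₁) := mul_le_mul_of_nonneg_left d1 (by positivity)
      _ = _ := by ring
  have hC₂' : 0 ≤ (C₁ + 8) * C₂ := by positivity
  set Γ := (C₁ + 8) * C₂
  clear_value X₁ X₂ Z₁ Z₂ Y₁ Y₂ Y₃ D Γ
  calc _ ≤ D + (C₁ * (X₁ + X₂ + Z₁ + Z₂) + Γ * Z₁) + 4 * (N ^ 2 / Kprog) := by linarith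
    _ ≤ _ := by
        have p1 := mul_nonneg hC₁.le hD0
        have p2 := mul_nonneg hC₁.le hprog0
        have p3 := mul_nonneg hC₂' hD0
        have p4 := mul_nonneg hC₂' hprog0
        have p5 := mul_nonneg hC₂' hZ₂0
        have p6 := mul_nonneg hC₂' hX₁0
        have p7 := mul_nonneg hC₂' hX₂0
        linarith

end

end APVariance

theorem theorem2 :
    ∃ C x₀ : ℝ, 0 < C ∧ 0 < x₀ ∧
      ∀ (x Q : ℝ) (a : ℕ → ℂ) (Kprog : ℝ) (Kconc : ℝ → ℝ) (P R K₁ K₂ K₃ : ℝ),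
        x₀ ≤ x → Real.sqrt (2 * x) < Q → Q ≤ x →
        0 < Kprog → APVariance.ProgressionsCondition a x Q Kprog →
        (∀ H : ℝ, H ≤ Q → 0 < Kconc H) → APVariance.NonConcentration a x Q Kconc →
        3 ≤ P → P ≤ R → R ≤ x ^ (1 / 10 : ℝ) →
        0 < K₁ → 0 < K₂ → 1 ≤ K₃ →
        APVariance.ResemblesIntegersI a x P K₁ K₂ →
        APVariance.ResemblesIntegersII a x K₂ K₃ →
        |APVariance.variance a x Q
            - (Q / 2 * ∑ n ∈ APVariance.upTo x, ‖a n‖ ^ 2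
              - Q / 2 * (‖APVariance.total a x‖ ^ 2 / x)
              + ‖APVariance.total a x‖ ^ 2 *
                  ∫ v in (x / Q)..(2 * x / Q), Int.fract v * (1 - Int.fract v) / v ^ 3)|
          ≤ C * (∑ n ∈ APVariance.upTo x, ‖a n‖ ^ 2 * (APVariance.tau n : ℝ)
              + APVariance.absTotal a x ^ 2 *
                  (1 / Kprog
                    + Real.log x / (P * Real.log P * Kconc 1)
                    + Real.log P / K₁ * Real.sqrt (Q / (x * Kconc (2 * x / Q))))
              + APVariance.absTotal a x * Real.log (P * x / Q) ^ 6 *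
                  (Q / (x * K₁) *
                      ∑ n ∈ APVariance.upTo x,
                        ‖a n‖ * (APVariance.tau3Smooth (P * x / Q) n : ℝ)
                    + Real.log x ^ 3 *
                        (R * P / K₂ + Q * K₃ / (x * R ^ (1 / Real.log P))) *
                        ∑ n ∈ APVariance.upTo x, ‖a n‖ * (APVariance.tau3 n : ℝ))) := by
  obtain ⟨C, hC, h⟩ := APVariance.exists_abs_variance_sub_le
  -- Here `x₀ = 1` is enough, since `3 ≤ P ≤ R ≤ x ^ (1/10)` already forces `x` to be large.
  refine ⟨C, 1, hC, one_pos, ?_⟩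
  intro x Q a Kprog Kconc P R K₁ K₂ K₃ hx hQ hQx hKprog hprog _ hconc hP hPR hR hK₁ hK₂ hK₃ hI hII
  have hQ0 : 0 < Q := (Real.sqrt_nonneg _).trans_lt hQ
  exact h a x Q P R K₁ K₂ K₃ Kprog Kconc
    ⟨hP, hPR, hR, hQ0, by nlinarith [Real.lt_sq_of_sqrt_lt hQ], hQx, hK₁, hK₂, hK₃, hI, hII⟩
    hKprog hprog hconc
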